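/- Let $n_1,n_2\ge 0$ and $n=n_1+n_2$. Write $\theta=(x,z)\in\mathbb{R}^{n_1}\times\mathbb{R}^{n_2}=\mathbb{R}^n$, let $|\cdot|$ be the Euclidean norm, $\mathbb{B}$ the closed unit ball and $\mathbb{R}_+=[0,\infty)$. **Hybrid systems.** A compact hybrid time domain is a set $\bigcup_{j=0}^{J-1}[t_j,t_{j+1}]\times\{j\}$ with $J\ge1$ and $0=t_0\le t_1\le\dots\le t_J$; a hybrid time domain is a set $E\subset\mathbb{R}_+\times\mathbb{Z}_{\ge0}$ such that $E\cap([0,t]\times\{0,\dots,j\})$ is a compact hybrid time domain for each $(t,j)\in E$. A hybrid arc is a function $\xi$ on a hybrid time domain $\mathrm{dom}\,\xi$ such that $\xi(\cdot,j)$ is locally absolutely continuous on $I_j=\{t:(t,j)\in\mathrm{dom}\,\xi\}$ whenever $I_j$ has nonempty interior. It is a solution (not necessarily maximal) of the hybrid system $(C,F,D,G)$ if $(0,0)\in\mathrm{dom}\,\xi$ and $\xi(0,0)\in C\cup D$; for each $j$ such that $I_j$ has nonempty interior, $\xi(t,j)\in C$ for all $t\in I_j$ and $\dot\xi(t,j)\in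 F(\xi(t,j))$ for almost all $t\in I_j$; and $\xi(t,j)\in D$, $\xi(t,j+1)\in G(\xi(t,j))$ whenever $(t,j),(t,j+1)\in\mathrm{dom}\,\xi$. It has no finite escape time if it is bounded or $t+j$ is unbounded on $\mathrm{dom}\,\xi$. Two hybrid arcs $\xi,\eta$ are $(T,\rho)$-close if for each $(t,j)\in\mathrm{dom}\,\xi$ with $t+j\le T$ there is $s$ with $(s,j)\in\mathrm{dom}\,\eta$, $|t-s|\le\rho$ and $|\xi(t,j)-\eta(s,j)|\le\rho$, and the same holds with $\xi$ and $\eta$ exchanged. **The system.** For $\varepsilon>0$ consider the hybrid system with state $(\theta,\tau_1,\tau_2)\in\mathbb{R}^n\times\mathbb{R}^2$, flow set $C\times\mathbb{R}_+^2$, jump set $D\times\mathbb{R}_+^2$, and $$\dot x=\varepsilon^{-1}\phi_1(\theta,\tau_1,\tau_2)+\phi_2(\theta,\tau_1,\tau_2),\quad \dot z\in\Phi(z),\quad \dot\tau_1=\varepsilon^{-1},\quad \dot\tau_2=\varepsilon^{-2},\qquad\qquad \theta^+\in G(\theta),\quad \tau^+=\tau. \qquad (1)$$ **Assumptions.** The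 sets $C,D\subset\mathbb{R}^n$ are closed; $(x,z)\mapsto\Phi(z)$ is outer semicontinuous and locally bounded relative to $C$, with nonempty convex values on $C$; $G$ is outer semicontinuous and locally bounded relative to $D$, with nonempty values on $D$. There are $T_1,T_2>0$ and an open $\delta$-neighbourhood $U$ of $C$, $\delta>0$, such that on $U\times\mathbb{R}_+^2$: (a) $\phi_1$ and $\phi_2$ are locally Lipschitz in $(x,z,\tau_1)$, locally uniformly in $\tau_2$, and continuous in $\tau_2$; $\phi_1$ is differentiable in $(x,\tau_1)$ and this derivative is locally Lipschitz in $(x,\tau_1)$, locally uniformly in $(z,\tau_2)$; (b) $\phi_1$ and $\phi_2$ are $T_1$-periodic in $\tau_1$ and $T_2$-periodic in $\tau_2$; (c) $\int_0^{T_2}\phi_1(\theta,\tau_1,s)\,ds=0$. **The average system.** Put $u_1(\theta,\tau)=\int_0^{\tau_2}\phi_1(\theta,\tau_1,s)\,ds$, $[u_1,\phi_1]_x=\partial_x\phi_1\cdot u_1-\partial_xu_1\cdot\phi_1$ and $$\bar f(\theta)=\frac1{T_1T_2}\int_0^{T_1}\!\!\int_0^{T_2}\Big(\phi_2(\theta,\tau)+\tfrac12[u_1,\phi_1]_x(\theta,\tau)\Big)\,d\tau_2\,d\tau_1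 .$$ The second-order average system $\mathcal{H}_2^{\mathrm{ave}}$ is the hybrid system $(C,F,D,G)$ with $F(\theta)=\{\bar f(\theta)\}\times\Phi(z)$. **Theorem.** Let $K_0\subset\mathbb{R}^n$ be a compact set such that no solution of $\mathcal{H}_2^{\mathrm{ave}}$ starting in $K_0$ has a finite escape time. Then for all $\rho>0$ and $T>0$ there are $\varepsilon^*>0$ and $r>0$ such that for each $\varepsilon\in(0,\varepsilon^*)$ and each solution $(\theta,\tau)$ of (1) with $\theta(0,0)\in K_0+r\mathbb{B}$, the arc $\theta$ is $(T,\rho)$-close to some solution of $\mathcal{H}_2^{\mathrm{ave}}$ starting in $K_0$. In particular this holds for every solution of (1) with $\theta(0,0)\in K_0$. -/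

import Mathlib

open Set Filter Topology MeasureTheory
open scoped Pointwise

namespace HybridAveraging

/-! ### Hybrid time domains, hybrid arcs and hybrid systems -/

/-- A compact hybrid time domain: `⋃_{j < J} [t_j, t_{j+1}] × {j}` with
`0 = t_0 ≤ t_1 ≤ ⋯ ≤ t_J` and `J ≥ 1`. -/
def IsCompactHybridTimeDomain (E : Set (ℝ × ℕ)) : Prop :=
  ∃ (J : ℕ) (t : ℕ → ℝ), 0 < J ∧ t 0 = 0 ∧ (∀ j < J, t j ≤ t (j + 1)) ∧
    E = {p | p.2 < J ∧ t p.2 ≤ p.1 ∧ p.1 ≤ t (p.2 + 1)}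

/-- A hybrid time domain: a subset of `[0, ∞) × ℕ` each of whose truncations
`E ∩ ([0, T] × {0, …, J})` with `(T, J) ∈ E` is a compact hybrid time domain. -/
def IsHybridTimeDomain (E : Set (ℝ × ℕ)) : Prop :=
  ∀ p ∈ E, 0 ≤ p.1 ∧ IsCompactHybridTimeDomain (E ∩ (Icc 0 p.1 ×ˢ Iic p.2))

/-- A function on a subset `dom` of `ℝ × ℕ`. Only the values of `val t j` with `(t, j) ∈ dom`
are relevant. -/
structure HybridFun (E : Type*) where
  dom : Set (ℝ × ℕ)
  val : ℝ → ℕ → E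

/-- The interval `I_j = {t | (t, j) ∈ dom x}`. -/
def HybridFun.slice {E : Type*} (x : HybridFun E) (j : ℕ) : Set ℝ :=
  {t | (t, j) ∈ x.dom}

/-- Composition of a hybrid function with a map of the state space. -/
def HybridFun.map {E E' : Type*} (f : E → E') (x : HybridFun E) : HybridFun E' where
  dom := x.dom
  val := fun t j => f (x.val t j)

/-- Hybrid arcs: the domain is a hybrid time domain and `x(·, j)` is locally absolutely continuous
on every `I_j` with nonempty interior. -/
def HybridFun.IsArc {E : Type*} [NormedAddCommGroup E] (x : HybridFun E) : Prop :=
  IsHybridTimeDomain x.dom ∧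
    ∀ j : ℕ, (interior (x.slice j)).Nonempty →
      ∀ a b : ℝ, a ≤ b → Icc a b ⊆ x.slice j →
        AbsolutelyContinuousOnInterval (fun t => x.val t j) a b

/-- The data `(C, F, D, G)` of a hybrid dynamical system
`x ∈ C, ẋ ∈ F(x);  x ∈ D, x⁺ ∈ G(x)`. -/
structure HybridSystem (E : Type*) where
  C : Set E
  F : E → Set E
  D : Set E
  G : E → Set E

/-- Solutions (not necessarily maximal) of a hybrid dynamical system. -/
def HybridSystem.IsSolution {E : Type*} [NormedAddCommGroup E] [NormedSpace ℝ E]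
    (H : HybridSystem E) (x : HybridFun E) : Prop :=
  x.IsArc ∧
  (0, 0) ∈ x.dom ∧ x.val 0 0 ∈ H.C ∪ H.D ∧
  (∀ j : ℕ, (interior (x.slice j)).Nonempty →
    (∀ t ∈ x.slice j, x.val t j ∈ H.C) ∧
    (∀ᵐ t : ℝ, t ∈ x.slice j →
      ∃ v ∈ H.F (x.val t j), HasDerivAt (fun s => x.val s j) v t)) ∧
  (∀ (t : ℝ) (j : ℕ), (t, j) ∈ x.dom → (t, j + 1) ∈ x.dom →
    x.val t j ∈ H.D ∧ x.val t (j + 1) ∈ H.G (x.val t j))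

/-- A hybrid function has no finite escape time if it does not become unbounded on a bounded
amount of hybrid time `t + j`. -/
def HybridFun.NoFiniteEscape {E : Type*} [NormedAddCommGroup E] (x : HybridFun E) : Prop :=
  (∃ B : ℝ, ∀ p ∈ x.dom, p.1 + (p.2 : ℝ) ≤ B) →
    ∃ M : ℝ, ∀ p ∈ x.dom, ‖x.val p.1 p.2‖ ≤ M

/-- `(T, ρ)`-closeness of two hybrid arcs. -/
def Close {E : Type*} [NormedAddCommGroup E] (T ρ : ℝ) (x y : HybridFun E) : Prop :=
  (∀ (t : ℝ) (j : ℕ), (t, j) ∈ x.dom → t + (j : ℝ) ≤ T →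
    ∃ s : ℝ, (s, j) ∈ y.dom ∧ |t - s| ≤ ρ ∧ ‖x.val t j - y.val s j‖ ≤ ρ) ∧
  (∀ (t : ℝ) (j : ℕ), (t, j) ∈ y.dom → t + (j : ℝ) ≤ T →
    ∃ s : ℝ, (s, j) ∈ x.dom ∧ |t - s| ≤ ρ ∧ ‖y.val t j - x.val s j‖ ≤ ρ)

/-- Outer semicontinuity of a set-valued map relative to a set, in terms of sequences. -/
def OSCOn {E E' : Type*} [TopologicalSpace E] [TopologicalSpace E']
    (M : E → Set E') (S : Set E) : Prop :=
  ∀ (p : ℕ → E) (v : ℕ → E') (p₀ : E) (v₀ : E'), (∀ i, p i ∈ S) → p₀ ∈ S →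
    (∀ i, v i ∈ M (p i)) → Tendsto p atTop (𝓝 p₀) → Tendsto v atTop (𝓝 v₀) → v₀ ∈ M p₀

/-- Local boundedness of a set-valued map relative to a set. -/
def LocBddOn {E E' : Type*} [TopologicalSpace E] [NormedAddCommGroup E']
    (M : E → Set E') (S : Set E) : Prop :=
  ∀ p ∈ S, ∃ N ∈ 𝓝 p, ∃ B : ℝ, ∀ q ∈ N ∩ S, ∀ v ∈ M q, ‖v‖ ≤ B

/-! ### The oscillating system and its second-order average -/

/-- `ℝ^{n₁} × ℝ^{n₂}` with the Euclidean norm of `ℝ^{n₁ + n₂}`; its points are `θ = (x, z)` with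
`x = θ.fst` and `z = θ.snd`. -/
abbrev State (n₁ n₂ : ℕ) : Type :=
  WithLp 2 (EuclideanSpace ℝ (Fin n₁) × EuclideanSpace ℝ (Fin n₂))

/-- The point `(x, z)`. -/
def mkState {n₁ n₂ : ℕ} (x : EuclideanSpace ℝ (Fin n₁)) (z : EuclideanSpace ℝ (Fin n₂)) :
    State n₁ n₂ :=
  WithLp.toLp 2 (x, z)

/-- The data of the oscillating hybrid system: flow and jump sets `C`, `D`, jump map `G`, the flow
map `Φ` of `z`, and the functions `φ_k(θ, τ₁, τ₂)`. -/
structure Data (n₁ n₂ : ℕ) where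
  C : Set (State n₁ n₂)
  D : Set (State n₁ n₂)
  G : State n₁ n₂ → Set (State n₁ n₂)
  Φ : EuclideanSpace ℝ (Fin n₂) → Set (EuclideanSpace ℝ (Fin n₂))
  φ₁ : State n₁ n₂ → ℝ → ℝ → EuclideanSpace ℝ (Fin n₁)
  φ₂ : State n₁ n₂ → ℝ → ℝ → EuclideanSpace ℝ (Fin n₁)

namespace Data

variable {n₁ n₂ : ℕ}

/-- The hybrid system with state `(θ, τ₁, τ₂)`, flow set `C × [0,∞)²`, jump set `D × [0,∞)²`,
`ẋ = ε⁻¹ φ₁ + φ₂`, `ż ∈ Φ(z)`, `τ̇₁ = ε⁻¹`, `τ̇₂ = ε⁻²`; at jumps `θ⁺ ∈ G(θ)`, `τ⁺ = τ`. -/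
def original (d : Data n₁ n₂) (ε : ℝ) : HybridSystem (State n₁ n₂ × ℝ × ℝ) where
  C := d.C ×ˢ (Ici 0 ×ˢ Ici 0)
  F := fun q => {v |
    v.1.fst = ε⁻¹ • d.φ₁ q.1 q.2.1 q.2.2 + d.φ₂ q.1 q.2.1 q.2.2 ∧
    v.1.snd ∈ d.Φ q.1.snd ∧ v.2.1 = ε⁻¹ ∧ v.2.2 = (ε ^ 2)⁻¹}
  D := d.D ×ˢ (Ici 0 ×ˢ Ici 0)
  G := fun q => {v | v.1 ∈ d.G q.1 ∧ v.2 = q.2}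

/-- The partial Jacobian `∂ₓ f` at `θ = (x, z)`. -/
noncomputable def partialX (f : State n₁ n₂ → EuclideanSpace ℝ (Fin n₁)) (θ : State n₁ n₂) :
    EuclideanSpace ℝ (Fin n₁) →L[ℝ] EuclideanSpace ℝ (Fin n₁) :=
  fderiv ℝ (fun x => f (mkState x θ.snd)) θ.fst

/-- `u₁(θ, τ) = ∫₀^{τ₂} φ₁(θ, τ₁, s) ds`. -/
noncomputable def u₁ (d : Data n₁ n₂) (θ : State n₁ n₂) (τ₁ τ₂ : ℝ) :
    EuclideanSpace ℝ (Fin n₁) :=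
  ∫ s in (0 : ℝ)..τ₂, d.φ₁ θ τ₁ s

/-- The Lie bracket `[u₁, φ₁]ₓ = ∂ₓφ₁ · u₁ - ∂ₓu₁ · φ₁`. -/
noncomputable def bracket (d : Data n₁ n₂) (θ : State n₁ n₂) (τ₁ τ₂ : ℝ) :
    EuclideanSpace ℝ (Fin n₁) :=
  partialX (fun θ' => d.φ₁ θ' τ₁ τ₂) θ (d.u₁ θ τ₁ τ₂) -
    partialX (fun θ' => d.u₁ θ' τ₁ τ₂) θ (d.φ₁ θ τ₁ τ₂)

/-- The second-order average `f̄`. -/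
noncomputable def fbar (d : Data n₁ n₂) (T₁ T₂ : ℝ) (θ : State n₁ n₂) :
    EuclideanSpace ℝ (Fin n₁) :=
  (T₁ * T₂)⁻¹ • ∫ τ₁ in (0 : ℝ)..T₁, ∫ τ₂ in (0 : ℝ)..T₂,
    (d.φ₂ θ τ₁ τ₂ + (1 / 2 : ℝ) • d.bracket θ τ₁ τ₂)

/-- The second-order average hybrid system, with flow map `{f̄(θ)} × Φ(z)`. -/
noncomputable def average (d : Data n₁ n₂) (T₁ T₂ : ℝ) : HybridSystem (State n₁ n₂) where
  C := d.C
  F := fun θ => {v | v.fst = d.fbar T₁ T₂ θ ∧ v.snd ∈ d.Φ θ.snd}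
  D := d.D
  G := d.G

/-- The regularity conditions on `C`, `D`, `Φ` and `G`. -/
structure BasicRegularity (d : Data n₁ n₂) : Prop where
  closed_C : IsClosed d.C
  closed_D : IsClosed d.D
  osc_Φ : OSCOn (fun θ : State n₁ n₂ => d.Φ θ.snd) d.C
  locBdd_Φ : LocBddOn (fun θ : State n₁ n₂ => d.Φ θ.snd) d.C
  convex_Φ : ∀ θ ∈ d.C, Convex ℝ (d.Φ θ.snd)
  nonempty_Φ : ∀ θ ∈ d.C, (d.Φ θ.snd).Nonempty
  osc_G : OSCOn d.G d.D
  locBdd_G : LocBddOn d.G d.D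
  nonempty_G : ∀ θ ∈ d.D, (d.G θ).Nonempty

/-- `f(θ, τ₁, τ₂)` is locally Lipschitz in `(x, z, τ₁)` (locally uniformly in `τ₂`) and continuous
in `τ₂`, on `S × [0,∞)²`. -/
def LipOn (S : Set (State n₁ n₂)) (f : State n₁ n₂ → ℝ → ℝ → EuclideanSpace ℝ (Fin n₁)) :
    Prop :=
  (∀ p ∈ S ×ˢ (Ici (0 : ℝ) ×ˢ Ici (0 : ℝ)),
    ∃ L : ℝ, ∃ N ∈ 𝓝[S ×ˢ (Ici (0 : ℝ) ×ˢ Ici (0 : ℝ))] p, ∀ q ∈ N, ∀ q' ∈ N,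
      q.2.2 = q'.2.2 → ‖f q.1 q.2.1 q.2.2 - f q'.1 q'.2.1 q'.2.2‖ ≤ L * dist q q') ∧
  (∀ θ ∈ S, ∀ τ₁ ∈ Ici (0 : ℝ), ContinuousOn (f θ τ₁) (Ici 0))

/-- `f(x, z, τ₁, τ₂)` is differentiable with respect to `(x, τ₁)` on `S × [0,∞)²` (one-sidedly in
`τ₁` at `τ₁ = 0`) and this derivative is locally Lipschitz in `(x, τ₁)`, locally uniformly in
`(z, τ₂)`. Here `S` is an open set. -/
def DiffLipOn (S : Set (State n₁ n₂)) (f : State n₁ n₂ → ℝ → ℝ → EuclideanSpace ℝ (Fin n₁)) :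
    Prop :=
  ∃ f' : State n₁ n₂ → ℝ → ℝ →
      (EuclideanSpace ℝ (Fin n₁) × ℝ →L[ℝ] EuclideanSpace ℝ (Fin n₁)),
    (∀ θ ∈ S, ∀ τ₁ ∈ Ici (0 : ℝ), ∀ τ₂ ∈ Ici (0 : ℝ),
      HasFDerivWithinAt
        (fun y : EuclideanSpace ℝ (Fin n₁) × ℝ => f (mkState y.1 θ.snd) y.2 τ₂)
        (f' θ τ₁ τ₂) (univ ×ˢ Ici 0) (θ.fst, τ₁)) ∧
    (∀ p ∈ S ×ˢ (Ici (0 : ℝ) ×ˢ Ici (0 : ℝ)),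
      ∃ L : ℝ, ∃ N ∈ 𝓝[S ×ˢ (Ici (0 : ℝ) ×ˢ Ici (0 : ℝ))] p, ∀ q ∈ N, ∀ q' ∈ N,
        q.1.snd = q'.1.snd → q.2.2 = q'.2.2 →
          ‖f' q.1 q.2.1 q.2.2 - f' q'.1 q'.2.1 q'.2.2‖ ≤ L * dist q q')

/-- Smoothness, periodicity and zero-average conditions on `φ₁`, `φ₂`, on an open `δ`-neighbourhood
of `C` for some `δ > 0`. -/
def OscillationRegularity (d : Data n₁ n₂) (T₁ T₂ : ℝ) : Prop :=
  0 < T₁ ∧ 0 < T₂ ∧ ∃ δ > 0,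
    LipOn (Metric.thickening δ d.C) d.φ₁ ∧
    DiffLipOn (Metric.thickening δ d.C) d.φ₁ ∧
    LipOn (Metric.thickening δ d.C) d.φ₂ ∧
    (∀ θ ∈ Metric.thickening δ d.C, ∀ τ₁ ∈ Ici (0 : ℝ), ∀ τ₂ ∈ Ici (0 : ℝ),
      d.φ₁ θ (τ₁ + T₁) τ₂ = d.φ₁ θ τ₁ τ₂ ∧ d.φ₁ θ τ₁ (τ₂ + T₂) = d.φ₁ θ τ₁ τ₂ ∧
      d.φ₂ θ (τ₁ + T₁) τ₂ = d.φ₂ θ τ₁ τ₂ ∧ d.φ₂ θ τ₁ (τ₂ + T₂) = d.φ₂ θ τ₁ τ₂) ∧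
    (∀ θ ∈ Metric.thickening δ d.C, ∀ τ₁ ∈ Ici (0 : ℝ),
      ∫ s in (0 : ℝ)..T₂, d.φ₁ θ τ₁ s = 0)

end Data

end HybridAveraging

namespace HybridAveraging

/-! ### Absolutely continuous functions -/

/-! The proof combines a direct estimate of increments over one fast period with a compactness
argument; no change of variables is made.

Averaging. During a fast period of length `ε ^ 2 * T₂` the term `ε⁻¹ φ₁`, with `(θ, τ₁)` frozen at
its value at the start of the period, integrates to zero. What remains is of order one. Indeed `x`
moves by about `ε ∫ φ₁` and `τ₁` by `ε σ`, where `σ` is the elapsed fast phase, so the first-order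
expansion of `ε⁻¹ φ₁` contributes `∂ₓφ₁ · ∫ φ₁ + σ ∂φ₁/∂τ₁`, to which `φ₂` is added: this is
`drift`. The component `z` moves only by `O(ε ^ 2)`, so a Lipschitz bound in `z` replaces
differentiability. Integration by parts turns the first term into half the Lie bracket, whatever the
initial fast phase (`integral_clm_apply_primitive`), and the second term vanishes after integration
over a period of `τ₁` (`IsFrozenField.integral_smul_deriv`). Hence the mean over both phases is `f̄`
(`IsOscillating.integral_frozenDrift`). Continuity of the fields near a state `p`, uniform in the
phases by periodicity, then shows that a flow that stays near `p` has an `x`-increment `(b - a)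
f̄(p)` up to `η (b - a) + B ε` (`IsOscillating.exists_local_averaging`). A bootstrap makes bounded
flows equi-Lipschitz up to `O(ε)` (`IsOscillating.exists_equiLipschitz`), although their velocity is
of order `ε⁻¹`.

Compactness. If the theorem fails, there are solutions with `ε → 0`, with initial values converging
to a point of `K₀`, that are close to no average solution. They are passed to the limit along a
nonprincipal ultrafilter, so that every bounded sequence converges and no subsequences are needed.
On each level `j` the equi-Lipschitz bound yields a Lipschitz limit. Its `x`-component has
derivative `f̄` by local averaging. Its `z`-component is differentiable almost everywhere, with
derivative in `Φ` by separating hyperplanes. Jumps pass to the limit because the graph of `G` is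
closed. So the limit is an average solution (`IsSolutionSeq.isSolution_limitArc`).

Boundedness of the levels is proved by induction. If level `j` is the first unbounded one, the limit
still exists on it up to escape and is an average solution starting in `K₀` on a bounded time
domain. It is therefore bounded, yet it contains limits of points of arbitrarily large prescribed
norm (`IsSolutionSeq.isBddLevel`). Once all levels are bounded, a sequence of times violating
closeness would have a limit on one level, where the values agree
(`IsSolutionSeq.eventually_close`). -/

theorem absolutelyContinuousOnInterval_lipschitz_comp {X Y : Type*} [PseudoMetricSpace X]
    [PseudoMetricSpace Y] {g : X → Y} {K : NNReal} (hg : LipschitzWith K g) {f : ℝ → X} {a b : ℝ}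
    (hf : AbsolutelyContinuousOnInterval f a b) :
    AbsolutelyContinuousOnInterval (fun t => g (f t)) a b := by
  have h := Tendsto.const_mul (K : ℝ) hf
  rw [mul_zero] at h
  refine squeeze_zero (fun E => Finset.sum_nonneg fun _ _ => dist_nonneg) (fun E => ?_) h
  rw [Finset.mul_sum]
  exact Finset.sum_le_sum fun i _ => hg.dist_le_mul _ _

/-- Subtracting a `C¹` primitive of the continuous `g` leaves an absolutely continuous function
whose derivative vanishes almost everywhere, hence a constant. -/
theorem absolutelyContinuousOnInterval_sub_eq_integral {F : Type*} [NormedAddCommGroup F]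
    [NormedSpace ℝ F] [CompleteSpace F] {f g : ℝ → F} {a b : ℝ} (hab : a ≤ b)
    (hf : AbsolutelyContinuousOnInterval f a b) (hg : ContinuousOn g (Icc a b))
    (hd : ∀ᵐ t : ℝ, t ∈ Icc a b → HasDerivAt f (g t) t) :
    f b - f a = ∫ t in a..b, g t := by
  -- The constant extension beyond the endpoints makes the integrand continuous on the line, so that
  -- the primitive is differentiable everywhere.
  set G : ℝ → F := IccExtend hab ((Icc a b).domRestrict g) with hG
  have hGc : Continuous G := (continuousOn_iff_continuous_domRestrict.1 hg).Icc_extend'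
  have hGg : ∀ t ∈ Icc a b, G t = g t := fun t ht => by
    rw [hG, IccExtend_of_mem hab _ ht]; rfl
  have hder : ∀ t, HasDerivAt (fun t => ∫ s in a..t, G s) (G t) t := fun t =>
    intervalIntegral.integral_hasDerivAt_right (hGc.intervalIntegrable _ _)
      (hGc.stronglyMeasurableAtFilter _ _) hGc.continuousAt
  obtain ⟨M, hM⟩ := isCompact_Icc.exists_bound_of_continuousOn (hGc.continuousOn (s := Icc a b))
  have hlip : LipschitzOnWith (Real.toNNReal M) (fun t => ∫ s in a..t, G s) (uIcc a b) := by
    rw [uIcc_of_le hab]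
    refine (convex_Icc a b).lipschitzOnWith_of_nnnorm_hasDerivWithin_le
      (fun x _ => (hder x).hasDerivWithinAt) (fun x hx => ?_)
    rw [← NNReal.coe_le_coe]
    exact (hM x hx).trans (Real.le_coe_toNNReal M)
  have hsub := hf.sub hlip.absolutelyContinuousOnInterval
  obtain ⟨c, hc⟩ := hsub.const_of_ae_hasDerivAt_zero (by
    filter_upwards [hd] with t ht htab
    rw [uIcc_of_le hab] at htab
    have := (ht htab).sub (hder t)
    rw [hGg t htab, sub_self] at this
    exact this)
  have h1 := hc a left_mem_uIcc
  have h2 := hc b right_mem_uIcc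
  simp only [Pi.sub_apply, intervalIntegral.integral_same, sub_zero] at h1 h2
  rw [h1, ← h2, sub_sub_cancel]
  refine intervalIntegral.integral_congr fun t ht => ?_
  rw [uIcc_of_le hab] at ht
  exact hGg t ht

/-- Applied to linear functionals of `z`, this expresses the inclusion `ż ∈ Φ(z)` without a
measurable selection. -/
theorem absolutelyContinuousOnInterval_sub_le {f : ℝ → ℝ} {a b c : ℝ} (hab : a ≤ b)
    (hf : AbsolutelyContinuousOnInterval f a b)
    (hd : ∀ᵐ t : ℝ, t ∈ Icc a b → ∃ v ≤ c, HasDerivAt f v t) :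
    f b - f a ≤ c * (b - a) := by
  rw [← hf.integral_deriv_eq_sub]
  have : ∫ t in a..b, deriv f t ≤ ∫ _ in a..b, c := by
    refine intervalIntegral.integral_mono_ae_restrict hab hf.intervalIntegrable_deriv (by simp) ?_
    rw [EventuallyLE, ae_restrict_iff' measurableSet_Icc]
    filter_upwards [hd] with t ht htab
    obtain ⟨v, hv, hv'⟩ := ht htab
    rwa [hv'.deriv]
  rw [intervalIntegral.integral_const, smul_eq_mul] at this
  linarith

/-! ### Periodic functions on the half line and telescoping -/

theorem apply_add_nat_mul {α : Type*} {f : ℝ → α} {T : ℝ} (hT : 0 ≤ T)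
    (hf : ∀ s, 0 ≤ s → f (s + T) = f s) (k : ℕ) {s : ℝ} (hs : 0 ≤ s) : f (s + k * T) = f s := by
  induction k with
  | zero => simp
  | succ k ih =>
    have : s + (k + 1 : ℕ) * T = s + k * T + T := by push_cast; ring
    rw [this, hf _ (by positivity), ih]

theorem integral_add_period_eq {E : Type*} [NormedAddCommGroup E] [NormedSpace ℝ E] {f : ℝ → E}
    {T : ℝ} (hc : Continuous f) (hf : ∀ s, 0 ≤ s → f (s + T) = f s)
    {c : ℝ} (h0 : 0 ≤ c) : ∫ s in c..c + T, f s = ∫ s in (0 : ℝ)..T, f s := by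
  have h1 : ∫ s in T..c + T, f s = ∫ s in (0 : ℝ)..c, f s := by
    have := intervalIntegral.integral_comp_add_right (a := 0) (b := c) f T
    rw [zero_add] at this
    rw [← this]
    refine intervalIntegral.integral_congr fun s hs => ?_
    rw [uIcc_of_le h0] at hs
    exact hf s hs.1
  have hi : ∀ a b : ℝ, IntervalIntegrable f volume a b := fun a b => hc.intervalIntegrable a b
  have h2 := intervalIntegral.integral_add_adjacent_intervals (hi 0 c) (hi c (c + T))
  have h3 := intervalIntegral.integral_add_adjacent_intervals (hi 0 T) (hi T (c + T))
  rw [h1, ← h2, add_comm] at h3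
  exact (add_left_cancel h3).symm

/-- Increments over a time `t - s` are controlled by those over steps of length `h`. -/
theorem norm_sub_le_of_step {E : Type*} [NormedAddCommGroup E] {ψ : ℝ → E} {s t h η A : ℝ}
    (hh : 0 < h) (hst : s ≤ t) (hη : 0 ≤ η)
    (hstep : ∀ k : ℕ, s + k * h + h ≤ t → ‖ψ (s + k * h + h) - ψ (s + k * h)‖ ≤ η * h)
    (hrem : ∀ r, s ≤ r → r ≤ t → t ≤ r + h → ‖ψ t - ψ r‖ ≤ A) :
    ‖ψ t - ψ s‖ ≤ η * (t - s) + A := by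
  have key : ∀ k : ℕ, s + k * h ≤ t → ‖ψ (s + k * h) - ψ s‖ ≤ η * (k * h) := by
    intro k
    induction k with
    | zero => simp
    | succ k ih =>
      intro hk
      have e : s + (k + 1 : ℕ) * h = s + k * h + h := by push_cast; ring
      rw [e] at hk ⊢
      calc _ = ‖(ψ (s + k * h + h) - ψ (s + k * h)) + (ψ (s + k * h) - ψ s)‖ := by
            rw [sub_add_sub_cancel]
        _ ≤ η * h + η * (k * h) := (norm_add_le _ _).trans
            (add_le_add (hstep k hk) (ih (by linarith)))
        _ = _ := by push_cast; ring
  -- The number of complete steps; the remaining piece is shorter than `h` and is covered by `hrem`.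
  set k := ⌊(t - s) / h⌋₊
  have hk1 : (k : ℝ) * h ≤ t - s := by
    rw [← le_div_iff₀ hh]; exact Nat.floor_le (div_nonneg (by linarith) hh.le)
  have hk2 : t - s < (k + 1) * h := by
    rw [← div_lt_iff₀ hh]; exact Nat.lt_floor_add_one _
  have h0 : 0 ≤ (k : ℝ) * h := by positivity
  calc _ = ‖(ψ t - ψ (s + k * h)) + (ψ (s + k * h) - ψ s)‖ := by rw [sub_add_sub_cancel]
    _ ≤ A + η * (k * h) := (norm_add_le _ _).trans
        (add_le_add (hrem _ (by linarith) (by linarith) (by linarith)) (key k (by linarith)))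
    _ ≤ _ := by nlinarith

/-! ### The averaged drift at a frozen state -/

section Frozen

variable {E : Type*} [NormedAddCommGroup E] [NormedSpace ℝ E]

/-- This is where the Lie bracket arises. With `u` and `V` the primitives of `f` and `A`, the
displacement from phase `c` is `u (c + σ) - u c`. The constant `u c` is killed by the zero mean of
`A`, and periodicity removes the shift by `c`. Since `V u` has derivative `A u + V f` and vanishes
at both ends of the period, `∫ A u = -∫ V f`, and each equals half of the antisymmetric combination
up to sign. -/
theorem integral_clm_apply_primitive [CompleteSpace E] {f : ℝ → E} {A : ℝ → E →L[ℝ] E} {T : ℝ}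
    (hf : Continuous f) (hA : Continuous A) (pf : ∀ s, 0 ≤ s → f (s + T) = f s)
    (pA : ∀ s, 0 ≤ s → A (s + T) = A s) (mf : ∫ s in (0 : ℝ)..T, f s = 0)
    (mA : ∫ s in (0 : ℝ)..T, A s = 0) {c : ℝ} (hc : 0 ≤ c) :
    ∫ σ in (0 : ℝ)..T, A (c + σ) (∫ s in (0 : ℝ)..σ, f (c + s)) =
      ∫ σ in (0 : ℝ)..T, (1 / 2 : ℝ) •
        (A σ (∫ s in (0 : ℝ)..σ, f s) - (∫ s in (0 : ℝ)..σ, A s) (f σ)) := by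
  set u : ℝ → E := fun t => ∫ s in (0 : ℝ)..t, f s with hu
  set V : ℝ → E →L[ℝ] E := fun t => ∫ s in (0 : ℝ)..t, A s with hV
  have du : ∀ t, HasDerivAt u (f t) t := fun t =>
    intervalIntegral.integral_hasDerivAt_right (hf.intervalIntegrable _ _)
      (hf.stronglyMeasurableAtFilter _ _) hf.continuousAt
  have dV : ∀ t, HasDerivAt V (A t) t := fun t =>
    intervalIntegral.integral_hasDerivAt_right (hA.intervalIntegrable _ _)
      (hA.stronglyMeasurableAtFilter _ _) hA.continuousAt
  have cu : Continuous u := continuous_iff_continuousAt.2 fun t => (du t).continuousAt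
  have cV : Continuous V := continuous_iff_continuousAt.2 fun t => (dV t).continuousAt
  have pu : ∀ s, 0 ≤ s → u (s + T) = u s := fun s hs => by
    have h := intervalIntegral.integral_add_adjacent_intervals
      (hf.intervalIntegrable (μ := volume) 0 s) (hf.intervalIntegrable s (s + T))
    rw [integral_add_period_eq hf pf hs, mf, add_zero] at h
    exact h.symm
  have h1 : ∀ σ, ∫ s in (0 : ℝ)..σ, f (c + s) = u (c + σ) - u c := fun σ => by
    rw [intervalIntegral.integral_comp_add_left f c, add_zero, hu,
      intervalIntegral.integral_interval_sub_left (hf.intervalIntegrable _ _)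
        (hf.intervalIntegrable _ _)]
  have h2 : ∫ σ in (0 : ℝ)..T, A (c + σ) (∫ s in (0 : ℝ)..σ, f (c + s)) =
      ∫ σ in (0 : ℝ)..T, A σ (u σ) := by
    simp_rw [h1, map_sub]
    have cA' : Continuous fun σ => A (c + σ) := hA.comp (by fun_prop)
    have cu' : Continuous fun σ => u (c + σ) := cu.comp (by fun_prop)
    rw [intervalIntegral.integral_sub ((cA'.clm_apply cu').intervalIntegrable _ _)
      ((cA'.clm_apply continuous_const).intervalIntegrable _ _)]
    rw [← ContinuousLinearMap.intervalIntegral_apply (cA'.intervalIntegrable _ _),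
      intervalIntegral.integral_comp_add_left A c, add_zero,
      integral_add_period_eq hA pA hc, mA, zero_apply, sub_zero,
      intervalIntegral.integral_comp_add_left (fun s => A s (u s)) c, add_zero]
    refine integral_add_period_eq (hA.clm_apply cu) (fun s hs => ?_) hc
    simp only [pA s hs, pu s hs]
  have h3 : ∫ σ in (0 : ℝ)..T, (A σ (u σ) + V σ (f σ)) = 0 := by
    rw [intervalIntegral.integral_eq_sub_of_hasDerivAt (f := fun σ => V σ (u σ))
      (fun t _ => (dV t).clm_apply (du t))
      (((hA.clm_apply cu).add (cV.clm_apply hf)).intervalIntegrable _ _)]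
    simp [u, mf]
  rw [h2, intervalIntegral.integral_smul, intervalIntegral.integral_sub
    ((hA.clm_apply cu).intervalIntegrable _ _) ((cV.clm_apply hf).intervalIntegrable _ _)]
  rw [intervalIntegral.integral_add
    ((hA.clm_apply cu).intervalIntegrable _ _) ((cV.clm_apply hf).intervalIntegrable _ _)] at h3
  rw [eq_neg_of_add_eq_zero_right h3, sub_neg_eq_add, ← two_smul ℝ, smul_smul]
  norm_num

/-- Continuous fields of `(τ₁, τ₂)` that are doubly periodic on the quadrant: `f` and `k` play the
roles of `φ₁` and `φ₂` at a fixed state, `A` and `b` those of `∂ₓφ₁` and `∂φ₁/∂τ₁`. -/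
structure IsFrozenField (T₁ T₂ : ℝ) (f k b : ℝ → ℝ → E) (A : ℝ → ℝ → E →L[ℝ] E) : Prop where
  pos₁ : 0 < T₁
  pos₂ : 0 < T₂
  cont_f : Continuous (Function.uncurry f)
  cont_k : Continuous (Function.uncurry k)
  cont_b : Continuous (Function.uncurry b)
  cont_A : Continuous (Function.uncurry A)
  per₁_f : ∀ s, 0 ≤ s → ∀ t, 0 ≤ t → f (s + T₁) t = f s t
  per₂_f : ∀ s, 0 ≤ s → ∀ t, 0 ≤ t → f s (t + T₂) = f s t
  per₁_k : ∀ s, 0 ≤ s → ∀ t, 0 ≤ t → k (s + T₁) t = k s t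
  per₂_k : ∀ s, 0 ≤ s → ∀ t, 0 ≤ t → k s (t + T₂) = k s t
  per₁_b : ∀ s, 0 ≤ s → ∀ t, 0 ≤ t → b (s + T₁) t = b s t
  per₂_b : ∀ s, 0 ≤ s → ∀ t, 0 ≤ t → b s (t + T₂) = b s t
  per₁_A : ∀ s, 0 ≤ s → ∀ t, 0 ≤ t → A (s + T₁) t = A s t
  per₂_A : ∀ s, 0 ≤ s → ∀ t, 0 ≤ t → A s (t + T₂) = A s t
  mean_f : ∀ s, 0 ≤ s → ∫ t in (0 : ℝ)..T₂, f s t = 0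
  mean_A : ∀ s, 0 ≤ s → ∫ t in (0 : ℝ)..T₂, A s t = 0
  deriv_f : ∀ s, 0 < s → ∀ t, 0 ≤ t → HasDerivAt (fun r => f r t) (b s t) s

/-- The second-order drift at phase `σ` after the start `(s, c)` of a fast period. -/
noncomputable def drift (f k b : ℝ → ℝ → E) (A : ℝ → ℝ → E →L[ℝ] E) (s c σ : ℝ) : E :=
  A s (c + σ) (∫ r in (0 : ℝ)..σ, f s (c + r)) + σ • b s (c + σ) + k s (c + σ)

/-- The mean of the drift over a fast period. -/
noncomputable def meanDrift (T₂ : ℝ) (f k b : ℝ → ℝ → E) (A : ℝ → ℝ → E →L[ℝ] E) (s c : ℝ) : E :=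
  T₂⁻¹ • ∫ σ in (0 : ℝ)..T₂, drift f k b A s c σ

namespace IsFrozenField

variable {T₁ T₂ : ℝ} {f k b : ℝ → ℝ → E} {A : ℝ → ℝ → E →L[ℝ] E}

theorem continuous_displacement (h : IsFrozenField T₁ T₂ f k b A) :
    Continuous fun q : ℝ × ℝ × ℝ => ∫ r in (0 : ℝ)..q.2.2, f q.1 (q.2.1 + r) := by
  refine intervalIntegral.continuous_parametric_intervalIntegral_of_continuous
    (f := fun (q : ℝ × ℝ × ℝ) r => f q.1 (q.2.1 + r)) ?_ (by fun_prop)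
  exact h.cont_f.comp (f := fun w : (ℝ × ℝ × ℝ) × ℝ => (w.1.1, w.1.2.1 + w.2)) (by fun_prop)

theorem continuous_drift (h : IsFrozenField T₁ T₂ f k b A) :
    Continuous fun q : ℝ × ℝ × ℝ => drift f k b A q.1 q.2.1 q.2.2 := by
  have hm : Continuous fun q : ℝ × ℝ × ℝ => (q.1, q.2.1 + q.2.2) := by fun_prop
  exact (((h.cont_A.comp hm).clm_apply h.continuous_displacement).add
    (Continuous.smul (by fun_prop) (h.cont_b.comp hm))).add (h.cont_k.comp hm)

theorem continuous_meanDrift (h : IsFrozenField T₁ T₂ f k b A) :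
    Continuous fun q : ℝ × ℝ => meanDrift T₂ f k b A q.1 q.2 := by
  refine Continuous.const_smul (intervalIntegral.continuous_parametric_intervalIntegral_of_continuous'
    (f := fun (q : ℝ × ℝ) σ => drift f k b A q.1 q.2 σ) ?_ 0 T₂) _
  exact h.continuous_drift.comp (f := fun w : (ℝ × ℝ) × ℝ => (w.1.1, w.1.2, w.2)) (by fun_prop)

theorem meanDrift_add_left (h : IsFrozenField T₁ T₂ f k b A) {s c : ℝ} (hs : 0 ≤ s)
    (hc : 0 ≤ c) :
    meanDrift T₂ f k b A (s + T₁) c = meanDrift T₂ f k b A s c := by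
  unfold meanDrift
  congr 1
  refine intervalIntegral.integral_congr fun σ hσ => ?_
  rw [uIcc_of_le h.pos₂.le] at hσ
  have h0 : 0 ≤ c + σ := by linarith [hσ.1]
  simp only [drift, h.per₁_A s hs _ h0, h.per₁_b s hs _ h0, h.per₁_k s hs _ h0]
  congr 3
  refine intervalIntegral.integral_congr fun r hr => ?_
  rw [uIcc_of_le hσ.1] at hr
  exact h.per₁_f s hs _ (by linarith [hr.1])

theorem meanDrift_add_right (h : IsFrozenField T₁ T₂ f k b A) {s c : ℝ} (hs : 0 ≤ s)
    (hc : 0 ≤ c) : meanDrift T₂ f k b A s (c + T₂) = meanDrift T₂ f k b A s c := by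
  unfold meanDrift
  congr 1
  refine intervalIntegral.integral_congr fun σ hσ => ?_
  rw [uIcc_of_le h.pos₂.le] at hσ
  have h0 : 0 ≤ c + σ := by linarith [hσ.1]
  simp only [drift, add_right_comm c T₂, h.per₂_A s hs _ h0, h.per₂_b s hs _ h0,
    h.per₂_k s hs _ h0]
  congr 3
  refine intervalIntegral.integral_congr fun r hr => ?_
  rw [uIcc_of_le hσ.1] at hr
  exact h.per₂_f s hs _ (by linarith [hr.1])

/-- Only the term with `b` still depends on the initial fast phase `c`; it disappears after
averaging over the slow phase. -/
theorem integral_drift [CompleteSpace E] (h : IsFrozenField T₁ T₂ f k b A) {s c : ℝ} (hs : 0 ≤ s)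
    (hc : 0 ≤ c) :
    ∫ σ in (0 : ℝ)..T₂, drift f k b A s c σ =
      (∫ σ in (0 : ℝ)..T₂, (k s σ + (1 / 2 : ℝ) •
        (A s σ (∫ r in (0 : ℝ)..σ, f s r) - (∫ r in (0 : ℝ)..σ, A s r) (f s σ)))) +
      ∫ σ in (0 : ℝ)..T₂, σ • b s (c + σ) := by
  have cf : Continuous (f s) := h.cont_f.comp (f := fun t => (s, t)) (by fun_prop)
  have ck : Continuous (k s) := h.cont_k.comp (f := fun t => (s, t)) (by fun_prop)
  have cb : Continuous (b s) := h.cont_b.comp (f := fun t => (s, t)) (by fun_prop)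
  have cA : Continuous (A s) := h.cont_A.comp (f := fun t => (s, t)) (by fun_prop)
  have cu : Continuous fun σ => ∫ r in (0 : ℝ)..σ, f s r :=
    intervalIntegral.continuous_parametric_intervalIntegral_of_continuous
      (f := fun _ r => f s r) (by fun_prop) continuous_id
  have cV : Continuous fun σ => ∫ r in (0 : ℝ)..σ, A s r :=
    intervalIntegral.continuous_parametric_intervalIntegral_of_continuous
      (f := fun _ r => A s r) (by fun_prop) continuous_id
  have cw : Continuous fun σ => ∫ r in (0 : ℝ)..σ, f s (c + r) :=
    intervalIntegral.continuous_parametric_intervalIntegral_of_continuous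
      (f := fun _ r => f s (c + r)) (by fun_prop) continuous_id
  have i1 := integral_clm_apply_primitive cf cA (h.per₂_f s hs) (h.per₂_A s hs)
    (h.mean_f s hs) (h.mean_A s hs) hc
  have i2 : ∫ σ in (0 : ℝ)..T₂, k s (c + σ) = ∫ σ in (0 : ℝ)..T₂, k s σ := by
    rw [intervalIntegral.integral_comp_add_left (k s) c, add_zero,
      integral_add_period_eq ck (h.per₂_k s hs) hc]
  have c1 : Continuous fun σ => A s (c + σ) (∫ r in (0 : ℝ)..σ, f s (c + r)) :=
    Continuous.clm_apply (by fun_prop) cw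
  have c2 : Continuous fun σ => σ • b s (c + σ) := by fun_prop
  have c3 : Continuous fun σ => k s (c + σ) := by fun_prop
  have c4 : Continuous fun σ => (1 / 2 : ℝ) •
        (A s σ (∫ r in (0 : ℝ)..σ, f s r) - (∫ r in (0 : ℝ)..σ, A s r) (f s σ)) :=
    ((cA.clm_apply cu).sub (cV.clm_apply cf)).const_smul _
  unfold drift
  have c12 : Continuous fun σ =>
      A s (c + σ) (∫ r in (0 : ℝ)..σ, f s (c + r)) + σ • b s (c + σ) := c1.add c2
  rw [intervalIntegral.integral_add (c12.intervalIntegrable _ _)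
    (c3.intervalIntegrable _ _), intervalIntegral.integral_add (c1.intervalIntegrable _ _)
    (c2.intervalIntegrable _ _), intervalIntegral.integral_add (ck.intervalIntegrable _ _)
    (c4.intervalIntegrable _ _), i1, i2]
  abel

/-- After exchanging the integrals, the inner one is that of `∂f/∂τ₁` over a full period in `τ₁`. -/
theorem integral_smul_deriv [CompleteSpace E] (h : IsFrozenField T₁ T₂ f k b A) {c : ℝ}
    (hc : 0 ≤ c) :
    ∫ s in (0 : ℝ)..T₁, ∫ σ in (0 : ℝ)..T₂, σ • b s (c + σ) = 0 := by
  have cb : Continuous (Function.uncurry fun s σ : ℝ => σ • b s (c + σ)) := by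
    have := h.cont_b.comp (f := fun q : ℝ × ℝ => (q.1, c + q.2)) (by fun_prop)
    exact continuous_snd.smul this
  rw [MeasureTheory.intervalIntegral_intervalIntegral_swap]
  · rw [intervalIntegral.integral_zero_ae]
    refine .of_forall fun σ hσ => ?_
    rw [uIoc_of_le h.pos₂.le] at hσ
    have h0 : 0 ≤ c + σ := by linarith [hσ.1]
    rw [intervalIntegral.integral_smul, intervalIntegral.integral_eq_sub_of_hasDeriv_right_of_le
      h.pos₁.le (f := fun s => f s (c + σ))
      (h.cont_f.comp (f := fun s => (s, c + σ)) (by fun_prop)).continuousOn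
      (fun s hs => (h.deriv_f s hs.1 _ h0).hasDerivWithinAt)
      ((h.cont_b.comp (f := fun s => (s, c + σ)) (by fun_prop)).intervalIntegrable _ _)]
    have := h.per₁_f 0 le_rfl _ h0
    rw [zero_add] at this
    rw [this, sub_self, smul_zero]
  · refine (cb.continuousOn.integrableOn_compact
      ((isCompact_uIcc (a := 0) (b := T₁)).prod (isCompact_uIcc (a := 0) (b := T₂)))).mono_set ?_
    exact prod_mono uIoc_subset_uIcc uIoc_subset_uIcc

theorem integral_meanDrift [CompleteSpace E] (h : IsFrozenField T₁ T₂ f k b A) {a c : ℝ} (ha : 0 ≤ a)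
    (hc : 0 ≤ c) :
    ∫ s in a..a + T₁, meanDrift T₂ f k b A s c =
      T₂⁻¹ • ∫ s in (0 : ℝ)..T₁, ∫ σ in (0 : ℝ)..T₂, (k s σ + (1 / 2 : ℝ) •
        (A s σ (∫ r in (0 : ℝ)..σ, f s r) - (∫ r in (0 : ℝ)..σ, A s r) (f s σ))) := by
  rw [integral_add_period_eq (f := fun s => meanDrift T₂ f k b A s c)
    (h.continuous_meanDrift.comp (f := fun s => (s, c)) (by fun_prop))
    (fun s hs => h.meanDrift_add_left hs hc) ha]
  unfold meanDrift
  rw [intervalIntegral.integral_smul]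
  congr 1
  have c1 : Continuous fun s => ∫ σ in (0 : ℝ)..T₂, drift f k b A s c σ :=
    intervalIntegral.continuous_parametric_intervalIntegral_of_continuous'
      (f := fun s σ => drift f k b A s c σ)
      (h.continuous_drift.comp (f := fun w : ℝ × ℝ => (w.1, c, w.2)) (by fun_prop)) _ _
  have c2 : Continuous fun s => ∫ σ in (0 : ℝ)..T₂, σ • b s (c + σ) :=
    intervalIntegral.continuous_parametric_intervalIntegral_of_continuous'
      (f := fun s σ => σ • b s (c + σ)) (continuous_snd.smul
        (h.cont_b.comp (f := fun w : ℝ × ℝ => (w.1, c + w.2)) (by fun_prop))) _ _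
  rw [← sub_zero (∫ s in (0 : ℝ)..T₁, ∫ σ in (0 : ℝ)..T₂, drift f k b A s c σ),
    ← h.integral_smul_deriv hc, ← intervalIntegral.integral_sub (c1.intervalIntegrable _ _)
    (c2.intervalIntegrable _ _)]
  refine intervalIntegral.integral_congr fun s hs => ?_
  rw [uIcc_of_le h.pos₁.le] at hs
  simp only [h.integral_drift hs.1 hc, add_sub_cancel_right]

end IsFrozenField

end Frozen

/-! ### Doubly periodic fields near a state -/

theorem exists_nat_add_mul_eq {T : ℝ} (hT : 0 < T) {s : ℝ} (hs : 0 ≤ s) :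
    ∃ k : ℕ, ∃ r ∈ Icc 0 T, s = r + k * T := by
  refine ⟨⌊s / T⌋₊, s - ⌊s / T⌋₊ * T, ⟨?_, ?_⟩, by ring⟩
  · have := Nat.floor_le (div_nonneg hs hT.le)
    rw [le_div_iff₀ hT] at this
    linarith
  · have := Nat.lt_floor_add_one (s / T)
    rw [div_lt_iff₀ hT] at this
    linarith

section Periodic

variable {X F : Type*} [PseudoMetricSpace X] [ProperSpace X] [NormedAddCommGroup F]

/-- `g(θ, s, t)` is continuous and doubly periodic on `S × [0, ∞)²`. -/
structure IsPeriodicField (S : Set X) (T₁ T₂ : ℝ) (g : X → ℝ → ℝ → F) : Prop where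
  cont : ContinuousOn (fun q : X × ℝ × ℝ => g q.1 q.2.1 q.2.2) (S ×ˢ (Ici 0 ×ˢ Ici 0))
  per₁ : ∀ θ ∈ S, ∀ s, 0 ≤ s → ∀ t, 0 ≤ t → g θ (s + T₁) t = g θ s t
  per₂ : ∀ θ ∈ S, ∀ s, 0 ≤ s → ∀ t, 0 ≤ t → g θ s (t + T₂) = g θ s t

/-- Periodicity reduces the phases to a compact cell, where continuity is uniform. This gives one
radius for all phases in the unbounded quadrant. -/
theorem IsPeriodicField.exists_close {S : Set X} {T₁ T₂ : ℝ} {g : X → ℝ → ℝ → F}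
    (hg : IsPeriodicField S T₁ T₂ g) (hS : IsOpen S) (hT₁ : 0 < T₁) (hT₂ : 0 < T₂)
    {p : X} (hp : p ∈ S) {η : ℝ} (hη : 0 < η) :
    ∃ r > 0, Metric.ball p r ⊆ S ∧ ∀ θ ∈ Metric.ball p r, ∀ s, 0 ≤ s → ∀ s' ∈ Icc s (s + r),
      ∀ t, 0 ≤ t → ‖g θ s' t - g p s t‖ ≤ η := by
  obtain ⟨r₀, hr₀, hball⟩ := Metric.isOpen_iff.1 hS p hp
  -- After reduction of `s` to `[0, T₁]`, the later slow phase `s'` may exceed `T₁` by up to `r ≤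
  -- 1`, hence the cell up to `T₁ + 1`.
  set K : Set (X × ℝ × ℝ) := Metric.closedBall p (r₀ / 2) ×ˢ (Icc 0 (T₁ + 1) ×ˢ Icc 0 T₂)
  have hK : IsCompact K :=
    (isCompact_closedBall _ _).prod (isCompact_Icc.prod isCompact_Icc)
  have hsub : K ⊆ S ×ˢ (Ici 0 ×ˢ Ici 0) := by
    rintro ⟨θ, s, t⟩ ⟨h1, h2, h3⟩
    exact ⟨hball (lt_of_le_of_lt h1 (half_lt_self hr₀)), h2.1, h3.1⟩
  have huc := hK.uniformContinuousOn_of_continuous (hg.cont.mono hsub)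
  rw [Metric.uniformContinuousOn_iff] at huc
  obtain ⟨δ, hδ, hclose⟩ := huc η hη
  set r := min (r₀ / 2) (min (δ / 2) 1)
  have hr1 : r ≤ r₀ / 2 := min_le_left _ _
  have hr2 : r ≤ δ / 2 := (min_le_right _ _).trans (min_le_left _ _)
  have hr3 : r ≤ 1 := (min_le_right _ _).trans (min_le_right _ _)
  have hrpos : 0 < r := by positivity
  have hbS : Metric.ball p r ⊆ S := fun θ hθ => hball (by
    rw [Metric.mem_ball] at hθ ⊢; linarith)
  refine ⟨r, hrpos, hbS, fun θ hθ s hs s' hs' t ht => ?_⟩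
  obtain ⟨k, a, ha, rfl⟩ := exists_nat_add_mul_eq hT₁ hs
  obtain ⟨l, c, hc, rfl⟩ := exists_nat_add_mul_eq hT₂ ht
  have hθS := hbS hθ
  have ha' : 0 ≤ s' - k * T₁ := by linarith [hs'.1, ha.1]
  have e1 : g θ s' (c + l * T₂) = g θ (s' - k * T₁) c := by
    rw [apply_add_nat_mul hT₂.le (hg.per₂ θ hθS s' (hs.trans hs'.1)) l hc.1]
    have := apply_add_nat_mul (f := fun s => g θ s c) hT₁.le
      (fun s hs => hg.per₁ θ hθS s hs c hc.1) k ha'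
    simpa using this
  have e2 : g p (a + k * T₁) (c + l * T₂) = g p a c := by
    rw [apply_add_nat_mul hT₂.le (hg.per₂ p hp _ hs) l hc.1]
    exact apply_add_nat_mul (f := fun s => g p s c) hT₁.le
      (fun s hs => hg.per₁ p hp s hs c hc.1) k ha.1
  rw [e1, e2, ← dist_eq_norm]
  refine (hclose (θ, s' - k * T₁, c) ⟨?_, ⟨ha', ?_⟩, hc⟩ (p, a, c) ⟨?_, ⟨ha.1, ?_⟩, hc⟩ ?_).le
  · rw [Metric.mem_ball] at hθ; simp only [Metric.mem_closedBall]; linarith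
  · simp only; linarith [hs'.2, ha.2]
  · simp only [Metric.mem_closedBall, dist_self]; linarith
  · simp only; linarith [ha.2]
  · rw [Prod.dist_eq, Prod.dist_eq]
    refine max_lt ?_ (max_lt ?_ ?_)
    · rw [Metric.mem_ball] at hθ; simp only; linarith
    · simp only [Real.dist_eq]
      rw [abs_lt]; constructor <;> linarith [hs'.1, hs'.2]
    · simpa using hδ

theorem IsPeriodicField.exists_bound {S : Set X} {T₁ T₂ : ℝ} {g : X → ℝ → ℝ → F}
    (hg : IsPeriodicField S T₁ T₂ g) (hS : IsOpen S) (hT₁ : 0 < T₁) (hT₂ : 0 < T₂)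
    {p : X} (hp : p ∈ S) :
    ∃ r > 0, ∃ B, 0 ≤ B ∧ ∀ θ ∈ Metric.ball p r, ∀ s, 0 ≤ s → ∀ t, 0 ≤ t → ‖g θ s t‖ ≤ B := by
  obtain ⟨r, hr, -, hclose⟩ := hg.exists_close hS hT₁ hT₂ hp one_pos
  have hc : ContinuousOn (fun q : ℝ × ℝ => g p q.1 q.2) (Icc 0 T₁ ×ˢ Icc 0 T₂) :=
    hg.cont.comp (f := fun q : ℝ × ℝ => (p, q.1, q.2)) (by fun_prop)
      fun q hq => ⟨hp, hq.1.1, hq.2.1⟩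
  obtain ⟨B, hB⟩ := (isCompact_Icc.prod isCompact_Icc).exists_bound_of_continuousOn hc
  refine ⟨r, hr, 1 + |B|, by positivity, fun θ hθ s hs t ht => ?_⟩
  have h1 := hclose θ hθ s hs s ⟨le_rfl, by linarith⟩ t ht
  have h2 : ‖g p s t‖ ≤ B := by
    obtain ⟨k, a, ha, rfl⟩ := exists_nat_add_mul_eq hT₁ hs
    obtain ⟨l, c, hc, rfl⟩ := exists_nat_add_mul_eq hT₂ ht
    rw [apply_add_nat_mul hT₂.le (hg.per₂ p hp _ hs) l hc.1,
      apply_add_nat_mul (f := fun s => g p s c) hT₁.le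
      (fun s hs => hg.per₁ p hp s hs c hc.1) k ha.1]
    exact hB (a, c) ⟨ha, hc⟩
  calc ‖g θ s t‖ = ‖(g θ s t - g p s t) + g p s t‖ := by rw [sub_add_cancel]
    _ ≤ 1 + B := (norm_add_le _ _).trans (add_le_add h1 h2)
    _ ≤ _ := by gcongr; exact le_abs_self B

end Periodic

/-! ### Regularity of the oscillating fields -/

section State

variable {n₁ n₂ : ℕ}

theorem norm_mkState_sub_le (x : EuclideanSpace ℝ (Fin n₁)) (z : EuclideanSpace ℝ (Fin n₂))
    (θ : State n₁ n₂) : ‖mkState x z - θ‖ ≤ ‖x - θ.fst‖ + ‖z - θ.snd‖ := by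
  have h := WithLp.prod_norm_sq_eq_of_L2 (mkState x z - θ)
  have h1 : (mkState x z - θ).fst = x - θ.fst := rfl
  have h2 : (mkState x z - θ).snd = z - θ.snd := rfl
  rw [h1, h2] at h
  refine abs_le_of_sq_le_sq' ?_ (by positivity) |>.2
  nlinarith [norm_nonneg (x - θ.fst), norm_nonneg (z - θ.snd)]

theorem norm_fst_sub_le (θ θ' : State n₁ n₂) : ‖θ.fst - θ'.fst‖ ≤ ‖θ - θ'‖ :=
  WithLp.norm_fst_le _ (θ - θ')

theorem norm_snd_sub_le (θ θ' : State n₁ n₂) : ‖θ.snd - θ'.snd‖ ≤ ‖θ - θ'‖ :=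
  WithLp.norm_snd_le _ (θ - θ')

theorem continuous_mkState :
    Continuous fun q : EuclideanSpace ℝ (Fin n₁) × EuclideanSpace ℝ (Fin n₂) => mkState q.1 q.2 :=
  WithLp.prod_continuous_toLp _ _ _

namespace Data

/-- The Lipschitz bound compares only points with equal `τ₂`, so `q` is compared with the point `m
q` that has the base values of `(θ, τ₁)` and the fast phase of `q`; continuity in `τ₂` does the
rest. -/
theorem LipOn.continuousOn {S : Set (State n₁ n₂)}
    {f : State n₁ n₂ → ℝ → ℝ → EuclideanSpace ℝ (Fin n₁)} (hf : LipOn S f) :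
    ContinuousOn (fun q : State n₁ n₂ × ℝ × ℝ => f q.1 q.2.1 q.2.2) (S ×ˢ (Ici 0 ×ˢ Ici 0)) := by
  intro p hp
  obtain ⟨L, N, hN, hL⟩ := hf.1 p hp
  set m : State n₁ n₂ × ℝ × ℝ → State n₁ n₂ × ℝ × ℝ := fun q => (p.1, p.2.1, q.2.2)
  have hm : Tendsto m (𝓝[S ×ˢ (Ici 0 ×ˢ Ici 0)] p) (𝓝[S ×ˢ (Ici 0 ×ˢ Ici 0)] p) := by
    refine tendsto_nhdsWithin_iff.2 ⟨?_, ?_⟩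
    · have : Continuous m := by fun_prop
      exact (this.tendsto p).mono_left nhdsWithin_le_nhds
    · filter_upwards [self_mem_nhdsWithin] with q hq
      exact ⟨hp.1, hp.2.1, hq.2.2⟩
  have h1 : Tendsto (fun q => L * dist q (m q)) (𝓝[S ×ˢ (Ici 0 ×ˢ Ici 0)] p) (𝓝 0) := by
    have : Continuous fun q => L * dist q (m q) := by fun_prop
    simpa [m] using (this.tendsto p).mono_left (nhdsWithin_le_nhds (s := S ×ˢ (Ici 0 ×ˢ Ici 0)))
  have h2 : Tendsto (fun q : State n₁ n₂ × ℝ × ℝ => f p.1 p.2.1 q.2.2)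
      (𝓝[S ×ˢ (Ici 0 ×ˢ Ici 0)] p) (𝓝 (f p.1 p.2.1 p.2.2)) := by
    refine (hf.2 p.1 hp.1 p.2.1 hp.2.1 p.2.2 hp.2.2).tendsto.comp
      (tendsto_nhdsWithin_iff.2 ⟨?_, ?_⟩)
    · exact ((by fun_prop : Continuous fun q : State n₁ n₂ × ℝ × ℝ => q.2.2).tendsto p).mono_left
        nhdsWithin_le_nhds
    · filter_upwards [self_mem_nhdsWithin] with q hq using hq.2.2
  have h3 : Tendsto (fun q : State n₁ n₂ × ℝ × ℝ => f q.1 q.2.1 q.2.2 - f p.1 p.2.1 q.2.2)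
      (𝓝[S ×ˢ (Ici 0 ×ˢ Ici 0)] p) (𝓝 0) := by
    refine squeeze_zero_norm' ?_ h1
    filter_upwards [hN, hm hN] with q hq hq'
    exact hL q hq (m q) hq' rfl
  simpa [ContinuousWithinAt] using h3.add h2

section Derivative

variable {S : Set (State n₁ n₂)} {f : State n₁ n₂ → ℝ → ℝ → EuclideanSpace ℝ (Fin n₁)}
  {f' : State n₁ n₂ → ℝ → ℝ → (EuclideanSpace ℝ (Fin n₁) × ℝ →L[ℝ] EuclideanSpace ℝ (Fin n₁))}

/-- `f'` is the derivative of `f` in `(x, τ₁)` on `S × [0, ∞)²`. -/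
def HasPartialDeriv (S : Set (State n₁ n₂))
    (f : State n₁ n₂ → ℝ → ℝ → EuclideanSpace ℝ (Fin n₁))
    (f' : State n₁ n₂ → ℝ → ℝ →
      (EuclideanSpace ℝ (Fin n₁) × ℝ →L[ℝ] EuclideanSpace ℝ (Fin n₁))) : Prop :=
  ∀ θ ∈ S, ∀ τ₁ ∈ Ici (0 : ℝ), ∀ τ₂ ∈ Ici (0 : ℝ),
    HasFDerivWithinAt
      (fun y : EuclideanSpace ℝ (Fin n₁) × ℝ => f (mkState y.1 θ.snd) y.2 τ₂)
      (f' θ τ₁ τ₂) (univ ×ˢ Ici 0) (θ.fst, τ₁)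

theorem HasPartialDeriv.norm_sub_le (hd : HasPartialDeriv S f f')
    {X : Set (EuclideanSpace ℝ (Fin n₁) × ℝ)} (hX : Convex ℝ X) {z : EuclideanSpace ℝ (Fin n₂)}
    {t : ℝ} (ht : 0 ≤ t) {φ : EuclideanSpace ℝ (Fin n₁) × ℝ →L[ℝ] EuclideanSpace ℝ (Fin n₁)}
    {c : ℝ} (hXS : ∀ y ∈ X, mkState y.1 z ∈ S ∧ 0 ≤ y.2)
    (hc : ∀ y ∈ X, ‖f' (mkState y.1 z) y.2 t - φ‖ ≤ c)
    {y y' : EuclideanSpace ℝ (Fin n₁) × ℝ} (hy : y ∈ X) (hy' : y' ∈ X) :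
    ‖f (mkState y'.1 z) y'.2 t - f (mkState y.1 z) y.2 t - φ (y' - y)‖ ≤ c * ‖y' - y‖ :=
  hX.norm_image_sub_le_of_norm_hasFDerivWithin_le'
    (f := fun y : EuclideanSpace ℝ (Fin n₁) × ℝ => f (mkState y.1 z) y.2 t)
    (f' := fun y => f' (mkState y.1 z) y.2 t)
    (fun y hy => (hd (mkState y.1 z) (hXS y hy).1 y.2 (hXS y hy).2 t ht).mono
      fun w hw => ⟨mem_univ _, (hXS w hw).2⟩) hc hy hy'

theorem HasPartialDeriv.hasFDerivAt (hd : HasPartialDeriv S f f') {θ : State n₁ n₂} (hθ : θ ∈ S)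
    {s t : ℝ} (hs : 0 ≤ s) (ht : 0 ≤ t) :
    HasFDerivAt (fun x => f (mkState x θ.snd) s t)
      ((f' θ s t).comp (ContinuousLinearMap.inl ℝ _ ℝ)) θ.fst := by
  have h1 := (hasFDerivAt_prodMk_left (𝕜 := ℝ) θ.fst s).hasFDerivWithinAt (s := univ)
  have hm : MapsTo (fun x => (x, s)) univ
      ((univ : Set (EuclideanSpace ℝ (Fin n₁))) ×ˢ Ici (0 : ℝ)) := fun x _ => ⟨mem_univ _, hs⟩
  have h2 := (hd θ hθ s hs t ht).comp θ.fst h1 hm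
  exact h2.hasFDerivAt univ_mem

theorem HasPartialDeriv.hasDerivAt (hd : HasPartialDeriv S f f') {θ : State n₁ n₂} (hθ : θ ∈ S)
    {s t : ℝ} (hs : 0 < s) (ht : 0 ≤ t) :
    HasDerivAt (fun r => f θ r t) (f' θ s t (0, 1)) s := by
  have h1 := (hasFDerivAt_prodMk_right (𝕜 := ℝ) θ.fst s)
  have h2 := (hd θ hθ s hs.le t ht).hasFDerivAt
    (prod_mem_nhds univ_mem (Ici_mem_nhds hs))
  have h3 : HasDerivAt (fun r => f θ r t) _ s := (h2.comp s h1).hasDerivAt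
  simpa using h3

theorem uniqueDiffWithinAt_halfSpace {E : Type*} [NormedAddCommGroup E] [NormedSpace ℝ E] (x : E)
    {s : ℝ} (hs : 0 ≤ s) : UniqueDiffWithinAt ℝ ((univ : Set E) ×ˢ Ici (0 : ℝ)) (x, s) :=
  (uniqueDiffOn_univ.prod (uniqueDiffOn_Ici 0)) _ ⟨mem_univ _, hs⟩

theorem eventually_mkState_mem (hS : IsOpen S) {θ : State n₁ n₂} (hθ : θ ∈ S) (s : ℝ) :
    ∀ᶠ y : EuclideanSpace ℝ (Fin n₁) × ℝ in 𝓝[univ ×ˢ Ici 0] (θ.fst, s),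
      mkState y.1 θ.snd ∈ S := by
  have hc : Continuous fun y : EuclideanSpace ℝ (Fin n₁) × ℝ => mkState y.1 θ.snd :=
    continuous_mkState.comp (by fun_prop : Continuous fun y : EuclideanSpace ℝ (Fin n₁) × ℝ =>
      (y.1, θ.snd))
  exact nhdsWithin_le_nhds (hc.continuousAt (x := (θ.fst, s)) (hS.mem_nhds hθ))

/-- The half space is a set of unique differentiability, including at `τ₁ = 0`, so the derivative
inherits the periods of the function. -/
theorem HasPartialDeriv.add_period_right (hd : HasPartialDeriv S f f') (hS : IsOpen S) {T : ℝ}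
    (hT : 0 ≤ T) (hf : ∀ θ ∈ S, ∀ s, 0 ≤ s → ∀ t, 0 ≤ t → f θ s (t + T) = f θ s t)
    {θ : State n₁ n₂} (hθ : θ ∈ S) {s t : ℝ} (hs : 0 ≤ s) (ht : 0 ≤ t) :
    f' θ s (t + T) = f' θ s t := by
  refine (uniqueDiffWithinAt_halfSpace _ hs).eq
    (hd θ hθ s hs (t + T) (add_nonneg ht hT)) ?_
  refine (hd θ hθ s hs t ht).congr_of_eventuallyEq ?_ (hf θ hθ s hs t ht)
  filter_upwards [self_mem_nhdsWithin, eventually_mkState_mem hS hθ s] with y hy hyS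
  exact hf _ hyS _ hy.2 t ht

theorem HasPartialDeriv.add_period_left (hd : HasPartialDeriv S f f') (hS : IsOpen S) {T : ℝ}
    (hT : 0 ≤ T) (hf : ∀ θ ∈ S, ∀ s, 0 ≤ s → ∀ t, 0 ≤ t → f θ (s + T) t = f θ s t)
    {θ : State n₁ n₂} (hθ : θ ∈ S) {s t : ℝ} (hs : 0 ≤ s) (ht : 0 ≤ t) :
    f' θ (s + T) t = f' θ s t := by
  refine (uniqueDiffWithinAt_halfSpace θ.fst hs).eq ?_ (hd θ hθ s hs t ht)
  have h1 : HasFDerivWithinAt (fun y : EuclideanSpace ℝ (Fin n₁) × ℝ => y + (0, T))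
      (ContinuousLinearMap.id ℝ _) (univ ×ˢ Ici 0) (θ.fst, s) :=
    (hasFDerivWithinAt_id _ _).add_const _
  have h2 : HasFDerivWithinAt
      (fun y : EuclideanSpace ℝ (Fin n₁) × ℝ => f (mkState y.1 θ.snd) y.2 t)
      (f' θ (s + T) t) (univ ×ˢ Ici 0) ((θ.fst, s) + (0, T)) := by
    simpa using hd θ hθ (s + T) (add_nonneg hs hT) t ht
  have hm : MapsTo (fun y : EuclideanSpace ℝ (Fin n₁) × ℝ => y + (0, T)) (univ ×ˢ Ici 0)
      (univ ×ˢ Ici 0) := fun y hy => ⟨mem_univ _, add_nonneg hy.2 hT⟩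
  have h3 := h2.comp (θ.fst, s) h1 hm
  rw [ContinuousLinearMap.comp_id] at h3
  refine h3.congr_of_eventuallyEq ?_ ?_
  · filter_upwards [self_mem_nhdsWithin, eventually_mkState_mem hS hθ s] with y hy hyS
    simpa using (hf _ hyS _ hy.2 t ht).symm
  · simp only [Prod.mk_add_mk, add_zero, Function.comp]
    exact (hf θ hθ s hs t ht).symm

end Derivative

end Data

end State

namespace Data

variable {n₁ n₂ : ℕ} {S : Set (State n₁ n₂)}
  {f : State n₁ n₂ → ℝ → ℝ → EuclideanSpace ℝ (Fin n₁)}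
  {f' : State n₁ n₂ → ℝ → ℝ → (EuclideanSpace ℝ (Fin n₁) × ℝ →L[ℝ] EuclideanSpace ℝ (Fin n₁))}

/-- The derivative is Lipschitz in `(x, τ₁)`, locally uniformly in `(z, τ₂)`. -/
def LipDeriv (S : Set (State n₁ n₂)) (f' : State n₁ n₂ → ℝ → ℝ →
    (EuclideanSpace ℝ (Fin n₁) × ℝ →L[ℝ] EuclideanSpace ℝ (Fin n₁))) : Prop :=
  ∀ p ∈ S ×ˢ (Ici (0 : ℝ) ×ˢ Ici (0 : ℝ)),
    ∃ L : ℝ, ∃ N ∈ 𝓝[S ×ˢ (Ici (0 : ℝ) ×ˢ Ici (0 : ℝ))] p, ∀ q ∈ N, ∀ q' ∈ N,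
      q.1.snd = q'.1.snd → q.2.2 = q'.2.2 →
        ‖f' q.1 q.2.1 q.2.2 - f' q'.1 q'.2.1 q'.2.2‖ ≤ L * dist q q'

theorem dist_mkState_fst (x x' : EuclideanSpace ℝ (Fin n₁)) (z : EuclideanSpace ℝ (Fin n₂)) :
    dist (mkState x z) (mkState x' z) = dist x x' := by
  rw [dist_eq_norm, dist_eq_norm]
  refine le_antisymm ?_ (norm_fst_sub_le (mkState x z) (mkState x' z))
  refine (norm_mkState_sub_le x z (mkState x' z)).trans_eq ?_
  change ‖x - x'‖ + ‖z - z‖ = _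
  simp

/-- Difference quotients in the direction `v` approximate the derivative locally uniformly. -/
theorem HasPartialDeriv.exists_difference_quotient (hd : HasPartialDeriv S f f') (hS : IsOpen S)
    (hl : LipDeriv S f') {p : State n₁ n₂ × ℝ × ℝ} (hp : p ∈ S ×ˢ (Ici (0 : ℝ) ×ˢ Ici (0 : ℝ)))
    (v : EuclideanSpace ℝ (Fin n₁) × ℝ) (hv : 0 ≤ v.2) {η : ℝ} (hη : 0 < η) :
    ∃ h > 0, ∀ᶠ q in 𝓝[S ×ˢ (Ici (0 : ℝ) ×ˢ Ici (0 : ℝ))] p,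
      mkState (q.1.fst + h • v.1) q.1.snd ∈ S ∧
      ‖h⁻¹ • (f (mkState (q.1.fst + h • v.1) q.1.snd) (q.2.1 + h * v.2) q.2.2 -
        f q.1 q.2.1 q.2.2) - f' q.1 q.2.1 q.2.2 v‖ ≤ η := by
  obtain ⟨L, N, hN, hL⟩ := hl p hp
  obtain ⟨r₁, hr₁, hN⟩ := Metric.mem_nhdsWithin_iff.1 hN
  obtain ⟨r₂, hr₂, hB⟩ := Metric.isOpen_iff.1 hS p.1 hp.1
  set r := min r₁ r₂
  have hr : 0 < r := lt_min hr₁ hr₂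
  -- The first bound keeps the segment inside the ball of radius `r` around `p`. The second makes
  -- the mean value error `|L| h ‖v‖ ^ 2` at most `η`.
  set h := min (r / (2 * (‖v‖ + 1))) (η / ((|L| + 1) * (‖v‖ + 1) ^ 2)) with hh
  have hv1 : 0 < ‖v‖ + 1 := by positivity
  have hpos : 0 < h := by positivity
  have hhr : h * (‖v‖ + 1) ≤ r / 2 := by
    calc _ ≤ r / (2 * (‖v‖ + 1)) * (‖v‖ + 1) := by gcongr; exact min_le_left _ _
      _ = r / 2 := by field_simp
  have hhη : h * ((|L| + 1) * (‖v‖ + 1) ^ 2) ≤ η := by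
    calc _ ≤ η / ((|L| + 1) * (‖v‖ + 1) ^ 2) * ((|L| + 1) * (‖v‖ + 1) ^ 2) := by
          gcongr; exact min_le_right _ _
      _ = η := by field_simp
  refine ⟨h, hpos, ?_⟩
  filter_upwards [self_mem_nhdsWithin, nhdsWithin_le_nhds (Metric.ball_mem_nhds p (half_pos hr))]
    with q hqS hqp
  set X : Set (EuclideanSpace ℝ (Fin n₁) × ℝ) :=
    Metric.closedBall (q.1.fst, q.2.1) (h * ‖v‖) ∩ (univ ×ˢ Ici 0)
  have hX : Convex ℝ X :=
    (convex_closedBall _ _).inter (convex_univ.prod (convex_Ici 0))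
  have hdist : ∀ y ∈ X, dist ((mkState y.1 q.1.snd, y.2, q.2.2) : State n₁ n₂ × ℝ × ℝ) q
      ≤ h * ‖v‖ := by
    intro y hy
    have hy1 := hy.1
    rw [Metric.mem_closedBall, Prod.dist_eq, max_le_iff] at hy1
    rw [Prod.dist_eq, Prod.dist_eq]
    refine max_le ?_ (max_le hy1.2 ?_)
    · exact (dist_mkState_fst y.1 q.1.fst q.1.snd).trans_le hy1.1
    · simp only [dist_self]; positivity
  have hle : h * ‖v‖ ≤ r / 2 := by nlinarith
  have hnear : ∀ y ∈ X, dist ((mkState y.1 q.1.snd, y.2, q.2.2) : State n₁ n₂ × ℝ × ℝ) p < r :=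
    fun y hy => (dist_triangle _ q p).trans_lt (by
      have := hdist y hy; rw [Metric.mem_ball] at hqp; linarith)
  have hXS : ∀ y ∈ X, mkState y.1 q.1.snd ∈ S ∧ 0 ≤ y.2 := fun y hy =>
    ⟨hB (lt_of_le_of_lt (le_max_left _ _) ((hnear y hy).trans_le (min_le_right _ _))), hy.2.2⟩
  have hXN : ∀ y ∈ X, ((mkState y.1 q.1.snd, y.2, q.2.2) : State n₁ n₂ × ℝ × ℝ) ∈ N :=
    fun y hy => hN ⟨(hnear y hy).trans_le (min_le_left _ _), (hXS y hy).1, (hXS y hy).2, hqS.2.2⟩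
  have hq : (q.1.fst, q.2.1) ∈ X :=
    ⟨Metric.mem_closedBall_self (by positivity), mem_univ _, hqS.2.1⟩
  have hqv : (q.1.fst, q.2.1) + h • v ∈ X := by
    refine ⟨?_, mem_univ _, ?_⟩
    · rw [Metric.mem_closedBall, dist_self_add_left, norm_smul, Real.norm_of_nonneg hpos.le]
    · exact add_nonneg hqS.2.1 (mul_nonneg hpos.le hv)
  refine ⟨(hXS _ hqv).1, ?_⟩
  have key := hd.norm_sub_le (φ := f' q.1 q.2.1 q.2.2) (c := |L| * (h * ‖v‖)) hX hqS.2.2 hXS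
    (fun y hy => (hL _ (hXN y hy) _ (hXN _ hq) rfl rfl).trans (by
      refine (mul_le_mul_of_nonneg_right (le_abs_self L) dist_nonneg).trans ?_
      gcongr
      exact hdist y hy)) hq hqv
  rw [add_sub_cancel_left, map_smul, norm_smul, Real.norm_of_nonneg hpos.le] at key
  have e : h⁻¹ • (f (mkState (q.1.fst + h • v.1) q.1.snd) (q.2.1 + h * v.2) q.2.2 -
        f q.1 q.2.1 q.2.2) - f' q.1 q.2.1 q.2.2 v =
      h⁻¹ • (f (mkState (q.1.fst + h • v.1) q.1.snd) (q.2.1 + h * v.2) q.2.2 -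
        f q.1 q.2.1 q.2.2 - h • f' q.1 q.2.1 q.2.2 v) := by
    rw [smul_sub h⁻¹ (_ - _), smul_smul, inv_mul_cancel₀ hpos.ne', one_smul]
  rw [e, norm_smul, norm_inv, Real.norm_of_nonneg hpos.le, inv_mul_le_iff₀ hpos]
  refine key.trans ?_
  calc |L| * (h * ‖v‖) * (h * ‖v‖) = h * (h * (|L| * ‖v‖ ^ 2)) := by ring
    _ ≤ h * (h * ((|L| + 1) * (‖v‖ + 1) ^ 2)) := by gcongr <;> linarith
    _ ≤ h * η := by gcongr

/-- Continuity of the derivative in `(z, τ₂)` is not assumed. It holds because the derivative is a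
locally uniform limit of difference quotients of the jointly continuous `f`. Directions with
nonnegative `τ₁`-component come first, because the quotients must stay in the half space; the others
follow by linearity. -/
theorem HasPartialDeriv.continuousOn (hd : HasPartialDeriv S f f') (hS : IsOpen S)
    (hl : LipDeriv S f')
    (hf : ContinuousOn (fun q : State n₁ n₂ × ℝ × ℝ => f q.1 q.2.1 q.2.2) (S ×ˢ (Ici 0 ×ˢ Ici 0))) :
    ContinuousOn (fun q : State n₁ n₂ × ℝ × ℝ => f' q.1 q.2.1 q.2.2) (S ×ˢ (Ici 0 ×ˢ Ici 0)) := by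
  have main : ∀ v : EuclideanSpace ℝ (Fin n₁) × ℝ, 0 ≤ v.2 →
      ContinuousOn (fun q : State n₁ n₂ × ℝ × ℝ => f' q.1 q.2.1 q.2.2 v)
        (S ×ˢ (Ici 0 ×ˢ Ici 0)) := by
    intro v hv p hp
    refine Metric.tendsto_nhds.2 fun η hη => ?_
    obtain ⟨h, hpos, hq⟩ := hd.exists_difference_quotient hS hl hp v hv
      (by positivity : 0 < η / 4)
    have hp' := hq.self_of_nhdsWithin hp
    have hpv : 0 ≤ h * v.2 := mul_nonneg hpos.le hv
    have hc : ContinuousWithinAt (fun q : State n₁ n₂ × ℝ × ℝ =>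
        h⁻¹ • (f (mkState (q.1.fst + h • v.1) q.1.snd) (q.2.1 + h * v.2) q.2.2 -
          f q.1 q.2.1 q.2.2)) (S ×ˢ (Ici 0 ×ˢ Ici 0)) p := by
      refine (ContinuousWithinAt.sub ?_ (hf p hp)).const_smul h⁻¹
      have hm : Continuous fun q : State n₁ n₂ × ℝ × ℝ =>
          ((mkState (q.1.fst + h • v.1) q.1.snd, q.2.1 + h * v.2, q.2.2) :
            State n₁ n₂ × ℝ × ℝ) := by
        refine Continuous.prodMk ?_ (by fun_prop)
        exact continuous_mkState.comp (f := fun q : State n₁ n₂ × ℝ × ℝ =>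
          (q.1.fst + h • v.1, q.1.snd)) (by fun_prop)
      refine (hf (mkState (p.1.fst + h • v.1) p.1.snd, p.2.1 + h * v.2, p.2.2)
        ⟨hp'.1, add_nonneg hp.2.1 hpv, hp.2.2⟩).tendsto.comp
        (tendsto_nhdsWithin_iff.2 ⟨(hm.tendsto p).mono_left nhdsWithin_le_nhds, ?_⟩)
      filter_upwards [hq, self_mem_nhdsWithin] with q hq hqS
      exact ⟨hq.1, add_nonneg hqS.2.1 hpv, hqS.2.2⟩
    filter_upwards [hq, Metric.tendsto_nhds.1 hc (η / 4) (by positivity)] with q h1 h2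
    have h3 := h1.2
    have h4 := hp'.2
    rw [← dist_eq_norm] at h3 h4
    exact lt_of_le_of_lt (dist_triangle4_left
      (h⁻¹ • (f (mkState (q.1.fst + h • v.1) q.1.snd) (q.2.1 + h * v.2) q.2.2 - f q.1 q.2.1 q.2.2))
      (h⁻¹ • (f (mkState (p.1.fst + h • v.1) p.1.snd) (p.2.1 + h * v.2) p.2.2 - f p.1 p.2.1 p.2.2))
      _ _) (by linarith)
  rw [continuousOn_clm_apply]
  intro v
  rcases le_total 0 v.2 with hv | hv
  · exact main v hv
  · exact (main (-v) (by simpa using hv)).neg.congr fun q _ => by simp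

/-- The local constants are made uniform over the compact period cell, and then over all phases by
periodicity. -/
theorem LipOn.exists_lipschitz {T₁ T₂ : ℝ} (hf : LipOn S f) (hS : IsOpen S) (hT₁ : 0 < T₁)
    (hT₂ : 0 < T₂) (h₁ : ∀ θ ∈ S, ∀ s, 0 ≤ s → ∀ t, 0 ≤ t → f θ (s + T₁) t = f θ s t)
    (h₂ : ∀ θ ∈ S, ∀ s, 0 ≤ s → ∀ t, 0 ≤ t → f θ s (t + T₂) = f θ s t)
    {p : State n₁ n₂} (hp : p ∈ S) :
    ∃ r > 0, ∃ L, 0 ≤ L ∧ ∀ θ ∈ Metric.ball p r, ∀ θ' ∈ Metric.ball p r, ∀ s, 0 ≤ s → ∀ t, 0 ≤ t →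
      ‖f θ s t - f θ' s t‖ ≤ L * ‖θ - θ'‖ := by
  obtain ⟨r₀, hr₀, hB⟩ := Metric.isOpen_iff.1 hS p hp
  have hK : IsCompact (Icc 0 T₁ ×ˢ Icc 0 T₂) := isCompact_Icc.prod isCompact_Icc
  have main : ∃ r > 0, ∃ L, 0 ≤ L ∧ ∀ θ ∈ Metric.ball p r ∩ S, ∀ θ' ∈ Metric.ball p r ∩ S,
      ∀ τ ∈ Icc 0 T₁ ×ˢ Icc 0 T₂, ‖f θ τ.1 τ.2 - f θ' τ.1 τ.2‖ ≤ L * ‖θ - θ'‖ := by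
    refine hK.induction_on (p := fun W => ∃ r > 0, ∃ L, 0 ≤ L ∧ ∀ θ ∈ Metric.ball p r ∩ S,
      ∀ θ' ∈ Metric.ball p r ∩ S, ∀ τ ∈ W, ‖f θ τ.1 τ.2 - f θ' τ.1 τ.2‖ ≤ L * ‖θ - θ'‖)
      ⟨1, one_pos, 0, le_rfl, by simp⟩ ?_ ?_ ?_
    · rintro W W' hW ⟨r, hr, L, hL, h⟩
      exact ⟨r, hr, L, hL, fun θ hθ θ' hθ' τ hτ => h θ hθ θ' hθ' τ (hW hτ)⟩
    · rintro W W' ⟨r, hr, L, hL, h⟩ ⟨r', hr', L', hL', h'⟩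
      have m1 : ∀ θ ∈ Metric.ball p (min r r') ∩ S, θ ∈ Metric.ball p r ∩ S := fun θ hθ =>
        ⟨Metric.ball_subset_ball (min_le_left _ _) hθ.1, hθ.2⟩
      have m2 : ∀ θ ∈ Metric.ball p (min r r') ∩ S, θ ∈ Metric.ball p r' ∩ S := fun θ hθ =>
        ⟨Metric.ball_subset_ball (min_le_right _ _) hθ.1, hθ.2⟩
      refine ⟨min r r', lt_min hr hr', max L L', le_max_of_le_left hL,
        fun θ hθ θ' hθ' τ hτ => ?_⟩
      rcases hτ with hτ | hτ
      · exact (h θ (m1 θ hθ) θ' (m1 θ' hθ') τ hτ).trans (by gcongr; exact le_max_left _ _)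
      · exact (h' θ (m2 θ hθ) θ' (m2 θ' hθ') τ hτ).trans (by gcongr; exact le_max_right _ _)
    · intro τ hτ
      obtain ⟨L, N, hN, hL⟩ := hf.1 (p, τ) ⟨hp, hτ.1.1, hτ.2.1⟩
      obtain ⟨r, hr, hN⟩ := Metric.mem_nhdsWithin_iff.1 hN
      refine ⟨Metric.ball τ r ∩ (Icc 0 T₁ ×ˢ Icc 0 T₂), ?_, r, hr, |L|, abs_nonneg L,
        fun θ hθ θ' hθ' σ hσ => ?_⟩
      · rw [inter_comm]
        exact inter_mem_nhdsWithin _ (Metric.ball_mem_nhds τ hr)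
      · have hmem : ∀ θ ∈ Metric.ball p r ∩ S, ((θ, σ) : State n₁ n₂ × ℝ × ℝ) ∈ N :=
          fun θ hθ => hN ⟨by
            rw [Metric.mem_ball, Prod.dist_eq]; exact max_lt hθ.1 hσ.1, hθ.2, hσ.2.1.1, hσ.2.2.1⟩
        refine (hL _ (hmem θ hθ) _ (hmem θ' hθ') rfl).trans ?_
        rw [Prod.dist_eq]
        simp only [dist_self, dist_eq_norm, max_eq_left (norm_nonneg (θ - θ'))]
        gcongr
        exact le_abs_self L
  obtain ⟨r, hr, L, hL, h⟩ := main
  refine ⟨min r r₀, lt_min hr hr₀, L, hL, fun θ hθ θ' hθ' s hs t ht => ?_⟩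
  have m1 : ∀ θ ∈ Metric.ball p (min r r₀), θ ∈ Metric.ball p r ∩ S := fun θ hθ =>
    ⟨Metric.ball_subset_ball (min_le_left _ _) hθ,
      hB (Metric.ball_subset_ball (min_le_right _ _) hθ)⟩
  obtain ⟨k, a, ha, rfl⟩ := exists_nat_add_mul_eq hT₁ hs
  obtain ⟨l, c, hc, rfl⟩ := exists_nat_add_mul_eq hT₂ ht
  have e : ∀ θ ∈ Metric.ball p (min r r₀), f θ (a + k * T₁) (c + l * T₂) = f θ a c := by
    intro θ hθ
    rw [apply_add_nat_mul hT₂.le (h₂ θ (m1 θ hθ).2 _ hs) l hc.1]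
    exact apply_add_nat_mul (f := fun s => f θ s c) hT₁.le
      (fun s hs => h₁ θ (m1 θ hθ).2 s hs c hc.1) k ha.1
  rw [e θ hθ, e θ' hθ']
  exact h θ (m1 θ hθ) θ' (m1 θ' hθ') (a, c) ⟨ha, hc⟩

end Data

/-! ### The oscillating fields frozen at a state. -/

namespace Data

variable {n₁ n₂ : ℕ}

/-- The conditions on `φ₁` and `φ₂` on an open neighbourhood `S` of `C`, with the derivative `f'` of
`φ₁` in `(x, τ₁)` made explicit. -/
structure IsOscillating (d : Data n₁ n₂) (T₁ T₂ : ℝ) (S : Set (State n₁ n₂))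
    (f' : State n₁ n₂ → ℝ → ℝ →
      (EuclideanSpace ℝ (Fin n₁) × ℝ →L[ℝ] EuclideanSpace ℝ (Fin n₁))) : Prop where
  pos₁ : 0 < T₁
  pos₂ : 0 < T₂
  isOpen : IsOpen S
  subset : d.C ⊆ S
  lip₁ : LipOn S d.φ₁
  lip₂ : LipOn S d.φ₂
  hasDeriv : HasPartialDeriv S d.φ₁ f'
  lipDeriv : LipDeriv S f'
  per₁₁ : ∀ θ ∈ S, ∀ s, 0 ≤ s → ∀ t, 0 ≤ t → d.φ₁ θ (s + T₁) t = d.φ₁ θ s t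
  per₁₂ : ∀ θ ∈ S, ∀ s, 0 ≤ s → ∀ t, 0 ≤ t → d.φ₁ θ s (t + T₂) = d.φ₁ θ s t
  per₂₁ : ∀ θ ∈ S, ∀ s, 0 ≤ s → ∀ t, 0 ≤ t → d.φ₂ θ (s + T₁) t = d.φ₂ θ s t
  per₂₂ : ∀ θ ∈ S, ∀ s, 0 ≤ s → ∀ t, 0 ≤ t → d.φ₂ θ s (t + T₂) = d.φ₂ θ s t
  mean : ∀ θ ∈ S, ∀ s, 0 ≤ s → ∫ t in (0 : ℝ)..T₂, d.φ₁ θ s t = 0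

theorem OscillationRegularity.exists_isOscillating {d : Data n₁ n₂} {T₁ T₂ : ℝ}
    (h : d.OscillationRegularity T₁ T₂) : ∃ S f', d.IsOscillating T₁ T₂ S f' := by
  obtain ⟨h₁, h₂, δ, hδ, hl₁, ⟨f', hd, hl⟩, hl₂, hper, hmean⟩ := h
  exact ⟨Metric.thickening δ d.C, f', h₁, h₂, Metric.isOpen_thickening,
    Metric.self_subset_thickening hδ _, hl₁, hl₂, hd, hl,
    fun θ hθ s hs t ht => (hper θ hθ s hs t ht).1,
    fun θ hθ s hs t ht => (hper θ hθ s hs t ht).2.1,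
    fun θ hθ s hs t ht => (hper θ hθ s hs t ht).2.2.1,
    fun θ hθ s hs t ht => (hper θ hθ s hs t ht).2.2.2, hmean⟩

/-- Extension of a function on the quadrant `[0, ∞)²` to the plane. -/
def quadrantExtend {F : Type*} (g : ℝ → ℝ → F) (s t : ℝ) : F := g (max s 0) (max t 0)

theorem quadrantExtend_of_nonneg {F : Type*} (g : ℝ → ℝ → F) {s t : ℝ} (hs : 0 ≤ s) (ht : 0 ≤ t) :
    quadrantExtend g s t = g s t := by
  rw [quadrantExtend, max_eq_left hs, max_eq_left ht]

theorem continuous_quadrantExtend {X F : Type*} [PseudoMetricSpace X] [ProperSpace X]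
    [NormedAddCommGroup F] {S : Set X} {T₁ T₂ : ℝ} {g : X → ℝ → ℝ → F}
    (hg : IsPeriodicField S T₁ T₂ g) {p : X} (hp : p ∈ S) :
    Continuous (Function.uncurry (quadrantExtend (g p))) := by
  have := hg.cont.comp_continuous (f := fun q : ℝ × ℝ => (p, max q.1 0, max q.2 0))
    (by fun_prop) fun q =>
      ⟨hp, mem_Ici.2 (le_max_right _ _), mem_Ici.2 (le_max_right _ _)⟩
  exact this

variable {d : Data n₁ n₂} {T₁ T₂ : ℝ} {S : Set (State n₁ n₂)}
  {f' : State n₁ n₂ → ℝ → ℝ → (EuclideanSpace ℝ (Fin n₁) × ℝ →L[ℝ] EuclideanSpace ℝ (Fin n₁))}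

namespace IsOscillating

theorem periodic_φ₁ (h : d.IsOscillating T₁ T₂ S f') : IsPeriodicField S T₁ T₂ d.φ₁ :=
  ⟨h.lip₁.continuousOn, h.per₁₁, h.per₁₂⟩

theorem periodic_φ₂ (h : d.IsOscillating T₁ T₂ S f') : IsPeriodicField S T₁ T₂ d.φ₂ :=
  ⟨h.lip₂.continuousOn, h.per₂₁, h.per₂₂⟩

theorem periodic_deriv (h : d.IsOscillating T₁ T₂ S f') : IsPeriodicField S T₁ T₂ f' :=
  ⟨h.hasDeriv.continuousOn h.isOpen h.lipDeriv h.lip₁.continuousOn,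
    fun _ hθ _ hs _ ht => h.hasDeriv.add_period_left h.isOpen h.pos₁.le h.per₁₁ hθ hs ht,
    fun _ hθ _ hs _ ht => h.hasDeriv.add_period_right h.isOpen h.pos₂.le h.per₁₂ hθ hs ht⟩

/-- `∂ₓφ₁` at a fixed state. -/
def derivX (f' : State n₁ n₂ → ℝ → ℝ →
    (EuclideanSpace ℝ (Fin n₁) × ℝ →L[ℝ] EuclideanSpace ℝ (Fin n₁))) (p : State n₁ n₂) (s t : ℝ) :
    EuclideanSpace ℝ (Fin n₁) →L[ℝ] EuclideanSpace ℝ (Fin n₁) :=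
  (f' p s t).comp (ContinuousLinearMap.inl ℝ _ ℝ)

/-- `∂φ₁/∂τ₁` at a fixed state. -/
def derivτ (f' : State n₁ n₂ → ℝ → ℝ →
    (EuclideanSpace ℝ (Fin n₁) × ℝ →L[ℝ] EuclideanSpace ℝ (Fin n₁))) (p : State n₁ n₂) (s t : ℝ) :
    EuclideanSpace ℝ (Fin n₁) :=
  f' p s t (0, 1)

theorem apply_eq (p : State n₁ n₂) (s t : ℝ) (v : EuclideanSpace ℝ (Fin n₁)) (r : ℝ) :
    f' p s t (v, r) = derivX f' p s t v + r • derivτ f' p s t := by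
  have : ((v, r) : EuclideanSpace ℝ (Fin n₁) × ℝ) = (v, 0) + r • (0, 1) := by simp
  rw [this, map_add, map_smul]
  rfl

theorem norm_derivX_le (p : State n₁ n₂) (s t : ℝ) : ‖derivX f' p s t‖ ≤ ‖f' p s t‖ := by
  refine (ContinuousLinearMap.opNorm_comp_le _ _).trans ?_
  exact mul_le_of_le_one_right (norm_nonneg _) (ContinuousLinearMap.norm_inl_le_one ℝ _ ℝ)

theorem periodic_derivX (h : d.IsOscillating T₁ T₂ S f') :
    IsPeriodicField S T₁ T₂ (derivX f') where
  cont := h.periodic_deriv.cont.clm_comp continuousOn_const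
  per₁ θ hθ s hs t ht := by simp only [derivX, h.periodic_deriv.per₁ θ hθ s hs t ht]
  per₂ θ hθ s hs t ht := by simp only [derivX, h.periodic_deriv.per₂ θ hθ s hs t ht]

theorem periodic_derivτ (h : d.IsOscillating T₁ T₂ S f') :
    IsPeriodicField S T₁ T₂ (derivτ f') where
  cont := h.periodic_deriv.cont.clm_apply continuousOn_const
  per₁ θ hθ s hs t ht := by simp only [derivτ, h.periodic_deriv.per₁ θ hθ s hs t ht]
  per₂ θ hθ s hs t ht := by simp only [derivτ, h.periodic_deriv.per₂ θ hθ s hs t ht]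

/-- Differentiation under the integral sign, dominated by the local bound on the derivative. It
identifies `∂ₓu₁` in the bracket and shows that `∂ₓφ₁` inherits the zero mean of `φ₁`. -/
theorem hasFDerivAt_u₁ (h : d.IsOscillating T₁ T₂ S f') {p : State n₁ n₂} (hp : p ∈ S) {s t : ℝ}
    (hs : 0 ≤ s) (ht : 0 ≤ t) :
    HasFDerivAt (fun x => d.u₁ (mkState x p.snd) s t) (∫ r in (0 : ℝ)..t, derivX f' p s r)
      p.fst := by
  obtain ⟨r₁, hr₁, B, -, hB⟩ := h.periodic_deriv.exists_bound h.isOpen h.pos₁ h.pos₂ hp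
  obtain ⟨r₂, hr₂, hS⟩ := Metric.isOpen_iff.1 h.isOpen p hp
  have hmem : ∀ x ∈ Metric.ball p.fst (min r₁ r₂),
      mkState x p.snd ∈ Metric.ball p r₁ ∧ mkState x p.snd ∈ S := by
    intro x hx
    have e : dist (mkState x p.snd) p < min r₁ r₂ := by
      have := dist_mkState_fst x p.fst p.snd
      exact this.trans_lt hx
    exact ⟨e.trans_le (min_le_left _ _), hS (e.trans_le (min_le_right _ _))⟩
  have hnear : Metric.ball p.fst (min r₁ r₂) ∈ 𝓝 p.fst := Metric.ball_mem_nhds _ (lt_min hr₁ hr₂)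
  have cont : ∀ {F : Type} [NormedAddCommGroup F] {g : State n₁ n₂ → ℝ → ℝ → F},
      IsPeriodicField S T₁ T₂ g → ∀ θ ∈ S, ContinuousOn (g θ s) (Icc 0 t) := by
    intro F _ g hg θ hθ
    exact hg.cont.comp (f := fun r : ℝ => (θ, s, r)) (by fun_prop) fun r hr => ⟨hθ, hs, hr.1⟩
  refine intervalIntegral.hasFDerivAt_integral_of_dominated_of_fderiv_le
    (F := fun x r => d.φ₁ (mkState x p.snd) s r)
    (F' := fun x r => derivX f' (mkState x p.snd) s r)
    (bound := fun _ => B) hnear ?_ ?_ ?_ ?_ ?_ ?_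
  · filter_upwards [hnear] with x hx
    rw [uIoc_of_le ht]
    exact ((cont h.periodic_φ₁ _ (hmem x hx).2).mono Ioc_subset_Icc_self).aestronglyMeasurable
      measurableSet_Ioc
  · refine ContinuousOn.intervalIntegrable ?_
    rw [uIcc_of_le ht]
    exact cont h.periodic_φ₁ p hp
  · rw [uIoc_of_le ht]
    exact ((cont h.periodic_derivX p hp).mono Ioc_subset_Icc_self).aestronglyMeasurable
      measurableSet_Ioc
  · refine .of_forall fun r hr x hx => ?_
    rw [uIoc_of_le ht] at hr
    exact (norm_derivX_le _ _ _).trans (hB _ (hmem x hx).1 s hs r hr.1.le)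
  · simp
  · refine .of_forall fun r hr x hx => ?_
    rw [uIoc_of_le ht] at hr
    exact h.hasDeriv.hasFDerivAt (hmem x hx).2 hs hr.1.le

theorem integral_derivX (h : d.IsOscillating T₁ T₂ S f') {p : State n₁ n₂} (hp : p ∈ S) {s : ℝ}
    (hs : 0 ≤ s) : ∫ r in (0 : ℝ)..T₂, derivX f' p s r = 0 := by
  refine (h.hasFDerivAt_u₁ hp hs h.pos₂.le).unique ?_
  refine (hasFDerivAt_const (0 : EuclideanSpace ℝ (Fin n₁)) p.fst).congr_of_eventuallyEq ?_
  have hc : Continuous fun x : EuclideanSpace ℝ (Fin n₁) => mkState x p.snd :=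
    continuous_mkState.comp (f := fun x => (x, p.snd)) (by fun_prop)
  filter_upwards [hc.continuousAt (x := p.fst) (h.isOpen.mem_nhds hp)] with x hx
  exact h.mean _ hx s hs

/-- Clamping negative phases to zero makes the fields continuous on the plane; periodicity is kept
only on the quadrant, which is all that a frozen field requires. -/
theorem isFrozenField (h : d.IsOscillating T₁ T₂ S f') {p : State n₁ n₂} (hp : p ∈ S) :
    IsFrozenField T₁ T₂ (quadrantExtend (d.φ₁ p)) (quadrantExtend (d.φ₂ p))
      (quadrantExtend (derivτ f' p)) (quadrantExtend (derivX f' p)) := by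
  have q₁ : ∀ {F : Type} [NormedAddCommGroup F] {g : State n₁ n₂ → ℝ → ℝ → F},
      IsPeriodicField S T₁ T₂ g → ∀ s, 0 ≤ s → ∀ t, 0 ≤ t →
        quadrantExtend (g p) (s + T₁) t = quadrantExtend (g p) s t := by
    intro F _ g hg s hs t ht
    rw [quadrantExtend_of_nonneg _ (add_nonneg hs h.pos₁.le) ht, quadrantExtend_of_nonneg _ hs ht,
      hg.per₁ p hp s hs t ht]
  have q₂ : ∀ {F : Type} [NormedAddCommGroup F] {g : State n₁ n₂ → ℝ → ℝ → F},
      IsPeriodicField S T₁ T₂ g → ∀ s, 0 ≤ s → ∀ t, 0 ≤ t →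
        quadrantExtend (g p) s (t + T₂) = quadrantExtend (g p) s t := by
    intro F _ g hg s hs t ht
    rw [quadrantExtend_of_nonneg _ hs (add_nonneg ht h.pos₂.le), quadrantExtend_of_nonneg _ hs ht,
      hg.per₂ p hp s hs t ht]
  have qi : ∀ {F : Type} [NormedAddCommGroup F] [NormedSpace ℝ F] (g : ℝ → ℝ → F) (s : ℝ),
      0 ≤ s → ∫ t in (0 : ℝ)..T₂, quadrantExtend g s t = ∫ t in (0 : ℝ)..T₂, g s t := by
    intro F _ _ g s hs
    refine intervalIntegral.integral_congr fun t ht => ?_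
    rw [uIcc_of_le h.pos₂.le] at ht
    exact quadrantExtend_of_nonneg g hs ht.1
  refine ⟨h.pos₁, h.pos₂, continuous_quadrantExtend h.periodic_φ₁ hp,
    continuous_quadrantExtend h.periodic_φ₂ hp, continuous_quadrantExtend h.periodic_derivτ hp,
    continuous_quadrantExtend h.periodic_derivX hp, q₁ h.periodic_φ₁, q₂ h.periodic_φ₁,
    q₁ h.periodic_φ₂, q₂ h.periodic_φ₂, q₁ h.periodic_derivτ, q₂ h.periodic_derivτ,
    q₁ h.periodic_derivX, q₂ h.periodic_derivX, fun s hs => (qi _ s hs).trans (h.mean p hp s hs),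
    fun s hs => (qi _ s hs).trans (h.integral_derivX hp hs), fun s hs t ht => ?_⟩
  rw [quadrantExtend_of_nonneg _ hs.le ht]
  refine (h.hasDeriv.hasDerivAt hp hs ht).congr_of_eventuallyEq ?_
  filter_upwards [Ici_mem_nhds hs] with r hr
  exact quadrantExtend_of_nonneg _ hr ht

/-- The drift of the slow variables over a fast period starting at phases `(s, c)`. -/
noncomputable def frozenDrift (d : Data n₁ n₂) (T₂ : ℝ) (f' : State n₁ n₂ → ℝ → ℝ →
    (EuclideanSpace ℝ (Fin n₁) × ℝ →L[ℝ] EuclideanSpace ℝ (Fin n₁))) (p : State n₁ n₂) (s c : ℝ) :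
    EuclideanSpace ℝ (Fin n₁) :=
  meanDrift T₂ (quadrantExtend (d.φ₁ p)) (quadrantExtend (d.φ₂ p))
      (quadrantExtend (derivτ f' p)) (quadrantExtend (derivX f' p)) s c

theorem bracket_eq (h : d.IsOscillating T₁ T₂ S f') {p : State n₁ n₂} (hp : p ∈ S) {s t : ℝ}
    (hs : 0 ≤ s) (ht : 0 ≤ t) :
    d.bracket p s t = derivX f' p s t (∫ r in (0 : ℝ)..t, d.φ₁ p s r) -
      (∫ r in (0 : ℝ)..t, derivX f' p s r) (d.φ₁ p s t) := by
  unfold bracket partialX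
  rw [(h.hasFDerivAt_u₁ hp hs ht).fderiv, (h.hasDeriv.hasFDerivAt hp hs ht).fderiv]
  rfl

/-- The link with `f̄`: averaging over the slow phase removes the dependence on both initial phases.
-/
theorem integral_frozenDrift (h : d.IsOscillating T₁ T₂ S f') {p : State n₁ n₂} (hp : p ∈ S)
    {a c : ℝ} (ha : 0 ≤ a) (hc : 0 ≤ c) :
    ∫ s in a..a + T₁, frozenDrift d T₂ f' p s c = T₁ • d.fbar T₁ T₂ p := by
  unfold frozenDrift fbar
  rw [(h.isFrozenField hp).integral_meanDrift ha hc, smul_smul, mul_inv, ← mul_assoc,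
    mul_inv_cancel₀ h.pos₁.ne', one_mul]
  congr 1
  refine intervalIntegral.integral_congr fun s hs => ?_
  rw [uIcc_of_le h.pos₁.le] at hs
  refine intervalIntegral.integral_congr fun t ht => ?_
  rw [uIcc_of_le h.pos₂.le] at ht
  have e : ∀ {F : Type} [NormedAddCommGroup F] [NormedSpace ℝ F] (g : ℝ → ℝ → F),
      ∫ r in (0 : ℝ)..t, quadrantExtend g s r = ∫ r in (0 : ℝ)..t, g s r := by
    intro F _ _ g
    refine intervalIntegral.integral_congr fun r hr => ?_
    rw [uIcc_of_le ht.1] at hr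
    exact quadrantExtend_of_nonneg g hs.1 hr.1
  simp only [quadrantExtend_of_nonneg _ hs.1 ht.1, e, h.bracket_eq hp hs.1 ht.1]

end IsOscillating

end Data

theorem integral_comp_mul_sub_start {E : Type*} [NormedAddCommGroup E] [NormedSpace ℝ E]
    (F : ℝ → E) {κ : ℝ} (hκ : κ ≠ 0) (s r : ℝ) :
    ∫ q in s..r, F (κ * (q - s)) = κ⁻¹ • ∫ q in (0 : ℝ)..κ * (r - s), F q := by
  rw [intervalIntegral.integral_comp_sub_right (fun q => F (κ * q)) s, sub_self,
    intervalIntegral.integral_comp_mul_left F hκ, mul_zero]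

namespace Data

variable {n₁ n₂ : ℕ}

/-! ### Flows of the oscillating system -/

/-- A flow of the oscillating system on `[a, b]` in integrated form: the differential inclusion for
`z` is expressed by bounds on linear functionals. -/
structure IsFlow (d : Data n₁ n₂) (ε : ℝ) (θ : ℝ → State n₁ n₂) (τ₁ τ₂ : ℝ → ℝ) (a b : ℝ) :
    Prop where
  cont : ContinuousOn θ (Icc a b)
  mem : ∀ t ∈ Icc a b, θ t ∈ d.C
  nonneg₁ : ∀ t ∈ Icc a b, 0 ≤ τ₁ t
  nonneg₂ : ∀ t ∈ Icc a b, 0 ≤ τ₂ t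
  τ₁_eq : ∀ s ∈ Icc a b, ∀ t ∈ Icc a b, s ≤ t → τ₁ t = τ₁ s + ε⁻¹ * (t - s)
  τ₂_eq : ∀ s ∈ Icc a b, ∀ t ∈ Icc a b, s ≤ t → τ₂ t = τ₂ s + (ε ^ 2)⁻¹ * (t - s)
  fst_eq : ∀ s ∈ Icc a b, ∀ t ∈ Icc a b, s ≤ t → (θ t).fst - (θ s).fst =
    ∫ r in s..t, (ε⁻¹ • d.φ₁ (θ r) (τ₁ r) (τ₂ r) + d.φ₂ (θ r) (τ₁ r) (τ₂ r))
  snd_le : ∀ s ∈ Icc a b, ∀ t ∈ Icc a b, s ≤ t →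
    ∀ (l : EuclideanSpace ℝ (Fin n₂) →L[ℝ] ℝ) (c : ℝ),
      (∀ r ∈ Icc s t, ∀ v ∈ d.Φ (θ r).snd, l v ≤ c) → l ((θ t).snd - (θ s).snd) ≤ c * (t - s)

variable {d : Data n₁ n₂} {T₁ T₂ : ℝ} {S : Set (State n₁ n₂)}
  {f' : State n₁ n₂ → ℝ → ℝ → (EuclideanSpace ℝ (Fin n₁) × ℝ →L[ℝ] EuclideanSpace ℝ (Fin n₁))}
  {ε : ℝ} {θ : ℝ → State n₁ n₂} {τ₁ τ₂ : ℝ → ℝ} {a b : ℝ}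

namespace IsFlow

theorem mono (hf : d.IsFlow ε θ τ₁ τ₂ a b) {s t : ℝ} (hs : a ≤ s) (ht : t ≤ b) :
    d.IsFlow ε θ τ₁ τ₂ s t := by
  have h : Icc s t ⊆ Icc a b := Icc_subset_Icc hs ht
  exact ⟨hf.cont.mono h, fun r hr => hf.mem r (h hr), fun r hr => hf.nonneg₁ r (h hr),
    fun r hr => hf.nonneg₂ r (h hr), fun r hr q hq => hf.τ₁_eq r (h hr) q (h hq),
    fun r hr q hq => hf.τ₂_eq r (h hr) q (h hq), fun r hr q hq => hf.fst_eq r (h hr) q (h hq),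
    fun r hr q hq => hf.snd_le r (h hr) q (h hq)⟩

theorem norm_snd_sub_le (hf : d.IsFlow ε θ τ₁ τ₂ a b) {s t : ℝ} (hs : s ∈ Icc a b)
    (ht : t ∈ Icc a b) (hst : s ≤ t) {B : ℝ} (hB0 : 0 ≤ B)
    (hB : ∀ r ∈ Icc s t, ∀ v ∈ d.Φ (θ r).snd, ‖v‖ ≤ B) :
    ‖(θ t).snd - (θ s).snd‖ ≤ B * (t - s) := by
  set w := (θ t).snd - (θ s).snd
  -- Testing the inclusion with the functional `⟪w, ·⟫` of the increment itself gives `‖w‖ ^ 2 ≤ ‖w‖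
  -- B (t - s)`.
  have h := hf.snd_le s hs t ht hst (innerSL ℝ w) (‖w‖ * B) fun r hr v hv => by
    rw [innerSL_apply_apply]
    exact (real_inner_le_norm _ _).trans (by gcongr; exact hB r hr v hv)
  rw [innerSL_apply_apply, real_inner_self_eq_norm_sq] at h
  rcases (norm_nonneg w).eq_or_lt with h0 | h0
  · rw [← h0]; exact mul_nonneg hB0 (by linarith)
  · nlinarith

theorem continuousOn_τ₁ (hf : d.IsFlow ε θ τ₁ τ₂ a b) : ContinuousOn τ₁ (Icc a b) := by
  have : ContinuousOn (fun t => τ₁ a + ε⁻¹ * (t - a)) (Icc a b) := by fun_prop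
  exact this.congr fun t ht => hf.τ₁_eq a ⟨le_rfl, ht.1.trans ht.2⟩ t ht ht.1

theorem continuousOn_τ₂ (hf : d.IsFlow ε θ τ₁ τ₂ a b) : ContinuousOn τ₂ (Icc a b) := by
  have : ContinuousOn (fun t => τ₂ a + (ε ^ 2)⁻¹ * (t - a)) (Icc a b) := by fun_prop
  exact this.congr fun t ht => hf.τ₂_eq a ⟨le_rfl, ht.1.trans ht.2⟩ t ht ht.1

theorem continuousOn_comp (hf : d.IsFlow ε θ τ₁ τ₂ a b) (hS : d.C ⊆ S) {F : Type*}
    [NormedAddCommGroup F] {g : State n₁ n₂ → ℝ → ℝ → F} (hg : IsPeriodicField S T₁ T₂ g) :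
    ContinuousOn (fun r => g (θ r) (τ₁ r) (τ₂ r)) (Icc a b) :=
  hg.cont.comp (hf.cont.prodMk (hf.continuousOn_τ₁.prodMk hf.continuousOn_τ₂))
    fun r hr => ⟨hS (hf.mem r hr), hf.nonneg₁ r hr, hf.nonneg₂ r hr⟩

theorem continuousOn_rhs (hf : d.IsFlow ε θ τ₁ τ₂ a b) (h : d.IsOscillating T₁ T₂ S f') :
    ContinuousOn (fun r => ε⁻¹ • d.φ₁ (θ r) (τ₁ r) (τ₂ r) + d.φ₂ (θ r) (τ₁ r) (τ₂ r))
      (Icc a b) :=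
  ((hf.continuousOn_comp h.subset h.periodic_φ₁).const_smul ε⁻¹).add
    (hf.continuousOn_comp h.subset h.periodic_φ₂)

theorem norm_fst_sub_le (hf : d.IsFlow ε θ τ₁ τ₂ a b) (hε : 0 < ε) {s t : ℝ} (hs : s ∈ Icc a b)
    (ht : t ∈ Icc a b) (hst : s ≤ t) {B : ℝ}
    (hB : ∀ r ∈ Icc s t, ‖d.φ₁ (θ r) (τ₁ r) (τ₂ r)‖ ≤ B ∧ ‖d.φ₂ (θ r) (τ₁ r) (τ₂ r)‖ ≤ B) :
    ‖(θ t).fst - (θ s).fst‖ ≤ (ε⁻¹ * B + B) * (t - s) := by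
  rw [hf.fst_eq s hs t ht hst, ← abs_of_nonneg (sub_nonneg.2 hst)]
  refine intervalIntegral.norm_integral_le_of_norm_le_const fun r hr => ?_
  rw [uIoc_of_le hst] at hr
  have := hB r ⟨hr.1.le, hr.2⟩
  refine (norm_add_le _ _).trans (add_le_add ?_ this.2)
  rw [norm_smul, norm_inv, Real.norm_of_nonneg hε.le]
  gcongr
  exact this.1

end IsFlow

/-- The constants that control the oscillating fields on a ball around `p`. -/
structure LocalBound (d : Data n₁ n₂) (f' : State n₁ n₂ → ℝ → ℝ →
    (EuclideanSpace ℝ (Fin n₁) × ℝ →L[ℝ] EuclideanSpace ℝ (Fin n₁)))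
    (p : State n₁ n₂) (r B : ℝ) : Prop where
  pos : 0 < r
  nonneg : 0 ≤ B
  φ₁_le : ∀ θ ∈ Metric.ball p r, ∀ s, 0 ≤ s → ∀ t, 0 ≤ t → ‖d.φ₁ θ s t‖ ≤ B
  φ₂_le : ∀ θ ∈ Metric.ball p r, ∀ s, 0 ≤ s → ∀ t, 0 ≤ t → ‖d.φ₂ θ s t‖ ≤ B
  deriv_le : ∀ θ ∈ Metric.ball p r, ∀ s, 0 ≤ s → ∀ t, 0 ≤ t → ‖f' θ s t‖ ≤ B
  lip : ∀ θ ∈ Metric.ball p r, ∀ θ' ∈ Metric.ball p r, ∀ s, 0 ≤ s → ∀ t, 0 ≤ t →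
      ‖d.φ₁ θ s t - d.φ₁ θ' s t‖ ≤ B * ‖θ - θ'‖
  Φ_le : ∀ θ ∈ Metric.ball p r ∩ d.C, ∀ v ∈ d.Φ θ.snd, ‖v‖ ≤ B

theorem LocalBound.mono {p : State n₁ n₂} {B r r' : ℝ} (h : d.LocalBound f' p r B)
    (hr' : 0 < r') (hle : r' ≤ r) : d.LocalBound f' p r' B := by
  have m : ∀ {θ}, θ ∈ Metric.ball p r' → θ ∈ Metric.ball p r :=
    fun hθ => Metric.ball_subset_ball hle hθ
  exact ⟨hr', h.nonneg, fun θ hθ => h.φ₁_le θ (m hθ), fun θ hθ => h.φ₂_le θ (m hθ),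
    fun θ hθ => h.deriv_le θ (m hθ), fun θ hθ θ' hθ' => h.lip θ (m hθ) θ' (m hθ'),
    fun θ hθ => h.Φ_le θ ⟨m hθ.1, hθ.2⟩⟩

theorem IsOscillating.exists_localBound (h : d.IsOscillating T₁ T₂ S f') (hb : d.BasicRegularity)
    {p : State n₁ n₂} (hp : p ∈ d.C) : ∃ r B, d.LocalBound f' p r B := by
  have hpS := h.subset hp
  obtain ⟨r₁, hr₁, B₁, -, h₁⟩ := h.periodic_φ₁.exists_bound h.isOpen h.pos₁ h.pos₂ hpS
  obtain ⟨r₂, hr₂, B₂, -, h₂⟩ := h.periodic_φ₂.exists_bound h.isOpen h.pos₁ h.pos₂ hpS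
  obtain ⟨r₃, hr₃, B₃, -, h₃⟩ := h.periodic_deriv.exists_bound h.isOpen h.pos₁ h.pos₂ hpS
  obtain ⟨r₄, hr₄, B₄, -, h₄⟩ := h.lip₁.exists_lipschitz h.isOpen h.pos₁ h.pos₂ h.per₁₁ h.per₁₂ hpS
  obtain ⟨N, hN, B₅, h₅⟩ := hb.locBdd_Φ p hp
  obtain ⟨r₅, hr₅, hN⟩ := Metric.mem_nhds_iff.1 hN
  obtain ⟨r, hr, hr1, hr2, hr3, hr4, hr5⟩ : ∃ r > 0, r ≤ r₁ ∧ r ≤ r₂ ∧ r ≤ r₃ ∧ r ≤ r₄ ∧ r ≤ r₅ :=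
    ⟨min r₁ (min r₂ (min r₃ (min r₄ r₅))), by positivity, by simp, by simp, by simp, by simp,
      by simp⟩
  obtain ⟨B, hB, hB1, hB2, hB3, hB4, hB5⟩ :
      ∃ B, 0 ≤ B ∧ B₁ ≤ B ∧ B₂ ≤ B ∧ B₃ ≤ B ∧ B₄ ≤ B ∧ B₅ ≤ B :=
    ⟨max 0 (max B₁ (max B₂ (max B₃ (max B₄ B₅)))), by simp, by simp, by simp, by simp, by simp,
      by simp⟩
  have m : ∀ {r'}, r ≤ r' → ∀ {θ}, θ ∈ Metric.ball p r → θ ∈ Metric.ball p r' :=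
    fun hr' _ hθ => Metric.ball_subset_ball hr' hθ
  exact ⟨r, B, hr, hB, fun θ hθ s hs t ht => (h₁ θ (m hr1 hθ) s hs t ht).trans hB1,
    fun θ hθ s hs t ht => (h₂ θ (m hr2 hθ) s hs t ht).trans hB2,
    fun θ hθ s hs t ht => (h₃ θ (m hr3 hθ) s hs t ht).trans hB3,
    fun θ hθ θ' hθ' s hs t ht => (h₄ θ (m hr4 hθ) θ' (m hr4 hθ') s hs t ht).trans (by gcongr),
    fun θ hθ v hv => (h₅ θ ⟨hN (m hr5 hθ.1), hθ.2⟩ v hv).trans hB5⟩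

/-- The oscillating fields on the ball of radius `r` around `p` are within `η` of those at `p`. -/
structure LocalClose (d : Data n₁ n₂) (S : Set (State n₁ n₂)) (f' : State n₁ n₂ → ℝ → ℝ →
    (EuclideanSpace ℝ (Fin n₁) × ℝ →L[ℝ] EuclideanSpace ℝ (Fin n₁)))
    (p : State n₁ n₂) (η r : ℝ) : Prop where
  pos : 0 < r
  subset : Metric.ball p r ⊆ S
  φ₁_le : ∀ θ ∈ Metric.ball p r, ∀ s, 0 ≤ s → ∀ s' ∈ Icc s (s + r), ∀ t, 0 ≤ t →
    ‖d.φ₁ θ s' t - d.φ₁ p s t‖ ≤ η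
  φ₂_le : ∀ θ ∈ Metric.ball p r, ∀ s, 0 ≤ s → ∀ s' ∈ Icc s (s + r), ∀ t, 0 ≤ t →
    ‖d.φ₂ θ s' t - d.φ₂ p s t‖ ≤ η
  deriv_le : ∀ θ ∈ Metric.ball p r, ∀ s, 0 ≤ s → ∀ s' ∈ Icc s (s + r), ∀ t, 0 ≤ t →
    ‖f' θ s' t - f' p s t‖ ≤ η

theorem IsOscillating.exists_localClose (h : d.IsOscillating T₁ T₂ S f') {p : State n₁ n₂}
    (hp : p ∈ S) {η : ℝ} (hη : 0 < η) : ∃ r, d.LocalClose S f' p η r := by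
  obtain ⟨r₁, hr₁, hS, h₁⟩ := h.periodic_φ₁.exists_close h.isOpen h.pos₁ h.pos₂ hp hη
  obtain ⟨r₂, hr₂, -, h₂⟩ := h.periodic_φ₂.exists_close h.isOpen h.pos₁ h.pos₂ hp hη
  obtain ⟨r₃, hr₃, -, h₃⟩ := h.periodic_deriv.exists_close h.isOpen h.pos₁ h.pos₂ hp hη
  obtain ⟨r, hr, hr1, hr2, hr3⟩ : ∃ r > 0, r ≤ r₁ ∧ r ≤ r₂ ∧ r ≤ r₃ :=
    ⟨min r₁ (min r₂ r₃), by positivity, by simp, by simp, by simp⟩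
  have m : ∀ {r'}, r ≤ r' → ∀ {θ}, θ ∈ Metric.ball p r → θ ∈ Metric.ball p r' :=
    fun hr' _ hθ => Metric.ball_subset_ball hr' hθ
  have m' : ∀ {r'}, r ≤ r' → ∀ {s s' : ℝ}, s' ∈ Icc s (s + r) → s' ∈ Icc s (s + r') :=
    fun hr' _ _ hs => ⟨hs.1, hs.2.trans (by linarith)⟩
  exact ⟨r, hr, fun θ hθ => hS (m hr1 hθ),
    fun θ hθ s hs s' hs' t ht => h₁ θ (m hr1 hθ) s hs s' (m' hr1 hs') t ht,
    fun θ hθ s hs s' hs' t ht => h₂ θ (m hr2 hθ) s hs s' (m' hr2 hs') t ht,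
    fun θ hθ s hs s' hs' t ht => h₃ θ (m hr3 hθ) s hs s' (m' hr3 hs') t ht⟩

theorem LocalClose.mono {p : State n₁ n₂} {η r r' : ℝ} (h : d.LocalClose S f' p η r)
    (hr' : 0 < r') (hle : r' ≤ r) : d.LocalClose S f' p η r' := by
  have m : ∀ {θ}, θ ∈ Metric.ball p r' → θ ∈ Metric.ball p r :=
    fun hθ => Metric.ball_subset_ball hle hθ
  have m' : ∀ {s s' : ℝ}, s' ∈ Icc s (s + r') → s' ∈ Icc s (s + r) :=
    fun hs => ⟨hs.1, hs.2.trans (by linarith)⟩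
  exact ⟨hr', fun θ hθ => h.subset (m hθ),
    fun θ hθ s hs s' hs' => h.φ₁_le θ (m hθ) s hs s' (m' hs'),
    fun θ hθ s hs s' hs' => h.φ₂_le θ (m hθ) s hs s' (m' hs'),
    fun θ hθ s hs s' hs' => h.deriv_le θ (m hθ) s hs s' (m' hs')⟩

end Data

namespace Data

open IsOscillating

variable {n₁ n₂ : ℕ} {d : Data n₁ n₂} {T₁ T₂ : ℝ} {S : Set (State n₁ n₂)}
  {f' : State n₁ n₂ → ℝ → ℝ → (EuclideanSpace ℝ (Fin n₁) × ℝ →L[ℝ] EuclideanSpace ℝ (Fin n₁))}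
  {ε : ℝ} {θ : ℝ → State n₁ n₂} {τ₁ τ₂ : ℝ → ℝ}

/-! ### The increment of a flow over a fast period -/

/-- A short piece of a flow near `p`, lasting at most one fast period. -/
structure IsShortFlow (d : Data n₁ n₂) (T₂ : ℝ) (S : Set (State n₁ n₂))
    (f' : State n₁ n₂ → ℝ → ℝ →
      (EuclideanSpace ℝ (Fin n₁) × ℝ →L[ℝ] EuclideanSpace ℝ (Fin n₁)))
    (ε : ℝ) (θ : ℝ → State n₁ n₂) (τ₁ τ₂ : ℝ → ℝ) (p : State n₁ n₂) (r B η s e : ℝ) : Prop where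
  flow : d.IsFlow ε θ τ₁ τ₂ s e
  mem : ∀ q ∈ Icc s e, θ q ∈ Metric.ball p (r / 2)
  bound : d.LocalBound f' p r B
  close : d.LocalClose S f' p η r
  pos : 0 < ε
  le_one : ε ≤ 1
  mul_le : ε * T₂ ≤ r
  le : s ≤ e
  sub_le : e - s ≤ ε ^ 2 * T₂

namespace IsShortFlow

variable {p : State n₁ n₂} {r B η s e : ℝ}

theorem mono (h : d.IsShortFlow T₂ S f' ε θ τ₁ τ₂ p r B η s e) {q : ℝ} (hq : q ∈ Icc s e) :
    d.IsShortFlow T₂ S f' ε θ τ₁ τ₂ p r B η s q :=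
  ⟨h.flow.mono le_rfl hq.2, fun q' hq' => h.mem q' ⟨hq'.1, hq'.2.trans hq.2⟩, h.bound, h.close,
    h.pos, h.le_one, h.mul_le, hq.1, by linarith [h.sub_le, hq.2]⟩

theorem mem_ball (h : d.IsShortFlow T₂ S f' ε θ τ₁ τ₂ p r B η s e) {q : ℝ} (hq : q ∈ Icc s e) :
    θ q ∈ Metric.ball p r :=
  Metric.ball_subset_ball (by linarith [h.bound.pos]) (h.mem q hq)

theorem left_mem (h : d.IsShortFlow T₂ S f' ε θ τ₁ τ₂ p r B η s e) : s ∈ Icc s e := ⟨le_rfl, h.le⟩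

theorem right_mem (h : d.IsShortFlow T₂ S f' ε θ τ₁ τ₂ p r B η s e) : e ∈ Icc s e := ⟨h.le, le_rfl⟩

theorem phase_nonneg (h : d.IsShortFlow T₂ S f' ε θ τ₁ τ₂ p r B η s e) :
    0 ≤ (ε ^ 2)⁻¹ * (e - s) :=
  mul_nonneg (by have := h.pos; positivity) (sub_nonneg.2 h.le)

theorem phase_le (h : d.IsShortFlow T₂ S f' ε θ τ₁ τ₂ p r B η s e) :
    (ε ^ 2)⁻¹ * (e - s) ≤ T₂ := by
  rw [inv_mul_le_iff₀ (by have := h.pos; positivity)]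
  exact h.sub_le

theorem inv_mul_eq (h : d.IsShortFlow T₂ S f' ε θ τ₁ τ₂ p r B η s e) :
    ε⁻¹ * (e - s) = ε * ((ε ^ 2)⁻¹ * (e - s)) := by
  have := h.pos.ne'
  field_simp

theorem τ₁_mem (h : d.IsShortFlow T₂ S f' ε θ τ₁ τ₂ p r B η s e) {q : ℝ} (hq : q ∈ Icc s e) :
    τ₁ q ∈ Icc (τ₁ s) (τ₁ s + r) := by
  have h' := h.mono hq
  rw [h.flow.τ₁_eq s h.left_mem q hq hq.1, h'.inv_mul_eq]
  have h1 := h'.phase_nonneg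
  have h2 := h'.phase_le
  have h3 := h.pos
  constructor
  · nlinarith
  · nlinarith [h.mul_le]

/-- To leading order the displacement of `x` is `ε` times the integral of the frozen `φ₁` over the
elapsed fast phase. The error comes from freezing `(θ, τ₁)`, of size `η`, and from neglecting `φ₂`,
of size `ε B`. -/
theorem norm_displacement_le (h : d.IsShortFlow T₂ S f' ε θ τ₁ τ₂ p r B η s e)
    (ho : d.IsOscillating T₁ T₂ S f') (hp : p ∈ S) (hη : 0 ≤ η) :
    ‖ε⁻¹ • ((θ e).fst - (θ s).fst) -
      ∫ q in (0 : ℝ)..(ε ^ 2)⁻¹ * (e - s), quadrantExtend (d.φ₁ p) (τ₁ s) (τ₂ s + q)‖ ≤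
      T₂ * (η + ε * B) := by
  have hε := h.pos
  have hB := h.bound.nonneg
  have hκ : (ε ^ 2)⁻¹ ≠ 0 := by positivity
  set G : ℝ → EuclideanSpace ℝ (Fin n₁) := fun q => quadrantExtend (d.φ₁ p) (τ₁ s) (τ₂ s + q)
  have hG : Continuous G :=
    (ho.isFrozenField hp).cont_f.comp (f := fun q => (τ₁ s, τ₂ s + q)) (by fun_prop)
  have h1 : ∫ q in (0 : ℝ)..(ε ^ 2)⁻¹ * (e - s), G q =
      ∫ q in s..e, (ε ^ 2)⁻¹ • G ((ε ^ 2)⁻¹ * (q - s)) := by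
    rw [intervalIntegral.integral_smul, integral_comp_mul_sub_start G hκ, smul_smul,
      mul_inv_cancel₀ hκ, one_smul]
  rw [h1, h.flow.fst_eq s h.left_mem e h.right_mem h.le, ← intervalIntegral.integral_smul,
    ← intervalIntegral.integral_sub]
  rotate_left
  · refine ContinuousOn.intervalIntegrable ?_
    rw [uIcc_of_le h.le]
    exact (h.flow.continuousOn_rhs ho).const_smul ε⁻¹
  · have : Continuous fun q => (ε ^ 2)⁻¹ • G ((ε ^ 2)⁻¹ * (q - s)) := by fun_prop
    exact this.intervalIntegrable _ _
  have h2 : ∀ q ∈ uIoc s e, ‖ε⁻¹ • (ε⁻¹ • d.φ₁ (θ q) (τ₁ q) (τ₂ q) + d.φ₂ (θ q) (τ₁ q) (τ₂ q)) -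
      (ε ^ 2)⁻¹ • G ((ε ^ 2)⁻¹ * (q - s))‖ ≤ (ε ^ 2)⁻¹ * η + ε⁻¹ * B := by
    intro q hq
    rw [uIoc_of_le h.le] at hq
    have hq' : q ∈ Icc s e := ⟨hq.1.le, hq.2⟩
    have hG' : G ((ε ^ 2)⁻¹ * (q - s)) = d.φ₁ p (τ₁ s) (τ₂ q) := by
      rw [h.flow.τ₂_eq s h.left_mem q hq' hq'.1]
      refine quadrantExtend_of_nonneg _ (h.flow.nonneg₁ s h.left_mem) ?_
      rw [← h.flow.τ₂_eq s h.left_mem q hq' hq'.1]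
      exact h.flow.nonneg₂ q hq'
    have e1 : ε⁻¹ • (ε⁻¹ • d.φ₁ (θ q) (τ₁ q) (τ₂ q) + d.φ₂ (θ q) (τ₁ q) (τ₂ q)) -
        (ε ^ 2)⁻¹ • G ((ε ^ 2)⁻¹ * (q - s)) =
        (ε ^ 2)⁻¹ • (d.φ₁ (θ q) (τ₁ q) (τ₂ q) - d.φ₁ p (τ₁ s) (τ₂ q)) +
          ε⁻¹ • d.φ₂ (θ q) (τ₁ q) (τ₂ q) := by
      rw [hG', smul_add, smul_smul, smul_sub, ← mul_inv, ← pow_two]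
      abel
    rw [e1]
    refine (norm_add_le _ _).trans ?_
    rw [norm_smul, norm_smul, norm_inv, norm_inv, norm_pow, Real.norm_of_nonneg hε.le]
    gcongr
    · exact h.close.φ₁_le _ (h.mem_ball hq') _ (h.flow.nonneg₁ s h.left_mem) _ (h.τ₁_mem hq') _
        (h.flow.nonneg₂ q hq')
    · exact h.bound.φ₂_le _ (h.mem_ball hq') _ (h.flow.nonneg₁ q hq') _ (h.flow.nonneg₂ q hq')
  refine (intervalIntegral.norm_integral_le_of_norm_le_const h2).trans ?_
  rw [abs_of_nonneg (sub_nonneg.2 h.le)]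
  calc ((ε ^ 2)⁻¹ * η + ε⁻¹ * B) * (e - s)
      = (ε ^ 2)⁻¹ * (e - s) * η + ε⁻¹ * (e - s) * B := by ring
    _ = (ε ^ 2)⁻¹ * (e - s) * (η + ε * B) := by rw [h.inv_mul_eq]; ring
    _ ≤ T₂ * (η + ε * B) := by gcongr; exact h.phase_le

/-- The change of state is split in two. Moving `z` costs a Lipschitz constant times `O(ε ^ 2)`.
Moving `(x, τ₁)`, a distance `O(ε)`, is linearized with the derivative frozen at `p`, with relative
error `η`. Both remain small after multiplication by `ε⁻¹`. -/
theorem norm_φ₁_sub_le (h : d.IsShortFlow T₂ S f' ε θ τ₁ τ₂ p r B η s e)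
    (ho : d.IsOscillating T₁ T₂ S f') (hη : 0 ≤ η) :
    ‖d.φ₁ (θ e) (τ₁ e) (τ₂ e) - d.φ₁ (θ s) (τ₁ s) (τ₂ e) -
      f' p (τ₁ s) (τ₂ e) ((θ e).fst - (θ s).fst, τ₁ e - τ₁ s)‖ ≤
      B * (B * (ε ^ 2 * T₂)) + η * (ε * T₂ * (2 * B + 1)) := by
  have hε := h.pos
  have hB := h.bound.nonneg
  have hs := h.left_mem
  have he := h.right_mem
  have hball : ∀ q ∈ Icc s e, ‖(θ q).fst - p.fst‖ < r / 2 ∧ ‖(θ q).snd - p.snd‖ < r / 2 := by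
    intro q hq
    have := h.mem q hq
    rw [Metric.mem_ball, dist_eq_norm] at this
    exact ⟨(HybridAveraging.norm_fst_sub_le _ _).trans_lt this,
      (HybridAveraging.norm_snd_sub_le _ _).trans_lt this⟩
  -- Mixed points take `x` and `z` from different times. This is why the flow is required to stay in
  -- the ball of half the radius.
  have hmix : ∀ x : EuclideanSpace ℝ (Fin n₁), x ∈ Metric.ball p.fst (r / 2) →
      mkState x (θ s).snd ∈ Metric.ball p r := by
    intro x hx
    rw [Metric.mem_ball, dist_eq_norm] at hx ⊢
    refine (norm_mkState_sub_le x (θ s).snd p).trans_lt ?_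
    linarith [(hball s hs).2]
  have hxe : (θ e).fst ∈ Metric.ball p.fst (r / 2) := by
    rw [Metric.mem_ball, dist_eq_norm]; exact (hball e he).1
  have hxs : (θ s).fst ∈ Metric.ball p.fst (r / 2) := by
    rw [Metric.mem_ball, dist_eq_norm]; exact (hball s hs).1
  have hT₂ : 0 ≤ ε * T₂ := mul_nonneg hε.le ho.pos₂.le
  have A₁ : ‖d.φ₁ (θ e) (τ₁ e) (τ₂ e) - d.φ₁ (mkState (θ e).fst (θ s).snd) (τ₁ e) (τ₂ e)‖ ≤
      B * (B * (ε ^ 2 * T₂)) := by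
    refine (h.bound.lip _ (h.mem_ball he) _ (hmix _ hxe) _ (h.flow.nonneg₁ e he) _
      (h.flow.nonneg₂ e he)).trans ?_
    gcongr
    rw [norm_sub_rev]
    refine (norm_mkState_sub_le _ _ _).trans ?_
    rw [sub_self, norm_zero, zero_add, norm_sub_rev]
    refine (h.flow.norm_snd_sub_le hs he h.le hB fun q hq v hv =>
      h.bound.Φ_le _ ⟨h.mem_ball hq, h.flow.mem q hq⟩ v hv).trans ?_
    gcongr
    exact h.sub_le
  have A₂ : ‖d.φ₁ (mkState (θ e).fst (θ s).snd) (τ₁ e) (τ₂ e) - d.φ₁ (θ s) (τ₁ s) (τ₂ e) -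
      f' p (τ₁ s) (τ₂ e) ((θ e).fst - (θ s).fst, τ₁ e - τ₁ s)‖ ≤
      η * (ε * T₂ * (2 * B + 1)) := by
    have key := ho.hasDeriv.norm_sub_le
      (X := Metric.ball p.fst (r / 2) ×ˢ Icc (τ₁ s) (τ₁ s + r)) (z := (θ s).snd) (t := τ₂ e)
      (φ := f' p (τ₁ s) (τ₂ e)) (c := η)
      ((convex_ball _ _).prod (convex_Icc _ _)) (h.flow.nonneg₂ e he)
      (fun y hy => ⟨h.close.subset (hmix _ hy.1), (h.flow.nonneg₁ s hs).trans hy.2.1⟩)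
      (fun y hy => h.close.deriv_le _ (hmix _ hy.1) _ (h.flow.nonneg₁ s hs) _ hy.2 _
        (h.flow.nonneg₂ e he))
      (y := ((θ s).fst, τ₁ s)) (y' := ((θ e).fst, τ₁ e))
      ⟨hxs, h.τ₁_mem hs⟩ ⟨hxe, h.τ₁_mem he⟩
    refine key.trans ?_
    gcongr
    rw [Prod.mk_sub_mk, Prod.norm_mk]
    have hphase := h.phase_le
    have hphase0 := h.phase_nonneg
    refine max_le ?_ ?_
    · refine (h.flow.norm_fst_sub_le hε hs he h.le (B := B) fun q hq =>
        ⟨h.bound.φ₁_le _ (h.mem_ball hq) _ (h.flow.nonneg₁ q hq) _ (h.flow.nonneg₂ q hq),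
        h.bound.φ₂_le _ (h.mem_ball hq) _ (h.flow.nonneg₁ q hq) _ (h.flow.nonneg₂ q hq)⟩).trans ?_
      have e1 : (e - s) ≤ ε⁻¹ * (e - s) :=
        le_mul_of_one_le_left (sub_nonneg.2 h.le) ((one_le_inv₀ hε).2 h.le_one)
      have e2 : ε⁻¹ * (e - s) ≤ ε * T₂ := by rw [h.inv_mul_eq]; gcongr
      calc (ε⁻¹ * B + B) * (e - s) = B * (ε⁻¹ * (e - s)) + B * (e - s) := by ring
        _ ≤ B * (ε * T₂) + B * (ε * T₂) := by gcongr; exact e1.trans e2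
        _ ≤ ε * T₂ * (2 * B + 1) := by linarith
    · rw [h.flow.τ₁_eq s hs e he h.le, add_sub_cancel_left, h.inv_mul_eq,
        Real.norm_of_nonneg (by positivity)]
      calc ε * ((ε ^ 2)⁻¹ * (e - s)) ≤ ε * T₂ := by gcongr
        _ ≤ ε * T₂ * (2 * B + 1) := le_mul_of_one_le_right hT₂ (by linarith)
  calc _ = ‖(d.φ₁ (θ e) (τ₁ e) (τ₂ e) - d.φ₁ (mkState (θ e).fst (θ s).snd) (τ₁ e) (τ₂ e)) +
        (d.φ₁ (mkState (θ e).fst (θ s).snd) (τ₁ e) (τ₂ e) - d.φ₁ (θ s) (τ₁ s) (τ₂ e) -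
        f' p (τ₁ s) (τ₂ e) ((θ e).fst - (θ s).fst, τ₁ e - τ₁ s))‖ := by congr 1; abel
    _ ≤ _ := (norm_add_le _ _).trans (add_le_add A₁ A₂)

/-- The constant of the estimates over a fast period. -/
noncomputable def periodConst (T₂ B : ℝ) : ℝ := B * B * T₂ + T₂ * (2 * B + 1) + B * T₂ * (1 + B) + 1

/-- The singular term is frozen at the actual state `θ s`, not at `p`: a difference `η` in `φ₁`
would be amplified by `ε⁻¹`, whereas the subtracted term integrates exactly to zero over a period.
The terms of order one may be frozen at `p`. -/
theorem norm_rhs_sub_le (h : d.IsShortFlow T₂ S f' ε θ τ₁ τ₂ p r B η s e)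
    (ho : d.IsOscillating T₁ T₂ S f') (hp : p ∈ S) (hη : 0 ≤ η) :
    ‖ε⁻¹ • d.φ₁ (θ e) (τ₁ e) (τ₂ e) + d.φ₂ (θ e) (τ₁ e) (τ₂ e) -
      ε⁻¹ • quadrantExtend (d.φ₁ (θ s)) (τ₁ s) (τ₂ s + (ε ^ 2)⁻¹ * (e - s)) -
      drift (quadrantExtend (d.φ₁ p)) (quadrantExtend (d.φ₂ p)) (quadrantExtend (derivτ f' p))
        (quadrantExtend (derivX f' p)) (τ₁ s) (τ₂ s) ((ε ^ 2)⁻¹ * (e - s))‖ ≤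
      periodConst T₂ B * (η + ε) := by
  have hε := h.pos
  have hB := h.bound.nonneg
  have hs := h.left_mem
  have he := h.right_mem
  have h1 := h.norm_displacement_le ho hp hη
  have h2 := h.norm_φ₁_sub_le ho hη
  have h3 := h.close.φ₂_le _ (h.mem_ball he) _ (h.flow.nonneg₁ s hs) _ (h.τ₁_mem he) _
    (h.flow.nonneg₂ e he)
  have hD := h.bound.deriv_le p (Metric.mem_ball_self h.bound.pos) _ (h.flow.nonneg₁ s hs) _
    (h.flow.nonneg₂ e he)
  have hτ := (h.flow.τ₂_eq s hs e he h.le).symm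
  have hδ : τ₁ e - τ₁ s = ε * ((ε ^ 2)⁻¹ * (e - s)) := by
    rw [h.flow.τ₁_eq s hs e he h.le, add_sub_cancel_left, h.inv_mul_eq]
  unfold drift
  simp only [hτ, quadrantExtend_of_nonneg _ (h.flow.nonneg₁ s hs) (h.flow.nonneg₂ e he)]
  rw [← apply_eq]
  set w := ∫ q in (0 : ℝ)..(ε ^ 2)⁻¹ * (e - s), quadrantExtend (d.φ₁ p) (τ₁ s) (τ₂ s + q)
  set σ := (ε ^ 2)⁻¹ * (e - s)
  set D := f' p (τ₁ s) (τ₂ e)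
  set δx := (θ e).fst - (θ s).fst
  -- Here `w` is the leading term of `ε⁻¹ δx`, and `τ₁` has advanced by exactly `ε σ`, so no error
  -- arises in the second slot.
  have hsplit : D (w, σ) = ε⁻¹ • D (δx, τ₁ e - τ₁ s) - D (ε⁻¹ • δx - w, 0) := by
    rw [← map_smul, ← map_sub, hδ, Prod.smul_mk, Prod.mk_sub_mk, sub_sub_cancel, smul_eq_mul,
      inv_mul_cancel_left₀ hε.ne', sub_zero]
  have e1 : ε⁻¹ • d.φ₁ (θ e) (τ₁ e) (τ₂ e) + d.φ₂ (θ e) (τ₁ e) (τ₂ e) -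
      ε⁻¹ • d.φ₁ (θ s) (τ₁ s) (τ₂ e) - (D (w, σ) + d.φ₂ p (τ₁ s) (τ₂ e)) =
      ε⁻¹ • (d.φ₁ (θ e) (τ₁ e) (τ₂ e) - d.φ₁ (θ s) (τ₁ s) (τ₂ e) - D (δx, τ₁ e - τ₁ s)) +
      D (ε⁻¹ • δx - w, 0) + (d.φ₂ (θ e) (τ₁ e) (τ₂ e) - d.φ₂ p (τ₁ s) (τ₂ e)) := by
    rw [hsplit]
    module
  have h4 : ‖D (ε⁻¹ • δx - w, 0)‖ ≤ B * (T₂ * (η + ε * B)) := by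
    refine (D.le_opNorm _).trans ?_
    rw [Prod.norm_mk, norm_zero, max_eq_left (norm_nonneg _)]
    gcongr
  rw [e1]
  refine (norm_add₃_le).trans ?_
  rw [norm_smul, norm_inv, Real.norm_of_nonneg hε.le]
  have hT₂ := ho.pos₂
  calc _ ≤ ε⁻¹ * (B * (B * (ε ^ 2 * T₂)) + η * (ε * T₂ * (2 * B + 1))) +
        B * (T₂ * (η + ε * B)) + η := by gcongr
    _ = B * B * T₂ * ε + η * (T₂ * (2 * B + 1)) + B * (T₂ * (η + ε * B)) + η := by
        field_simp
    _ ≤ _ := by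
        unfold periodConst
        have : 0 ≤ B * B * T₂ * η + T₂ * (2 * B + 1) * ε + B * T₂ * B * η + B * T₂ * ε + ε := by
          positivity
        nlinarith

end IsShortFlow

theorem IsOscillating.norm_period_sub_le (ho : d.IsOscillating T₁ T₂ S f') {p : State n₁ n₂}
    {r B η s : ℝ} (h : d.IsShortFlow T₂ S f' ε θ τ₁ τ₂ p r B η s (s + ε ^ 2 * T₂)) (hp : p ∈ S)
    (hη : 0 ≤ η) :
    ‖(θ (s + ε ^ 2 * T₂)).fst - (θ s).fst -
      (ε ^ 2 * T₂) • frozenDrift d T₂ f' p (τ₁ s) (τ₂ s)‖ ≤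
      IsShortFlow.periodConst T₂ B * (η + ε) * (ε ^ 2 * T₂) := by
  have hε := h.pos
  have hκ : (ε ^ 2)⁻¹ ≠ 0 := by positivity
  have hs := h.left_mem
  have hT₂ := ho.pos₂
  have hθ : θ s ∈ S := ho.subset (h.flow.mem s hs)
  set G : ℝ → EuclideanSpace ℝ (Fin n₁) := fun q =>
    quadrantExtend (d.φ₁ (θ s)) (τ₁ s) (τ₂ s + q) with hGdef
  set H : ℝ → EuclideanSpace ℝ (Fin n₁) := fun q =>
    drift (quadrantExtend (d.φ₁ p)) (quadrantExtend (d.φ₂ p)) (quadrantExtend (derivτ f' p))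
        (quadrantExtend (derivX f' p)) (τ₁ s) (τ₂ s) q with hHdef
  have hG : Continuous G :=
    (ho.isFrozenField hθ).cont_f.comp (f := fun q => (τ₁ s, τ₂ s + q)) (by fun_prop)
  have hH : Continuous H :=
    (ho.isFrozenField hp).continuous_drift.comp (f := fun q => (τ₁ s, τ₂ s, q)) (by fun_prop)
  have hend : (ε ^ 2)⁻¹ * (s + ε ^ 2 * T₂ - s) = T₂ := by field_simp; ring
  -- The zero-mean condition at the state `θ s` removes the term of order `ε⁻¹`.
  have iG : ∫ q in s..s + ε ^ 2 * T₂, ε⁻¹ • G ((ε ^ 2)⁻¹ * (q - s)) = 0 := by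
    rw [intervalIntegral.integral_smul, integral_comp_mul_sub_start G hκ, hend, hGdef,
      intervalIntegral.integral_comp_add_left (quadrantExtend (d.φ₁ (θ s)) (τ₁ s)), add_zero,
      integral_add_period_eq (f := quadrantExtend (d.φ₁ (θ s)) (τ₁ s))
        ((ho.isFrozenField hθ).cont_f.comp (f := fun q => (τ₁ s, q))
        (by fun_prop)) ((ho.isFrozenField hθ).per₂_f _ (h.flow.nonneg₁ s hs))
        (h.flow.nonneg₂ s hs), (ho.isFrozenField hθ).mean_f _ (h.flow.nonneg₁ s hs), smul_zero,
      smul_zero]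
  have iH : ∫ q in s..s + ε ^ 2 * T₂, H ((ε ^ 2)⁻¹ * (q - s)) =
      (ε ^ 2 * T₂) • frozenDrift d T₂ f' p (τ₁ s) (τ₂ s) := by
    rw [integral_comp_mul_sub_start H hκ, hend, inv_inv, frozenDrift, meanDrift, smul_smul,
      mul_assoc, mul_inv_cancel₀ hT₂.ne', mul_one]
  have cG : IntervalIntegrable (fun q => ε⁻¹ • G ((ε ^ 2)⁻¹ * (q - s))) volume s
      (s + ε ^ 2 * T₂) := by
    refine Continuous.intervalIntegrable ?_ _ _
    fun_prop
  have cH : IntervalIntegrable (fun q => H ((ε ^ 2)⁻¹ * (q - s))) volume s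
      (s + ε ^ 2 * T₂) := by
    refine Continuous.intervalIntegrable ?_ _ _
    fun_prop
  have cR : IntervalIntegrable (fun r => ε⁻¹ • d.φ₁ (θ r) (τ₁ r) (τ₂ r) +
      d.φ₂ (θ r) (τ₁ r) (τ₂ r)) volume s (s + ε ^ 2 * T₂) := by
    refine ContinuousOn.intervalIntegrable ?_
    rw [uIcc_of_le h.le]
    exact h.flow.continuousOn_rhs ho
  rw [h.flow.fst_eq s hs _ h.right_mem h.le, ← iH,
    ← sub_zero (∫ r in s..s + ε ^ 2 * T₂, (ε⁻¹ • d.φ₁ (θ r) (τ₁ r) (τ₂ r) +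
      d.φ₂ (θ r) (τ₁ r) (τ₂ r))), ← iG, ← intervalIntegral.integral_sub cR cG,
    ← intervalIntegral.integral_sub (cR.sub cG) cH]
  have hlen : ε ^ 2 * T₂ = |s + ε ^ 2 * T₂ - s| := by
    rw [add_sub_cancel_left, abs_of_nonneg (by positivity)]
  conv_rhs => rw [hlen]
  refine intervalIntegral.norm_integral_le_of_norm_le_const fun q hq => ?_
  rw [uIoc_of_le h.le] at hq
  exact (h.mono ⟨hq.1.le, hq.2⟩).norm_rhs_sub_le ho hp hη

end Data

namespace Data

open IsOscillating

variable {n₁ n₂ : ℕ} {d : Data n₁ n₂} {T₁ T₂ : ℝ} {S : Set (State n₁ n₂)}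
  {f' : State n₁ n₂ → ℝ → ℝ → (EuclideanSpace ℝ (Fin n₁) × ℝ →L[ℝ] EuclideanSpace ℝ (Fin n₁))}

/-! ### Averaging of flows near a state -/

/-- The state is already frozen, so a one-point parameter space suffices for the uniform estimates
on periodic fields. -/
theorem IsOscillating.periodic_frozenDrift (ho : d.IsOscillating T₁ T₂ S f') {p : State n₁ n₂}
    (hp : p ∈ S) :
    IsPeriodicField (univ : Set Unit) T₁ T₂ (fun _ => frozenDrift d T₂ f' p) where
  cont := ((ho.isFrozenField hp).continuous_meanDrift.comp
    (f := fun q : Unit × ℝ × ℝ => q.2) continuous_snd).continuousOn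
  per₁ _ _ _ hs _ ht := (ho.isFrozenField hp).meanDrift_add_left hs ht
  per₂ _ _ _ hs _ ht := (ho.isFrozenField hp).meanDrift_add_right hs ht

/-- Slow averaging: the integral of the frozen drift along the slow phase is almost linear. -/
theorem IsOscillating.norm_integral_frozenDrift_sub_le (ho : d.IsOscillating T₁ T₂ S f')
    {p : State n₁ n₂} (hp : p ∈ S) {B ε t₁ c a b : ℝ} (hε : 0 < ε) (ht₁ : 0 ≤ t₁) (hc : 0 ≤ c)
    (hab : a ≤ b) (hB : ∀ s, 0 ≤ s → ∀ t, 0 ≤ t → ‖frozenDrift d T₂ f' p s t‖ ≤ B) :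
    ‖(∫ q in a..b, frozenDrift d T₂ f' p (t₁ + ε⁻¹ * (q - a)) c) - (b - a) • d.fbar T₁ T₂ p‖ ≤
      (B + ‖d.fbar T₁ T₂ p‖) * (ε * T₁) := by
  have hT₁ := ho.pos₁
  have hκ : ε⁻¹ ≠ 0 := by positivity
  set G : ℝ → EuclideanSpace ℝ (Fin n₁) := fun q => frozenDrift d T₂ f' p (t₁ + ε⁻¹ * (q - a)) c
    with hGdef
  have hG0 : Continuous fun s => frozenDrift d T₂ f' p s c :=
    (ho.isFrozenField hp).continuous_meanDrift.comp (f := fun s => (s, c)) (by fun_prop)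
  have hG : Continuous G := by
    exact hG0.comp (f := fun q => t₁ + ε⁻¹ * (q - a)) (by fun_prop)
  set ψ : ℝ → EuclideanSpace ℝ (Fin n₁) := fun t => (∫ q in a..t, G q) - (t - a) • d.fbar T₁ T₂ p
  have hψ : ∀ s t, ψ t - ψ s = (∫ q in s..t, G q) - (t - s) • d.fbar T₁ T₂ p := by
    intro s t
    have := intervalIntegral.integral_interval_sub_left (hG.intervalIntegrable (μ := volume) a t)
      (hG.intervalIntegrable a s)
    rw [← this]
    simp only [ψ]
    module
  have key := norm_sub_le_of_step (ψ := ψ) (s := a) (t := b) (h := ε * T₁) (η := 0)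
    (A := (B + ‖d.fbar T₁ T₂ p‖) * (ε * T₁)) (by positivity) hab le_rfl ?_ ?_
  · simpa [ψ] using key
  · intro k _
    rw [hψ]
    set s := a + k * (ε * T₁)
    -- A time `ε * T₁` is exactly one slow period, so complete steps contribute no error.
    have h1 : ∫ q in s..s + ε * T₁, G q = (ε * T₁) • d.fbar T₁ T₂ p := by
      have e1 : ∀ q, G q = (fun u => frozenDrift d T₂ f' p ((t₁ + ε⁻¹ * (s - a)) + u) c)
          (ε⁻¹ * (q - s)) := by
        intro q
        simp only [hGdef]
        congr 1
        ring
      simp_rw [e1]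
      rw [integral_comp_mul_sub_start
        (fun u => frozenDrift d T₂ f' p ((t₁ + ε⁻¹ * (s - a)) + u) c) hκ, inv_inv,
      add_sub_cancel_left s,
        inv_mul_cancel_left₀ hε.ne', intervalIntegral.integral_comp_add_left
          (fun u => frozenDrift d T₂ f' p u c), add_zero, ho.integral_frozenDrift hp ?_ hc,
        smul_smul]
      have : 0 ≤ (k : ℝ) * (ε * T₁) := by positivity
      have h2 : 0 ≤ ε⁻¹ * (s - a) := by simp only [s, add_sub_cancel_left]; positivity
      linarith
    rw [h1, add_sub_cancel_left, sub_self, norm_zero, zero_mul]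
  · intro r hr hrb hbr
    rw [hψ]
    have h1 : ‖∫ q in r..b, G q‖ ≤ B * |b - r| := by
      refine intervalIntegral.norm_integral_le_of_norm_le_const fun q hq => hB _ ?_ _ hc
      rw [uIoc_of_le hrb] at hq
      have : 0 ≤ ε⁻¹ * (q - a) := mul_nonneg (by positivity) (by linarith [hq.1])
      linarith
    have hB0 : 0 ≤ B := (norm_nonneg _).trans (hB 0 le_rfl 0 le_rfl)
    rw [abs_of_nonneg (by linarith)] at h1
    calc _ ≤ B * (b - r) + (b - r) * ‖d.fbar T₁ T₂ p‖ := by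
          refine (norm_sub_le _ _).trans (add_le_add h1 ?_)
          rw [norm_smul, Real.norm_of_nonneg (by linarith)]
      _ = (B + ‖d.fbar T₁ T₂ p‖) * (b - r) := by ring
      _ ≤ _ := by gcongr; linarith

/-- Two averagings are chained. Over each fast period the increment is compared with the integral of
the frozen drift along the slow phase, and that integral is then compared with `(b - a) f̄(p)`.
Complete periods give an error proportional to their length; the incomplete ones at the end give `B
ε`. -/
theorem IsOscillating.exists_local_averaging (ho : d.IsOscillating T₁ T₂ S f')
    (hb : d.BasicRegularity) {p : State n₁ n₂} (hp : p ∈ d.C) {η : ℝ} (hη : 0 < η) :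
    ∃ r > 0, ∃ B, 0 ≤ B ∧ ∃ ε₀ > 0, ∀ ε ∈ Ioo 0 ε₀, ∀ (θ : ℝ → State n₁ n₂) (τ₁ τ₂ : ℝ → ℝ)
      (a b : ℝ), a ≤ b → d.IsFlow ε θ τ₁ τ₂ a b → (∀ t ∈ Icc a b, θ t ∈ Metric.ball p r) →
      ‖(θ b).fst - (θ a).fst - (b - a) • d.fbar T₁ T₂ p‖ ≤ η * (b - a) + B * ε := by
  have hpS := ho.subset hp
  have hT₁ := ho.pos₁
  have hT₂ := ho.pos₂
  obtain ⟨r₁, B, hbd⟩ := ho.exists_localBound hb hp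
  have hB := hbd.nonneg
  set K := IsShortFlow.periodConst T₂ B with hK
  have hK0 : 0 ≤ K := by rw [hK, IsShortFlow.periodConst]; positivity
  -- Each fast period costs `K (η' + ε) + η'` per unit time, which is at most `η` once `ε ≤ η'`.
  set η' := η / (2 * K + 1) with hη'
  have hη'0 : 0 < η' := by positivity
  obtain ⟨r₂, hcl⟩ := ho.exists_localClose hpS hη'0
  obtain ⟨r₃, hr₃, -, hgc⟩ := (ho.periodic_frozenDrift hpS).exists_close isOpen_univ hT₁ hT₂
    (mem_univ ()) hη'0
  obtain ⟨r₄, hr₄, G₀, hG₀, hgb⟩ := (ho.periodic_frozenDrift hpS).exists_bound isOpen_univ hT₁ hT₂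
    (mem_univ ())
  obtain ⟨r, hr, hr1, hr2⟩ : ∃ r > 0, r ≤ r₁ ∧ r ≤ r₂ :=
    ⟨min r₁ r₂, lt_min hbd.pos hcl.pos, by simp, by simp⟩
  replace hbd := hbd.mono hr hr1
  replace hcl := hcl.mono hr hr2
  have hg0 : ∀ s, 0 ≤ s → ∀ t, 0 ≤ t → ‖frozenDrift d T₂ f' p s t‖ ≤ G₀ :=
    hgb () (Metric.mem_ball_self hr₄)
  -- The two summands of the constant bound the contributions of the last incomplete fast period and
  -- of the last incomplete slow period.
  refine ⟨r / 2, by positivity, T₂ * (2 * B + G₀) + (G₀ + ‖d.fbar T₁ T₂ p‖) * T₁, by positivity,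
    min (min 1 η') (min (r / T₂) (r₃ / T₂)), by positivity, ?_⟩
  rintro ε ⟨hε, hlt⟩ θ τ₁ τ₂ a b hab hf hball
  have hε1 : ε ≤ 1 := hlt.le.trans ((min_le_left _ _).trans (min_le_left _ _))
  have hεη : ε ≤ η' := hlt.le.trans ((min_le_left _ _).trans (min_le_right _ _))
  have hεr : ε * T₂ ≤ r := by
    rw [← le_div_iff₀ hT₂]; exact hlt.le.trans ((min_le_right _ _).trans (min_le_left _ _))
  have hεr₃ : ε * T₂ ≤ r₃ := by
    rw [← le_div_iff₀ hT₂]; exact hlt.le.trans ((min_le_right _ _).trans (min_le_right _ _))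
  have ha : a ∈ Icc a b := ⟨le_rfl, hab⟩
  have hc := hf.nonneg₂ a ha
  have hball' : ∀ t ∈ Icc a b, θ t ∈ Metric.ball p r := fun t ht =>
    Metric.ball_subset_ball (by linarith) (hball t ht)
  set G : ℝ → EuclideanSpace ℝ (Fin n₁) := fun q =>
    frozenDrift d T₂ f' p (τ₁ a + ε⁻¹ * (q - a)) (τ₂ a)
  have hG : Continuous G := (ho.isFrozenField hpS).continuous_meanDrift.comp
    (f := fun q => (τ₁ a + ε⁻¹ * (q - a), τ₂ a)) (by fun_prop)
  have hGb : ∀ q, a ≤ q → ‖G q‖ ≤ G₀ := fun q hq => hg0 _ (add_nonneg (hf.nonneg₁ a ha)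
    (mul_nonneg (by positivity) (by linarith))) _ hc
  set ψ : ℝ → EuclideanSpace ℝ (Fin n₁) := fun t => (θ t).fst - ∫ q in a..t, G q
  have hψ : ∀ s t, ψ t - ψ s = ((θ t).fst - (θ s).fst) - ∫ q in s..t, G q := by
    intro s t
    have := intervalIntegral.integral_interval_sub_left (hG.intervalIntegrable (μ := volume) a t)
      (hG.intervalIntegrable a s)
    rw [← this]
    simp only [ψ]
    abel
  have key := norm_sub_le_of_step (ψ := ψ) (s := a) (t := b) (h := ε ^ 2 * T₂) (η := η)
    (A := T₂ * (2 * B + G₀) * ε) (by positivity) hab hη.le ?_ ?_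
  · have h2 := ho.norm_integral_frozenDrift_sub_le hpS hε (hf.nonneg₁ a ha) hc hab hg0
    rw [hψ] at key
    calc _ = ‖((θ b).fst - (θ a).fst - ∫ q in a..b, G q) +
          ((∫ q in a..b, G q) - (b - a) • d.fbar T₁ T₂ p)‖ := by congr 1; abel
      _ ≤ (η * (b - a) + T₂ * (2 * B + G₀) * ε) + (G₀ + ‖d.fbar T₁ T₂ p‖) * (ε * T₁) :=
          (norm_add_le _ _).trans (add_le_add key h2)
      _ = _ := by ring
  · intro k hk
    set s := a + k * (ε ^ 2 * T₂) with hs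
    have hh : 0 < ε ^ 2 * T₂ := by positivity
    have has : a ≤ s := by
      have : 0 ≤ k * (ε ^ 2 * T₂) := by positivity
      linarith
    have hsm : s ∈ Icc a b := ⟨has, by linarith⟩
    have hshort : d.IsShortFlow T₂ S f' ε θ τ₁ τ₂ p r B η' s (s + ε ^ 2 * T₂) :=
      ⟨hf.mono has hk, fun q hq => hball q ⟨has.trans hq.1, hq.2.trans hk⟩, hbd, hcl, hε, hε1,
        hεr, by linarith, by linarith⟩
    have h1 := ho.norm_period_sub_le hshort hpS hη'0.le
    -- After `k` full steps the fast phase has advanced by `k * T₂`, so the same initial fast phase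
    -- serves for all steps.
    have hτ₂ : frozenDrift d T₂ f' p (τ₁ s) (τ₂ s) = frozenDrift d T₂ f' p (τ₁ s) (τ₂ a) := by
      have : τ₂ s = τ₂ a + k * T₂ := by
        rw [hf.τ₂_eq a ha s hsm has, hs]
        field_simp
        ring
      rw [this]
      exact apply_add_nat_mul hT₂.le (fun t ht =>
        (ho.isFrozenField hpS).meanDrift_add_right (hf.nonneg₁ s hsm) ht) k hc
    have h2 : ‖(∫ q in s..s + ε ^ 2 * T₂, G q) -
        (ε ^ 2 * T₂) • frozenDrift d T₂ f' p (τ₁ s) (τ₂ a)‖ ≤ η' * (ε ^ 2 * T₂) := by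
      have e1 : (ε ^ 2 * T₂) • frozenDrift d T₂ f' p (τ₁ s) (τ₂ a) =
          ∫ _ in s..s + ε ^ 2 * T₂, frozenDrift d T₂ f' p (τ₁ s) (τ₂ a) := by
        rw [intervalIntegral.integral_const, add_sub_cancel_left]
      rw [e1, ← intervalIntegral.integral_sub (hG.intervalIntegrable _ _) (by simp)]
      have e2 : ε ^ 2 * T₂ = |s + ε ^ 2 * T₂ - s| := by
        rw [add_sub_cancel_left, abs_of_pos hh]
      conv_rhs => rw [e2]
      refine intervalIntegral.norm_integral_le_of_norm_le_const fun q hq => ?_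
      rw [uIoc_of_le (by linarith)] at hq
      have e3 : τ₁ a + ε⁻¹ * (q - a) = τ₁ s + ε⁻¹ * (q - s) := by
        rw [hf.τ₁_eq a ha s hsm has]; ring
      have e4 : ε⁻¹ * (q - s) ≤ ε * T₂ := by
        rw [inv_mul_le_iff₀ hε]; nlinarith [hq.2]
      have e5 : 0 ≤ ε⁻¹ * (q - s) := mul_nonneg (by positivity) (by linarith [hq.1])
      simp only [G, e3]
      exact hgc () (Metric.mem_ball_self hr₃) _ (hf.nonneg₁ s hsm) _
        ⟨by linarith, by linarith⟩ _ hc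
    rw [hψ]
    calc _ = ‖((θ (s + ε ^ 2 * T₂)).fst - (θ s).fst -
          (ε ^ 2 * T₂) • frozenDrift d T₂ f' p (τ₁ s) (τ₂ s)) -
          ((∫ q in s..s + ε ^ 2 * T₂, G q) -
          (ε ^ 2 * T₂) • frozenDrift d T₂ f' p (τ₁ s) (τ₂ a))‖ := by rw [hτ₂]; congr 1; abel
      _ ≤ K * (η' + ε) * (ε ^ 2 * T₂) + η' * (ε ^ 2 * T₂) :=
          (norm_sub_le _ _).trans (add_le_add h1 h2)
      _ ≤ K * (η' + η') * (ε ^ 2 * T₂) + η' * (ε ^ 2 * T₂) := by gcongr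
      _ = η * (ε ^ 2 * T₂) := by rw [hη']; field_simp; ring
  · intro s hs hsb hbs
    have hsm : s ∈ Icc a b := ⟨hs, hsb⟩
    have hbm : b ∈ Icc a b := ⟨hab, le_rfl⟩
    have h1 := hf.norm_fst_sub_le hε hsm hbm hsb (B := B) fun q hq => by
      have hq' : q ∈ Icc a b := ⟨hs.trans hq.1, hq.2⟩
      exact ⟨hbd.φ₁_le _ (hball' q hq') _ (hf.nonneg₁ q hq') _ (hf.nonneg₂ q hq'),
        hbd.φ₂_le _ (hball' q hq') _ (hf.nonneg₁ q hq') _ (hf.nonneg₂ q hq')⟩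
    have h2 : ‖∫ q in s..b, G q‖ ≤ G₀ * |b - s| := by
      refine intervalIntegral.norm_integral_le_of_norm_le_const fun q hq => hGb q ?_
      rw [uIoc_of_le hsb] at hq
      linarith [hq.1]
    rw [abs_of_nonneg (by linarith)] at h2
    rw [hψ]
    calc _ ≤ (ε⁻¹ * B + B) * (b - s) + G₀ * (b - s) := (norm_sub_le _ _).trans (add_le_add h1 h2)
      _ = (ε⁻¹ * B + B + G₀) * (b - s) := by ring
      _ ≤ (ε⁻¹ * B + B + G₀) * (ε ^ 2 * T₂) := by gcongr; linarith
      _ = T₂ * (B + ε * (B + G₀)) * ε := by field_simp; ring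
      _ ≤ T₂ * (B + 1 * (B + G₀)) * ε := by gcongr
      _ = _ := by ring

end Data

/-- A continuous curve of norm at most `R` at the start and at least `R` at the end has a first time
at which its norm is `R`. -/
theorem exists_first_norm_eq {E : Type*} [NormedAddCommGroup E] {ψ : ℝ → E} {s t R : ℝ}
    (hst : s ≤ t) (hψ : ContinuousOn ψ (Icc s t)) (hs : ‖ψ s‖ ≤ R) (ht : R ≤ ‖ψ t‖) :
    ∃ e ∈ Icc s t, ‖ψ e‖ = R ∧ ∀ q ∈ Icc s e, ‖ψ q‖ ≤ R := by
  have hcl : IsClosed (Icc s t ∩ {q | R ≤ ‖ψ q‖}) :=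
    hψ.norm.preimage_isClosed_of_isClosed isClosed_Icc isClosed_Ici
  have hcomp : IsCompact (Icc s t ∩ {q | R ≤ ‖ψ q‖}) :=
    isCompact_Icc.of_isClosed_subset hcl inter_subset_left
  obtain ⟨e, he, hmin⟩ := hcomp.exists_isLeast ⟨t, ⟨hst, le_rfl⟩, ht⟩
  have hlt : ∀ q ∈ Ico s e, ‖ψ q‖ < R := fun q hq => by
    by_contra! hcon
    exact absurd (hmin ⟨⟨hq.1, hq.2.le.trans he.1.2⟩, hcon⟩) (not_le.2 hq.2)
  have hle : ‖ψ e‖ ≤ R := by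
    rcases he.1.1.eq_or_lt with h | h
    · rwa [← h]
    · obtain ⟨q, hq, hqR⟩ := intermediate_value_Icc h.le
        (hψ.norm.mono (Icc_subset_Icc le_rfl he.1.2)) ⟨hs, he.2⟩
      rcases hq.2.eq_or_lt with h' | h'
      · rw [← h']; exact hqR.le
      · exact absurd hqR (hlt q ⟨hq.1, h'⟩).ne
  refine ⟨e, he.1, le_antisymm hle he.2, fun q hq => ?_⟩
  rcases hq.2.eq_or_lt with h' | h'
  · rwa [h']
  · exact (hlt q ⟨hq.1, h'⟩).le

namespace Data

open IsOscillating

variable {n₁ n₂ : ℕ} {d : Data n₁ n₂} {T₁ T₂ : ℝ} {S : Set (State n₁ n₂)}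
  {f' : State n₁ n₂ → ℝ → ℝ → (EuclideanSpace ℝ (Fin n₁) × ℝ →L[ℝ] EuclideanSpace ℝ (Fin n₁))}

/-! ### Equi-Lipschitz estimates -/

theorem IsOscillating.exists_local_speed (ho : d.IsOscillating T₁ T₂ S f')
    (hb : d.BasicRegularity) {p : State n₁ n₂} (hp : p ∈ d.C) :
    ∃ r > 0, ∃ M, 0 ≤ M ∧ ∃ B, 0 ≤ B ∧ ∃ ε₀ > 0, ∀ ε ∈ Ioo 0 ε₀, ∀ (θ : ℝ → State n₁ n₂)
      (τ₁ τ₂ : ℝ → ℝ) (a b : ℝ), a ≤ b → d.IsFlow ε θ τ₁ τ₂ a b →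
      (∀ t ∈ Icc a b, θ t ∈ Metric.ball p r) → ‖θ b - θ a‖ ≤ M * (b - a) + B * ε := by
  obtain ⟨r₁, hr₁, B, hB, ε₀, hε₀, hav⟩ := ho.exists_local_averaging hb hp one_pos
  obtain ⟨r₂, B₂, hbd⟩ := ho.exists_localBound hb hp
  have hB₂ := hbd.nonneg
  refine ⟨min r₁ r₂, lt_min hr₁ hbd.pos, 1 + ‖d.fbar T₁ T₂ p‖ + B₂, by positivity, B, hB, ε₀,
    hε₀, fun ε hε θ τ₁ τ₂ a b hab hf hball => ?_⟩
  have h1 := hav ε hε θ τ₁ τ₂ a b hab hf fun t ht =>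
    Metric.ball_subset_ball (min_le_left _ _) (hball t ht)
  have h2 := hf.norm_snd_sub_le (left_mem_Icc.2 hab) (right_mem_Icc.2 hab) hab hB₂
    fun t ht => hbd.Φ_le _ ⟨Metric.ball_subset_ball (min_le_right _ _) (hball t ht), hf.mem t ht⟩
  have h3 : ‖(θ b).fst - (θ a).fst‖ ≤ 1 * (b - a) + B * ε + (b - a) * ‖d.fbar T₁ T₂ p‖ := by
    calc _ = ‖((θ b).fst - (θ a).fst - (b - a) • d.fbar T₁ T₂ p) +
          (b - a) • d.fbar T₁ T₂ p‖ := by rw [sub_add_cancel]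
      _ ≤ _ := by
        refine (norm_add_le _ _).trans (add_le_add h1 ?_)
        rw [norm_smul, Real.norm_of_nonneg (by linarith)]
  have h4 := norm_mkState_sub_le (θ b).fst (θ b).snd (θ a)
  calc ‖θ b - θ a‖ ≤ ‖(θ b).fst - (θ a).fst‖ + ‖(θ b).snd - (θ a).snd‖ := h4
    _ ≤ _ := by linarith

/-- The bound on flows that start in `W` and stay within `ρ` of the start. -/
theorem IsOscillating.exists_speed_of_isCompact (ho : d.IsOscillating T₁ T₂ S f')
    (hb : d.BasicRegularity) {K : Set (State n₁ n₂)} (hK : IsCompact K) (hKC : K ⊆ d.C) :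
    ∃ ρ > 0, ∃ M, 0 ≤ M ∧ ∃ B, 0 ≤ B ∧ ∃ ε₀ > 0, ∀ ε ∈ Ioo 0 ε₀, ∀ (θ : ℝ → State n₁ n₂)
      (τ₁ τ₂ : ℝ → ℝ) (a b : ℝ), a ≤ b → d.IsFlow ε θ τ₁ τ₂ a b → θ a ∈ K →
      (∀ t ∈ Icc a b, ‖θ t - θ a‖ < ρ) → ‖θ b - θ a‖ ≤ M * (b - a) + B * ε := by
  refine hK.induction_on (p := fun W => ∃ ρ > 0, ∃ M, 0 ≤ M ∧ ∃ B, 0 ≤ B ∧ ∃ ε₀ > 0,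
      ∀ ε ∈ Ioo 0 ε₀, ∀ (θ : ℝ → State n₁ n₂)
      (τ₁ τ₂ : ℝ → ℝ) (a b : ℝ), a ≤ b → d.IsFlow ε θ τ₁ τ₂ a b → θ a ∈ W →
      (∀ t ∈ Icc a b, ‖θ t - θ a‖ < ρ) → ‖θ b - θ a‖ ≤ M * (b - a) + B * ε) ?_ ?_ ?_ ?_
  · exact ⟨1, one_pos, 0, le_rfl, 0, le_rfl, 1, one_pos, fun _ _ _ _ _ _ _ _ _ h => h.elim⟩
  · rintro W W' hW ⟨ρ, hρ, M, hM, B, hB, ε₀, hε₀, h⟩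
    exact ⟨ρ, hρ, M, hM, B, hB, ε₀, hε₀, fun ε hε θ τ₁ τ₂ a b hab hf ha =>
      h ε hε θ τ₁ τ₂ a b hab hf (hW ha)⟩
  · rintro W W' ⟨ρ, hρ, M, hM, B, hB, ε₀, hε₀, h⟩ ⟨ρ', hρ', M', hM', B', hB', ε₀', hε₀', h'⟩
    refine ⟨min ρ ρ', lt_min hρ hρ', max M M', le_max_of_le_left hM, max B B',
      le_max_of_le_left hB, min ε₀ ε₀', lt_min hε₀ hε₀',
      fun ε hε θ τ₁ τ₂ a b hab hf ha hball => ?_⟩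
    have hε0 : 0 ≤ ε := hε.1.le
    have hab' : 0 ≤ b - a := sub_nonneg.2 hab
    rcases ha with ha | ha
    · refine (h ε ⟨hε.1, hε.2.trans_le (min_le_left _ _)⟩ θ τ₁ τ₂ a b hab hf ha
        fun t ht => (hball t ht).trans_le (min_le_left _ _)).trans ?_
      gcongr <;> exact le_max_left _ _
    · refine (h' ε ⟨hε.1, hε.2.trans_le (min_le_right _ _)⟩ θ τ₁ τ₂ a b hab hf ha
        fun t ht => (hball t ht).trans_le (min_le_right _ _)).trans ?_
      gcongr <;> exact le_max_right _ _
  · intro p hp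
    obtain ⟨r, hr, M, hM, B, hB, ε₀, hε₀, h⟩ := ho.exists_local_speed hb (hKC hp)
    refine ⟨Metric.ball p (r / 2),
      mem_nhdsWithin_of_mem_nhds (Metric.ball_mem_nhds p (half_pos hr)),
      r / 2, half_pos hr, M, hM, B, hB, ε₀, hε₀, fun ε hε θ τ₁ τ₂ a b hab hf ha hball =>
      h ε hε θ τ₁ τ₂ a b hab hf fun t ht => ?_⟩
    have h1 := hball t ht
    rw [Metric.mem_ball] at ha ⊢
    rw [← dist_eq_norm] at h1
    linarith [dist_triangle (θ t) (θ a) p]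

/-- The local speed bound presupposes that the flow stays within `ρ` of its start. For durations at
most `h₀` it cannot leave, since at a first exit the bound itself would be violated. Longer flows
are cut into pieces of length at most `h₀`. -/
theorem IsOscillating.exists_equiLipschitz (ho : d.IsOscillating T₁ T₂ S f')
    (hb : d.BasicRegularity) (R : ℝ) :
    ∃ M, 0 ≤ M ∧ ∃ B, 0 ≤ B ∧ ∃ ε₀ > 0, ∀ ε ∈ Ioo 0 ε₀, ∀ (θ : ℝ → State n₁ n₂)
      (τ₁ τ₂ : ℝ → ℝ) (a b : ℝ), a ≤ b → d.IsFlow ε θ τ₁ τ₂ a b →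
      (∀ t ∈ Icc a b, ‖θ t‖ ≤ R) → ‖θ b - θ a‖ ≤ M * (b - a) + B * ε := by
  have hK : IsCompact (d.C ∩ Metric.closedBall 0 R) :=
    (isCompact_closedBall 0 R).inter_left hb.closed_C
  obtain ⟨ρ, hρ, M, hM, B, hB, ε₀, hε₀, h⟩ := ho.exists_speed_of_isCompact hb hK inter_subset_left
  set h₀ := ρ / (4 * (M + 1))
  have hh₀ : 0 < h₀ := by positivity
  have hMh : M * h₀ ≤ ρ / 4 := by
    calc M * h₀ ≤ (M + 1) * h₀ := by gcongr; linarith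
      _ = ρ / 4 := by simp only [h₀]; field_simp
  set ε₁ := min ε₀ (ρ / (4 * (B + 1)))
  have hε₁ : 0 < ε₁ := by positivity
  have hBε : ∀ ε ∈ Ioo 0 ε₁, B * ε ≤ ρ / 4 := fun ε hε => by
    have : ε ≤ ρ / (4 * (B + 1)) := hε.2.le.trans (min_le_right _ _)
    calc B * ε ≤ (B + 1) * ε := by gcongr; exacts [hε.1.le, by linarith]
      _ ≤ (B + 1) * (ρ / (4 * (B + 1))) := by gcongr
      _ = ρ / 4 := by field_simp
  have short : ∀ ε ∈ Ioo 0 ε₁, ∀ (θ : ℝ → State n₁ n₂) (τ₁ τ₂ : ℝ → ℝ) (a b : ℝ), a ≤ b →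
      b - a ≤ h₀ → d.IsFlow ε θ τ₁ τ₂ a b → (∀ t ∈ Icc a b, ‖θ t‖ ≤ R) →
      ‖θ b - θ a‖ ≤ M * (b - a) + B * ε := by
    intro ε hε θ τ₁ τ₂ a b hab hlen hf hR
    have hε' : ε ∈ Ioo 0 ε₀ := ⟨hε.1, hε.2.trans_le (min_le_left _ _)⟩
    have hstart : θ a ∈ d.C ∩ Metric.closedBall 0 R :=
      ⟨hf.mem a ⟨le_rfl, hab⟩, by simpa using hR a ⟨le_rfl, hab⟩⟩
    by_cases hstay : ∀ t ∈ Icc a b, ‖θ t - θ a‖ < ρ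
    · exact h ε hε' θ τ₁ τ₂ a b hab hf hstart hstay
    · exfalso
      push Not at hstay
      obtain ⟨t, ht, hge⟩ := hstay
      -- Up to the first time at distance `3 / 4 * ρ` the speed bound applies and gives at most `ρ /
      -- 4 + ρ / 4`, a contradiction.
      obtain ⟨e, he, heq, hle⟩ := exists_first_norm_eq (ψ := fun q => θ q - θ a) (R := 3 / 4 * ρ)
        ht.1 ((hf.cont.mono (Icc_subset_Icc le_rfl ht.2)).sub continuousOn_const)
        (by simpa using hρ.le) (by linarith)
      have h1 := h ε hε' θ τ₁ τ₂ a e he.1 (hf.mono le_rfl (he.2.trans ht.2)) hstart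
        fun q hq => (hle q hq).trans_lt (by linarith)
      have h2 : M * (e - a) ≤ M * h₀ := by
        gcongr
        linarith [he.2, ht.2]
      have h3 := hBε ε hε
      linarith
  have chain : ∀ N : ℕ, ∀ ε ∈ Ioo 0 ε₁, ∀ (θ : ℝ → State n₁ n₂) (τ₁ τ₂ : ℝ → ℝ) (a b : ℝ), a ≤ b →
      b - a ≤ N * h₀ → d.IsFlow ε θ τ₁ τ₂ a b → (∀ t ∈ Icc a b, ‖θ t‖ ≤ R) →
      ‖θ b - θ a‖ ≤ M * (b - a) + N * (B * ε) := by
    intro N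
    induction N with
    | zero =>
      intro ε hε θ τ₁ τ₂ a b hab hlen hf hR
      have : a = b := by simp only [Nat.cast_zero, zero_mul] at hlen; linarith
      subst this
      simp
    | succ N ih =>
      intro ε hε θ τ₁ τ₂ a b hab hlen hf hR
      set c := max a (b - h₀)
      have hac : a ≤ c := le_max_left _ _
      have hcb : c ≤ b := max_le hab (by linarith)
      push_cast at hlen ⊢
      have h1 := ih ε hε θ τ₁ τ₂ a c hac (by
        rcases le_total a (b - h₀) with h | h
        · rw [show c = b - h₀ from max_eq_right h]; linarith
        · rw [show c = a from max_eq_left h, sub_self]; positivity) (hf.mono le_rfl hcb)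
        fun t ht => hR t ⟨ht.1, ht.2.trans hcb⟩
      have h2 := short ε hε θ τ₁ τ₂ c b hcb (by linarith [le_max_right a (b - h₀)])
        (hf.mono hac le_rfl) fun t ht => hR t ⟨hac.trans ht.1, ht.2⟩
      calc ‖θ b - θ a‖ = ‖(θ b - θ c) + (θ c - θ a)‖ := by rw [sub_add_sub_cancel]
        _ ≤ (M * (b - c) + B * ε) + (M * (c - a) + N * (B * ε)) :=
            (norm_add_le _ _).trans (add_le_add h2 h1)
        _ = _ := by ring
  -- There are at most `(b - a) / h₀ + 1` pieces, each with error `B * ε`; all but one of these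
  -- errors are absorbed into the slope.
  refine ⟨M + B * ε₁ / h₀, by positivity, B, hB, ε₁, hε₁,
    fun ε hε θ τ₁ τ₂ a b hab hf hR => ?_⟩
  have hq : 0 ≤ (b - a) / h₀ := div_nonneg (by linarith) hh₀.le
  have h1 := chain ⌈(b - a) / h₀⌉₊ ε hε θ τ₁ τ₂ a b hab
    (by rw [← div_le_iff₀ hh₀]; exact Nat.le_ceil _) hf hR
  have h2 : (⌈(b - a) / h₀⌉₊ : ℝ) ≤ (b - a) / h₀ + 1 := (Nat.ceil_lt_add_one hq).le
  have hBε0 : 0 ≤ B * ε := mul_nonneg hB hε.1.le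
  calc ‖θ b - θ a‖ ≤ M * (b - a) + ⌈(b - a) / h₀⌉₊ * (B * ε) := h1
    _ ≤ M * (b - a) + ((b - a) / h₀ + 1) * (B * ε) := by gcongr
    _ = M * (b - a) + (b - a) / h₀ * (B * ε) + B * ε := by ring
    _ ≤ M * (b - a) + (b - a) / h₀ * (B * ε₁) + B * ε := by gcongr; exact hε.2.le
    _ = _ := by ring

/-- Half spaces that contain `Φ(z)` in their interior contain `Φ` near `z`. -/
theorem BasicRegularity.exists_support (hb : d.BasicRegularity) {p : State n₁ n₂} (hp : p ∈ d.C)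
    (l : EuclideanSpace ℝ (Fin n₂) →L[ℝ] ℝ) {c : ℝ} (hc : ∀ v ∈ d.Φ p.snd, l v < c) :
    ∃ r > 0, ∀ θ ∈ Metric.ball p r ∩ d.C, ∀ v ∈ d.Φ θ.snd, l v ≤ c := by
  by_contra! hcon
  obtain ⟨N, hN, B, hB⟩ := hb.locBdd_Φ p hp
  -- Violating velocities at states tending to `p` are bounded, so they have a limit point, which
  -- outer semicontinuity places in `Φ` at `p` although the functional is at least `c` there.
  choose! θ hθ v hv hlt using fun n : ℕ => hcon (1 / ((n : ℝ) + 1)) (by positivity)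
  have hθp : Tendsto θ atTop (𝓝 p) := by
    rw [tendsto_iff_dist_tendsto_zero]
    exact squeeze_zero (fun _ => dist_nonneg) (fun n => (hθ n).1.le)
      tendsto_one_div_add_atTop_nhds_zero_nat
  have hev : ∀ᶠ n in atTop, ‖v n‖ ≤ B := by
    filter_upwards [hθp hN] with n hn
    exact hB _ ⟨hn, (hθ n).2⟩ _ (hv n)
  obtain ⟨v₀, -, φ, hφ, hv₀⟩ := tendsto_subseq_of_frequently_bounded
    (Metric.isBounded_closedBall (x := (0 : EuclideanSpace ℝ (Fin n₂))) (r := B))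
    (hev.mono fun n hn => by simpa using hn).frequently
  have h1 : v₀ ∈ d.Φ p.snd := hb.osc_Φ (θ ∘ φ) (v ∘ φ) p v₀ (fun n => (hθ _).2) hp
    (fun n => hv _) (hθp.comp hφ.tendsto_atTop) hv₀
  have h2 : c ≤ l v₀ := ge_of_tendsto' ((l.continuous.tendsto v₀).comp hv₀) fun n => (hlt _).le
  exact absurd (hc v₀ h1) (not_lt.2 h2)

end Data

/-! ### Ultralimits of flows on one level -/

theorem exists_tendsto_of_isCompact {X : Type*} [TopologicalSpace X] {𝓤 : Ultrafilter ℕ} {K : Set X}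
    (hK : IsCompact K) {u : ℕ → X} (hu : ∀ᶠ i in 𝓤, u i ∈ K) :
    ∃ x ∈ K, Tendsto u 𝓤 (𝓝 x) := by
  obtain ⟨x, hx, h⟩ := hK.ultrafilter_le_nhds' (𝓤.map u) hu
  exact ⟨x, hx, h⟩

/-- `t` is a limit of points of the sets `I i`. -/
def IsApprox (𝓤 : Ultrafilter ℕ) (I : ℕ → Set ℝ) (t : ℝ) (u : ℕ → ℝ) : Prop :=
  (∀ᶠ i in 𝓤, u i ∈ I i) ∧ Tendsto u 𝓤 (𝓝 t)

/-- The functions `θ i` are eventually uniformly bounded on `I i`, up to some time after `t`. -/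
def IsBddUpTo {E : Type*} [NormedAddCommGroup E] (𝓤 : Ultrafilter ℕ) (I : ℕ → Set ℝ)
    (θ : ℕ → ℝ → E) (t : ℝ) : Prop :=
  ∃ R : ℝ, ∃ t' > t, ∀ᶠ i in 𝓤, ∀ q ∈ I i, q ≤ t' → ‖θ i q‖ ≤ R

/-- The times at which the ultralimit of the functions `θ i` is defined. -/
def limitSet {E : Type*} [NormedAddCommGroup E] (𝓤 : Ultrafilter ℕ) (I : ℕ → Set ℝ)
    (θ : ℕ → ℝ → E) : Set ℝ :=
  {t | (∃ u, IsApprox 𝓤 I t u) ∧ IsBddUpTo 𝓤 I θ t}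

open Classical in
/-- The ultralimit of the functions `θ i` on `limitSet`. -/
noncomputable def limitFun {E : Type*} [NormedAddCommGroup E] (𝓤 : Ultrafilter ℕ) (I : ℕ → Set ℝ)
    (θ : ℕ → ℝ → E) (t : ℝ) : E :=
  if h : ∃ q, ∀ u, IsApprox 𝓤 I t u → Tendsto (fun i => θ i (u i)) 𝓤 (𝓝 q) then h.choose else 0

namespace Data

open IsOscillating

variable {n₁ n₂ : ℕ}

/-- A sequence of flows with `ε → 0`. -/
structure IsFlowSeq (d : Data n₁ n₂) (𝓤 : Ultrafilter ℕ) (T : ℝ) (I : ℕ → Set ℝ) (ε : ℕ → ℝ)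
    (θ : ℕ → ℝ → State n₁ n₂) (τ₁ τ₂ : ℕ → ℝ → ℝ) : Prop where
  ord : ∀ i, (I i).OrdConnected
  sub : ∀ i, I i ⊆ Icc 0 T
  pos : ∀ i, 0 < ε i
  tendsto : Tendsto ε 𝓤 (𝓝 0)
  flow : ∀ i, ∀ s ∈ I i, ∀ t ∈ I i, s < t → d.IsFlow (ε i) (θ i) (τ₁ i) (τ₂ i) s t

namespace IsFlowSeq

variable {d : Data n₁ n₂} {T₁ T₂ : ℝ} {S : Set (State n₁ n₂)}
  {f' : State n₁ n₂ → ℝ → ℝ → (EuclideanSpace ℝ (Fin n₁) × ℝ →L[ℝ] EuclideanSpace ℝ (Fin n₁))}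
  {𝓤 : Ultrafilter ℕ} {T : ℝ} {I : ℕ → Set ℝ} {ε : ℕ → ℝ} {θ : ℕ → ℝ → State n₁ n₂}
  {τ₁ τ₂ : ℕ → ℝ → ℝ}

theorem eventually_mem_Ioo (h : d.IsFlowSeq 𝓤 T I ε θ τ₁ τ₂) {ε₀ : ℝ} (hε₀ : 0 < ε₀) :
    ∀ᶠ i in 𝓤, ε i ∈ Ioo 0 ε₀ := by
  filter_upwards [h.tendsto (Iio_mem_nhds hε₀)] with i hi
  exact ⟨h.pos i, hi⟩

theorem exists_equiLipschitz (h : d.IsFlowSeq 𝓤 T I ε θ τ₁ τ₂) (ho : d.IsOscillating T₁ T₂ S f')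
    (hb : d.BasicRegularity) (R : ℝ) :
    ∃ M, 0 ≤ M ∧ ∃ B, 0 ≤ B ∧ ∀ᶠ i in 𝓤, ∀ s ∈ I i, ∀ t ∈ I i, s ≤ t →
      (∀ q ∈ Icc s t, ‖θ i q‖ ≤ R) → ‖θ i t - θ i s‖ ≤ M * (t - s) + B * ε i := by
  obtain ⟨M, hM, B, hB, ε₀, hε₀, hL⟩ := ho.exists_equiLipschitz hb R
  refine ⟨M, hM, B, hB, ?_⟩
  filter_upwards [h.eventually_mem_Ioo hε₀] with i hi s hs t ht hst hR
  rcases hst.eq_or_lt with rfl | hlt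
  · have := mul_nonneg hB hi.1.le
    simpa
  · exact hL (ε i) hi (θ i) (τ₁ i) (τ₂ i) s t hst (h.flow i s hs t ht hlt) hR

/-- By the equi-Lipschitz bound the values at two sequences of times with the same limit merge, so
the ultralimit does not depend on the approximating times. -/
theorem tendsto_sub (h : d.IsFlowSeq 𝓤 T I ε θ τ₁ τ₂) (ho : d.IsOscillating T₁ T₂ S f')
    (hb : d.BasicRegularity) {t : ℝ} (ht : IsBddUpTo 𝓤 I θ t) {u v : ℕ → ℝ}
    (hu : IsApprox 𝓤 I t u) (hv : IsApprox 𝓤 I t v) :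
    Tendsto (fun i => θ i (u i) - θ i (v i)) 𝓤 (𝓝 0) := by
  obtain ⟨R, t', ht', hR⟩ := ht
  obtain ⟨M, hM, B, hB, hL⟩ := h.exists_equiLipschitz ho hb R
  have hlim : Tendsto (fun i => M * |u i - v i| + B * ε i) 𝓤 (𝓝 0) := by
    have := (((hu.2.sub hv.2).abs).const_mul M).add (h.tendsto.const_mul B)
    simpa using this
  refine squeeze_zero_norm' ?_ hlim
  filter_upwards [hR, hL, hu.1, hv.1, hu.2 (Iio_mem_nhds ht'), hv.2 (Iio_mem_nhds ht')]
    with i hRi hLi hui hvi hut hvt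
  have key : ∀ s ∈ I i, ∀ r ∈ I i, s ≤ r → r < t' → ‖θ i r - θ i s‖ ≤ M * (r - s) + B * ε i :=
    fun s hs r hr hsr hrt => hLi s hs r hr hsr fun q hq =>
      hRi q ((h.ord i).out hs hr hq) (hq.2.trans hrt.le)
  rcases le_total (v i) (u i) with hle | hle
  · rw [abs_of_nonneg (sub_nonneg.2 hle)]
    exact key _ hvi _ hui hle hut
  · rw [norm_sub_rev, abs_sub_comm, abs_of_nonneg (sub_nonneg.2 hle)]
    exact key _ hui _ hvi hle hvt

theorem tendsto_limitFun (h : d.IsFlowSeq 𝓤 T I ε θ τ₁ τ₂) (ho : d.IsOscillating T₁ T₂ S f')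
    (hb : d.BasicRegularity) {t : ℝ} (ht : t ∈ limitSet 𝓤 I θ) {u : ℕ → ℝ}
    (hu : IsApprox 𝓤 I t u) : Tendsto (fun i => θ i (u i)) 𝓤 (𝓝 (limitFun 𝓤 I θ t)) := by
  have hex : ∃ q, ∀ u, IsApprox 𝓤 I t u → Tendsto (fun i => θ i (u i)) 𝓤 (𝓝 q) := by
    obtain ⟨⟨v, hv⟩, hbdd⟩ := ht
    obtain ⟨R, t', ht', hR⟩ := id hbdd
    obtain ⟨q, -, hq⟩ := exists_tendsto_of_isCompact (𝓤 := 𝓤)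
      (isCompact_closedBall (0 : State n₁ n₂) R) (u := fun i => θ i (v i)) (by
        filter_upwards [hR, hv.1, hv.2 (Iio_mem_nhds ht')] with i h1 h2 h3
        simpa using h1 _ h2 (le_of_lt h3))
    refine ⟨q, fun w hw => ?_⟩
    simpa using (h.tendsto_sub ho hb hbdd hw hv).add hq
  rw [limitFun, dif_pos hex]
  exact hex.choose_spec u hu

/-- A time up to which the flows are bounded belongs to the limit set. -/
theorem mem_limitSet (h : d.IsFlowSeq 𝓤 T I ε θ τ₁ τ₂) (ho : d.IsOscillating T₁ T₂ S f')
    (hb : d.BasicRegularity) {e : ℝ} {u : ℕ → ℝ} (hu : IsApprox 𝓤 I e u) {R : ℝ}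
    (hR : ∀ᶠ i in 𝓤, ∀ q ∈ I i, q ≤ u i → ‖θ i q‖ ≤ R) : e ∈ limitSet 𝓤 I θ := by
  refine ⟨⟨u, hu⟩, R + 1, ?_⟩
  obtain ⟨M, hM, B, hB, hL⟩ := h.exists_equiLipschitz ho hb (R + 1)
  -- Within time `2 * δ` the norm grows by less than `1 / 2 + 1 / 2`, so it cannot go from at most
  -- `R` to `R + 1`.
  set δ := 1 / (4 * (M + 1))
  have hδ : 0 < δ := by positivity
  have hMδ : M * (2 * δ) ≤ 1 / 2 := by
    calc M * (2 * δ) ≤ (M + 1) * (2 * δ) := by gcongr; linarith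
      _ = 1 / 2 := by simp only [δ]; field_simp; norm_num
  have hBε : ∀ᶠ i in 𝓤, B * ε i < 1 / 2 := by
    have : Tendsto (fun i => B * ε i) 𝓤 (𝓝 0) := by simpa using h.tendsto.const_mul B
    exact this (Iio_mem_nhds (by norm_num))
  refine ⟨e + δ, by linarith, ?_⟩
  filter_upwards [hR, hL, hu.1, hBε, hu.2 (Ioi_mem_nhds (by linarith : e - δ < e))]
    with i hRi hLi hui hBi hue q hq hqe
  by_contra! hcon
  have hlt : u i < q := by
    by_contra! hle
    linarith [hRi q hq hle]
  have hcont := (h.flow i _ hui q hq hlt).cont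
  obtain ⟨r, hr, hreq, hrle⟩ := exists_first_norm_eq (R := R + 1) hlt.le hcont
    ((hRi _ hui le_rfl).trans (by linarith)) hcon.le
  have h1 := hLi _ hui r ((h.ord i).out hui hq hr) hr.1 hrle
  have h2 : M * (r - u i) ≤ M * (2 * δ) := by
    gcongr
    have : e - δ < u i := hue
    linarith [hr.2]
  have h3 : ‖θ i r‖ ≤ ‖θ i r - θ i (u i)‖ + ‖θ i (u i)‖ := by
    simpa using norm_add_le (θ i r - θ i (u i)) (θ i (u i))
  linarith [hRi _ hui le_rfl]

theorem eventually_mem (h : d.IsFlowSeq 𝓤 T I ε θ τ₁ τ₂) {s t q : ℝ} (hs : s ∈ limitSet 𝓤 I θ)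
    (ht : t ∈ limitSet 𝓤 I θ) (hsq : s < q) (hqt : q < t) : ∀ᶠ i in 𝓤, q ∈ I i := by
  obtain ⟨⟨u, hu⟩, -⟩ := hs
  obtain ⟨⟨v, hv⟩, -⟩ := ht
  filter_upwards [hu.1, hv.1, hu.2 (Iio_mem_nhds hsq), hv.2 (Ioi_mem_nhds hqt)] with i h1 h2 h3 h4
  exact (h.ord i).out h1 h2 ⟨le_of_lt h3, le_of_lt h4⟩

theorem ordConnected (h : d.IsFlowSeq 𝓤 T I ε θ τ₁ τ₂) : (limitSet 𝓤 I θ).OrdConnected := by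
  refine ⟨fun s hs t ht q hq => ?_⟩
  rcases hq.1.eq_or_lt with rfl | hsq
  · exact hs
  rcases hq.2.eq_or_lt with rfl | hqt
  · exact ht
  obtain ⟨R, t', ht', hR⟩ := ht.2
  exact ⟨⟨fun _ => q, h.eventually_mem hs ht hsq hqt, tendsto_const_nhds⟩, R, t', hqt.trans ht', hR⟩

/-- The error `B * ε` of the equi-Lipschitz bound vanishes in the limit. -/
theorem exists_lipschitzOnWith (h : d.IsFlowSeq 𝓤 T I ε θ τ₁ τ₂) (ho : d.IsOscillating T₁ T₂ S f')
    (hb : d.BasicRegularity) {t : ℝ} (ht : t ∈ limitSet 𝓤 I θ) :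
    ∃ K : NNReal, LipschitzOnWith K (limitFun 𝓤 I θ) (limitSet 𝓤 I θ ∩ Iic t) := by
  obtain ⟨R, t', ht', hR⟩ := ht.2
  obtain ⟨M, hM, B, hB, hL⟩ := h.exists_equiLipschitz ho hb R
  have key : ∀ p ∈ limitSet 𝓤 I θ ∩ Iic t, ∀ q ∈ limitSet 𝓤 I θ ∩ Iic t, p < q →
      ‖limitFun 𝓤 I θ q - limitFun 𝓤 I θ p‖ ≤ M * (q - p) := by
    rintro p ⟨hp, -⟩ q ⟨hq, hqt⟩ hpq
    obtain ⟨u, hu⟩ := hp.1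
    obtain ⟨v, hv⟩ := hq.1
    have l1 := ((h.tendsto_limitFun ho hb hq hv).sub (h.tendsto_limitFun ho hb hp hu)).norm
    have l2 : Tendsto (fun i => M * (v i - u i) + B * ε i) 𝓤 (𝓝 (M * (q - p))) := by
      simpa using ((hv.2.sub hu.2).const_mul M).add (h.tendsto.const_mul B)
    refine le_of_tendsto_of_tendsto l1 l2 ?_
    have hqt' : q < t' := lt_of_le_of_lt hqt ht'
    obtain ⟨m, hm1, hm2⟩ := exists_between hpq
    filter_upwards [hR, hL, hu.1, hv.1, hv.2 (Iio_mem_nhds hqt'), hu.2 (Iio_mem_nhds hm1),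
      hv.2 (Ioi_mem_nhds hm2)] with i hRi hLi hui hvi hvt h1 h2
    exact hLi _ hui _ hvi (le_of_lt (lt_trans h1 h2)) fun r hr =>
      hRi r ((h.ord i).out hui hvi hr) (hr.2.trans (le_of_lt hvt))
  refine ⟨⟨M, hM⟩, LipschitzOnWith.of_dist_le_mul fun p hp q hq => ?_⟩
  rcases lt_trichotomy p q with hlt | rfl | hlt
  · rw [dist_comm, dist_eq_norm, dist_comm, Real.dist_eq, abs_of_pos (sub_pos.2 hlt)]
    exact key p hp q hq hlt
  · simp
  · rw [dist_eq_norm, Real.dist_eq, abs_of_pos (sub_pos.2 hlt)]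
    exact key q hq p hp hlt

/-- A second limit time guarantees that the approximating times eventually lie on a proper flow
interval, where states belong to `C`; on a level reduced to one point this can fail. -/
theorem limitFun_mem (h : d.IsFlowSeq 𝓤 T I ε θ τ₁ τ₂) (ho : d.IsOscillating T₁ T₂ S f')
    (hb : d.BasicRegularity) (hnt : (limitSet 𝓤 I θ).Nontrivial) {q : ℝ}
    (hq : q ∈ limitSet 𝓤 I θ) : limitFun 𝓤 I θ q ∈ d.C := by
  obtain ⟨t, ht, hne⟩ := hnt.exists_ne q
  obtain ⟨u, hu⟩ := hq.1
  obtain ⟨v, hv⟩ := ht.1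
  refine hb.closed_C.mem_of_tendsto (h.tendsto_limitFun ho hb hq hu) ?_
  rcases hne.lt_or_gt with hlt | hlt
  · obtain ⟨m, hm1, hm2⟩ := exists_between hlt
    filter_upwards [hu.1, hv.1, hv.2 (Iio_mem_nhds hm1), hu.2 (Ioi_mem_nhds hm2)] with i a b c e
    exact (h.flow i _ b _ a (lt_trans c e)).mem _ ⟨le_of_lt (lt_trans c e), le_rfl⟩
  · obtain ⟨m, hm1, hm2⟩ := exists_between hlt
    filter_upwards [hu.1, hv.1, hu.2 (Iio_mem_nhds hm1), hv.2 (Ioi_mem_nhds hm2)] with i a b c e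
    exact (h.flow i _ a _ b (lt_trans c e)).mem _ ⟨le_rfl, le_of_lt (lt_trans c e)⟩

/-- Near an interior time `s` the flows stay close to the limit at time `s`. -/
theorem exists_flow_near (h : d.IsFlowSeq 𝓤 T I ε θ τ₁ τ₂) (ho : d.IsOscillating T₁ T₂ S f')
    (hb : d.BasicRegularity) {s : ℝ} (hs : s ∈ interior (limitSet 𝓤 I θ)) {r : ℝ} (hr : 0 < r) :
    ∃ h₀ > 0, Icc (s - h₀) (s + h₀) ⊆ interior (limitSet 𝓤 I θ) ∧ ∀ᶠ i in 𝓤,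
      d.IsFlow (ε i) (θ i) (τ₁ i) (τ₂ i) (s - h₀) (s + h₀) ∧
      ∀ t ∈ Icc (s - h₀) (s + h₀), θ i t ∈ Metric.ball (limitFun 𝓤 I θ s) r := by
  obtain ⟨δ, hδ, hsub⟩ := Metric.isOpen_iff.1 isOpen_interior s hs
  have hin : ∀ q, |q - s| < δ → q ∈ interior (limitSet 𝓤 I θ) := fun q hq => hsub (by
    rwa [Metric.mem_ball, Real.dist_eq])
  have hinI : ∀ q, |q - s| < δ / 2 → ∀ᶠ i in 𝓤, q ∈ I i := fun q hq => by
    rw [abs_lt] at hq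
    refine h.eventually_mem (interior_subset (hin (s - δ / 2) ?_))
      (interior_subset (hin (s + δ / 2) ?_)) (by linarith) (by linarith)
    · rw [abs_lt]; constructor <;> linarith
    · rw [abs_lt]; constructor <;> linarith
  obtain ⟨R, t', ht', hR⟩ := (interior_subset (hin (s + δ / 2) (by
    rw [abs_lt]; constructor <;> linarith))).2
  obtain ⟨M, hM, B, hB, hL⟩ := h.exists_equiLipschitz ho hb R
  -- The first bound keeps the interval in the interior of the limit set, the second limits the
  -- movement around time `s` to `r / 4 + B * ε`.
  set h₀ := min (δ / 4) (r / (4 * (M + 1)))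
  have hh₀ : 0 < h₀ := by positivity
  have h1 : h₀ ≤ δ / 4 := min_le_left _ _
  have hMh : M * h₀ ≤ r / 4 := by
    calc M * h₀ ≤ (M + 1) * (r / (4 * (M + 1))) := by gcongr; exacts [by linarith, min_le_right _ _]
      _ = r / 4 := by field_simp
  have hBε : ∀ᶠ i in 𝓤, B * ε i < r / 4 := by
    have : Tendsto (fun i => B * ε i) 𝓤 (𝓝 0) := by simpa using h.tendsto.const_mul B
    exact this (Iio_mem_nhds (by positivity))
  have hsI := hinI s (by simpa using half_pos hδ)
  have hts := h.tendsto_limitFun ho hb (interior_subset hs) (u := fun _ => s)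
    ⟨hsI, tendsto_const_nhds⟩
  refine ⟨h₀, hh₀, fun q hq => hin q ?_, ?_⟩
  · rw [abs_lt]; constructor <;> linarith [hq.1, hq.2]
  filter_upwards [hR, hL, hBε, hsI, hinI (s - h₀) (by rw [abs_lt]; constructor <;> linarith),
    hinI (s + h₀) (by rw [abs_lt]; constructor <;> linarith),
    hts (Metric.ball_mem_nhds _ (by positivity : 0 < r / 4))] with i hRi hLi hBi hsi hli hri hci
  refine ⟨h.flow i _ hli _ hri (by linarith), fun t ht => ?_⟩
  have hti := (h.ord i).out hli hri ht
  have hbound : ‖θ i t - θ i s‖ ≤ M * h₀ + B * ε i := by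
    rcases le_total s t with hst | hst
    · refine (hLi s hsi t hti hst fun q hq => hRi q ((h.ord i).out hsi hti hq)
        (by linarith [hq.2, ht.2])).trans ?_
      gcongr
      linarith [ht.2]
    · rw [norm_sub_rev]
      refine (hLi t hti s hsi hst fun q hq => hRi q ((h.ord i).out hti hsi hq)
        (by linarith [hq.2])).trans ?_
      gcongr
      linarith [ht.1]
  have hci' : dist (θ i s) (limitFun 𝓤 I θ s) < r / 4 := hci
  rw [Metric.mem_ball]
  rw [← dist_eq_norm] at hbound
  linarith [dist_triangle (θ i t) (θ i s) (limitFun 𝓤 I θ s)]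

theorem interior_nontrivial {s : ℝ} {L : Set ℝ} (hs : s ∈ interior L) : L.Nontrivial := by
  obtain ⟨δ, hδ, hsub⟩ := Metric.isOpen_iff.1 isOpen_interior s hs
  refine ⟨s, interior_subset hs, s + δ / 2, interior_subset (hsub ?_), by linarith⟩
  rw [Metric.mem_ball, Real.dist_eq, add_sub_cancel_left, abs_of_pos (half_pos hδ)]
  linarith

theorem tendsto_of_mem_interior (h : d.IsFlowSeq 𝓤 T I ε θ τ₁ τ₂)
    (ho : d.IsOscillating T₁ T₂ S f') (hb : d.BasicRegularity) {t : ℝ}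
    (ht : t ∈ interior (limitSet 𝓤 I θ)) :
    Tendsto (fun i => θ i t) 𝓤 (𝓝 (limitFun 𝓤 I θ t)) := by
  obtain ⟨δ, hδ, hsub⟩ := Metric.isOpen_iff.1 isOpen_interior t ht
  refine h.tendsto_limitFun ho hb (interior_subset ht) (u := fun _ => t) ⟨?_, tendsto_const_nhds⟩
  refine h.eventually_mem (s := t - δ / 2) (t := t + δ / 2) (interior_subset (hsub ?_))
    (interior_subset (hsub ?_)) (by linarith) (by linarith)
  · rw [Metric.mem_ball, Real.dist_eq, abs_lt]; constructor <;> linarith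
  · rw [Metric.mem_ball, Real.dist_eq, abs_lt]; constructor <;> linarith

/-- For every `η`, local averaging around the limit state applies near `s`. Its term `B * ε`
vanishes in the limit, which leaves the definition of the derivative. -/
theorem hasDerivAt_fst (h : d.IsFlowSeq 𝓤 T I ε θ τ₁ τ₂) (ho : d.IsOscillating T₁ T₂ S f')
    (hb : d.BasicRegularity) {s : ℝ} (hs : s ∈ interior (limitSet 𝓤 I θ)) :
    HasDerivAt (fun t => (limitFun 𝓤 I θ t).fst) (d.fbar T₁ T₂ (limitFun 𝓤 I θ s)) s := by
  set p := limitFun 𝓤 I θ s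
  have hp : p ∈ d.C := h.limitFun_mem ho hb (interior_nontrivial hs) (interior_subset hs)
  rw [hasDerivAt_iff_isLittleO, Asymptotics.isLittleO_iff]
  intro η hη
  obtain ⟨r, hr, B, hB, ε₀, hε₀, hav⟩ := ho.exists_local_averaging hb hp hη
  obtain ⟨h₀, hh₀, hsub, hev⟩ := h.exists_flow_near ho hb hs hr
  have key : ∀ a ∈ Icc (s - h₀) (s + h₀), ∀ b ∈ Icc (s - h₀) (s + h₀), a ≤ b →
      ‖(limitFun 𝓤 I θ b).fst - (limitFun 𝓤 I θ a).fst - (b - a) • d.fbar T₁ T₂ p‖ ≤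
        η * (b - a) := by
    intro a ha b hb' hab
    have cfst : Continuous fun w : State n₁ n₂ => w.fst := WithLp.continuous_fst _ _ _
    have l1 := ((((cfst.tendsto _).comp (h.tendsto_of_mem_interior ho hb (hsub hb'))).sub
      ((cfst.tendsto _).comp (h.tendsto_of_mem_interior ho hb (hsub ha)))).sub_const
      ((b - a) • d.fbar T₁ T₂ p)).norm
    have l2 : Tendsto (fun i => η * (b - a) + B * ε i) 𝓤 (𝓝 (η * (b - a))) := by
      simpa using (h.tendsto.const_mul B).const_add (η * (b - a))
    refine le_of_tendsto_of_tendsto l1 l2 ?_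
    filter_upwards [hev, h.eventually_mem_Ioo hε₀] with i hi hεi
    exact hav (ε i) hεi (θ i) (τ₁ i) (τ₂ i) a b hab (hi.1.mono ha.1 hb'.2)
      fun t ht => hi.2 t ⟨ha.1.trans ht.1, ht.2.trans hb'.2⟩
  have hs' : s ∈ Icc (s - h₀) (s + h₀) := ⟨by linarith, by linarith⟩
  filter_upwards [Icc_mem_nhds (by linarith : s - h₀ < s) (by linarith : s < s + h₀)] with t ht
  rcases le_total s t with hst | hst
  · rw [Real.norm_of_nonneg (sub_nonneg.2 hst)]
    exact key s hs' t ht hst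
  · rw [Real.norm_eq_abs, abs_sub_comm, abs_of_nonneg (sub_nonneg.2 hst), ← norm_neg]
    refine le_trans (le_of_eq ?_) (key t ht s hs' hst)
    congr 1
    module

theorem deriv_snd_mem (h : d.IsFlowSeq 𝓤 T I ε θ τ₁ τ₂) (ho : d.IsOscillating T₁ T₂ S f')
    (hb : d.BasicRegularity) {s : ℝ} (hs : s ∈ interior (limitSet 𝓤 I θ))
    {v : EuclideanSpace ℝ (Fin n₂)} (hv : HasDerivAt (fun t => (limitFun 𝓤 I θ t).snd) v s) :
    v ∈ d.Φ (limitFun 𝓤 I θ s).snd := by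
  set p := limitFun 𝓤 I θ s
  have hp : p ∈ d.C := h.limitFun_mem ho hb (interior_nontrivial hs) (interior_subset hs)
  by_contra hcon
  have hclosed : IsClosed (d.Φ p.snd) := by
    rw [← isSeqClosed_iff_isClosed]
    intro w w₀ hw hw₀
    exact hb.osc_Φ (fun _ => p) w p w₀ (fun _ => hp) hp hw tendsto_const_nhds hw₀
  -- The separating half space contains `Φ` at nearby states, so it bounds the increments of the
  -- flows and hence the right slope of the limit, contradicting `c < l v`.
  obtain ⟨l, c, hlt, hcv⟩ := geometric_hahn_banach_closed_point (hb.convex_Φ p hp) hclosed hcon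
  obtain ⟨r, hr, hsup⟩ := hb.exists_support hp l hlt
  obtain ⟨h₀, hh₀, hsub, hev⟩ := h.exists_flow_near ho hb hs hr
  have csnd : Continuous fun w : State n₁ n₂ => w.snd := WithLp.continuous_snd _ _ _
  have key : ∀ b ∈ Ioo s (s + h₀), l ((limitFun 𝓤 I θ b).snd - p.snd) ≤ c * (b - s) := by
    intro b hb'
    have hbI : b ∈ Icc (s - h₀) (s + h₀) := ⟨by linarith [hb'.1], hb'.2.le⟩
    have hsI : s ∈ Icc (s - h₀) (s + h₀) := ⟨by linarith, by linarith⟩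
    have l1 := (l.continuous.tendsto _).comp
      (((csnd.tendsto _).comp (h.tendsto_of_mem_interior ho hb (hsub hbI))).sub
      ((csnd.tendsto _).comp (h.tendsto_of_mem_interior ho hb hs)))
    refine le_of_tendsto l1 ?_
    filter_upwards [hev] with i hi
    refine hi.1.snd_le s hsI b hbI hb'.1.le l c fun q hq w hw =>
      hsup _ ⟨hi.2 q ?_, hi.1.mem q ?_⟩ w hw
    · exact ⟨by linarith [hq.1], hq.2.trans hb'.2.le⟩
    · exact ⟨by linarith [hq.1], hq.2.trans hb'.2.le⟩
  have hder : HasDerivAt (fun t => l (limitFun 𝓤 I θ t).snd) (l v) s :=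
    l.hasFDerivAt.comp_hasDerivAt s hv
  have hslope := (hasDerivWithinAt_iff_tendsto_slope' (self_notMem_Ioi)).1
    (hder.hasDerivWithinAt (s := Ioi s))
  have hle : l v ≤ c := by
    refine le_of_tendsto hslope ?_
    filter_upwards [Ioo_mem_nhdsGT (by linarith : s < s + h₀)] with b hb'
    rw [slope_def_field, div_le_iff₀ (by linarith [hb'.1]), ← map_sub]
    exact key b hb'
  exact absurd hcv (not_lt.2 hle)

theorem continuousSMul_of_normedSpace (E : Type*) [NormedAddCommGroup E] [NormedSpace ℝ E] :
    ContinuousSMul ℝ E :=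
  inferInstance

/-- The default instance search does not find this in reasonable time. -/
instance instContinuousSMulState : ContinuousSMul ℝ (State n₁ n₂) :=
  continuousSMul_of_normedSpace _

theorem hasDerivAt_state {y : ℝ → State n₁ n₂} {x' : EuclideanSpace ℝ (Fin n₁)}
    {z' : EuclideanSpace ℝ (Fin n₂)} {s : ℝ} (hx : HasDerivAt (fun t => (y t).fst) x' s)
    (hz : HasDerivAt (fun t => (y t).snd) z' s) : HasDerivAt y (mkState x' z') s := by
  exact (WithLp.prodContinuousLinearEquiv 2 ℝ (EuclideanSpace ℝ (Fin n₁))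
    (EuclideanSpace ℝ (Fin n₂))).symm.hasFDerivAt.comp_hasDerivAt s (hx.prodMk hz)

theorem lipschitzWith_snd :
    LipschitzWith 1 (WithLp.snd : State n₁ n₂ → EuclideanSpace ℝ (Fin n₂)) := by
  refine LipschitzWith.of_dist_le_mul fun w v => ?_
  rw [dist_eq_norm, dist_eq_norm, NNReal.coe_one, one_mul]
  exact norm_snd_sub_le w v

/-- The ultralimit solves the averaged differential inclusion almost everywhere. -/
theorem ae_hasDerivAt (h : d.IsFlowSeq 𝓤 T I ε θ τ₁ τ₂) (ho : d.IsOscillating T₁ T₂ S f')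
    (hb : d.BasicRegularity) :
    ∀ᵐ t : ℝ, t ∈ limitSet 𝓤 I θ →
      ∃ v ∈ (d.average T₁ T₂).F (limitFun 𝓤 I θ t), HasDerivAt (limitFun 𝓤 I θ) v t := by
  -- Only the `z`-component needs almost everywhere differentiability of Lipschitz functions; the
  -- `x`-component is differentiable at every interior time.
  have hbv : LocallyBoundedVariationOn (fun t => (limitFun 𝓤 I θ t).snd) (limitSet 𝓤 I θ) := by
    intro a b ha hb'
    obtain ⟨K, hK⟩ := h.exists_lipschitzOnWith ho hb hb'
    rcases le_or_gt a b with hab | hab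
    · have hbv := (lipschitzWith_snd.comp_lipschitzOnWith hK).locallyBoundedVariationOn a b
        ⟨ha, hab⟩ ⟨hb', mem_Iic.2 le_rfl⟩
      exact hbv.mono fun t ht => ⟨⟨ht.1, ht.2.2⟩, ht.2⟩
    · rw [Icc_eq_empty hab.not_ge, inter_empty]
      rw [BoundedVariationOn, eVariationOn.subsingleton _ subsingleton_empty]
      exact ENNReal.zero_ne_top
  have hnull : ∀ᵐ t : ℝ, t ∉ frontier (limitSet 𝓤 I θ) :=
    measure_eq_zero_iff_ae_notMem.1 (h.ordConnected.convex.addHaar_frontier volume)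
  filter_upwards [hbv.ae_differentiableWithinAt_of_mem, hnull] with t ht hfr htL
  have hint : t ∈ interior (limitSet 𝓤 I θ) := by
    by_contra hcon
    exact hfr ⟨subset_closure htL, hcon⟩
  have hdiff := (ht htL).differentiableAt (mem_interior_iff_mem_nhds.1 hint)
  exact ⟨mkState _ _, ⟨rfl, h.deriv_snd_mem ho hb hint hdiff.hasDerivAt⟩,
    hasDerivAt_state (h.hasDerivAt_fst ho hb hint) hdiff.hasDerivAt⟩

end IsFlowSeq

end Data

/-! ### Structure of hybrid time domains -/

/-- The level sets `L j` of a hybrid time domain, with least elements `b j`. -/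
structure IsLevelFamily (L : ℕ → Set ℝ) (b : ℕ → ℝ) : Prop where
  ord : ∀ j, (L j).OrdConnected
  zero : b 0 = 0
  least : ∀ j, (L j).Nonempty → IsLeast (L j) (b j)
  step : ∀ j k, j < k → (L k).Nonempty → b (j + 1) ∈ L j ∧ b (j + 1) ∈ L (j + 1)
  branch : ∀ j k, j < k → ∀ s ∈ L j, ∀ t ∈ L k, s ≤ b (j + 1) ∨ t = b (j + 1)

namespace IsLevelFamily

variable {L L' : ℕ → Set ℝ} {b : ℕ → ℝ}

theorem nonempty_of_le (h : IsLevelFamily L b) {j k : ℕ} (hjk : j ≤ k) (hk : (L k).Nonempty) :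
    (L j).Nonempty := by
  rcases hjk.eq_or_lt with rfl | hlt
  · exact hk
  · exact ⟨_, (h.step j k hlt hk).1⟩

theorem start_le_succ (h : IsLevelFamily L b) {j k : ℕ} (hjk : j < k) (hk : (L k).Nonempty) :
    b j ≤ b (j + 1) :=
  (h.least j (h.nonempty_of_le hjk.le hk)).2 (h.step j k hjk hk).1

theorem start_le_start (h : IsLevelFamily L b) {j k : ℕ} (hjk : j ≤ k) (hk : (L k).Nonempty) :
    b j ≤ b k := by
  induction k, hjk using Nat.le_induction with
  | base => exact le_rfl
  | succ m hm ih =>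
    exact (ih (h.nonempty_of_le m.le_succ hk)).trans (h.start_le_succ m.lt_succ_self hk)

theorem start_nonneg (h : IsLevelFamily L b) {k : ℕ} (hk : (L k).Nonempty) : 0 ≤ b k := by
  rw [← h.zero]
  exact h.start_le_start k.zero_le hk

theorem eq_start (h : IsLevelFamily L b) {j : ℕ} {t : ℝ} (ht : t ∈ L j) (ht' : t ∈ L (j + 1)) :
    t = b (j + 1) := by
  rcases h.branch j (j + 1) j.lt_succ_self t ht t ht' with hle | heq
  · exact le_antisymm hle ((h.least _ ⟨t, ht'⟩).2 ht')
  · exact heq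

/-- Truncation of a family of levels. -/
theorem truncate (h : IsLevelFamily L b) (hsub : ∀ j, L' j ⊆ L j)
    (hlow : ∀ j k, j ≤ k → ∀ s ∈ L j, ∀ t ∈ L' k, s ≤ t → s ∈ L' j) : IsLevelFamily L' b := by
  have hleast : ∀ j, (L' j).Nonempty → IsLeast (L' j) (b j) := fun j ⟨t, ht⟩ => by
    have hl := h.least j ⟨t, hsub j ht⟩
    exact ⟨hlow j j le_rfl _ hl.1 t ht (hl.2 (hsub j ht)), fun s hs => hl.2 (hsub j hs)⟩
  refine ⟨fun j => ⟨fun s hs t ht q hq => ?_⟩, h.zero, hleast, fun j k hjk hk => ?_,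
    fun j k hjk s hs t ht => h.branch j k hjk s (hsub j hs) t (hsub k ht)⟩
  · exact hlow j j le_rfl q ((h.ord j).out (hsub j hs) (hsub j ht) hq) t ht hq.2
  · obtain ⟨t, ht⟩ := hk
    have hne : (L k).Nonempty := ⟨t, hsub k ht⟩
    have hle : b (j + 1) ≤ t := (h.start_le_start hjk hne).trans ((h.least k hne).2 (hsub k ht))
    have hst := h.step j k hjk hne
    exact ⟨hlow j k hjk.le _ hst.1 t ht hle, hlow (j + 1) k hjk _ hst.2 t ht hle⟩

theorem isHybridTimeDomain (h : IsLevelFamily L b) : IsHybridTimeDomain {p | p.1 ∈ L p.2} := by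
  rintro ⟨t, j⟩ ht
  have ht : t ∈ L j := ht
  have hne : (L j).Nonempty := ⟨t, ht⟩
  have hbt : b j ≤ t := (h.least j hne).2 ht
  -- The truncation at `(t, j)` has jump times `b 0, …, b j` and ends at `t`.
  refine ⟨(h.start_nonneg hne).trans hbt, j + 1, fun k => if k ≤ j then b k else t,
    j.succ_pos, ?_, ?_, ?_⟩
  · exact (if_pos j.zero_le).trans h.zero
  · intro k hk
    beta_reduce
    rw [if_pos (Nat.lt_succ_iff.1 hk)]
    split_ifs with hk'
    · exact h.start_le_succ hk' hne
    · have : k = j := by omega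
      rw [this]
      exact hbt
  · ext ⟨s, k⟩
    simp only [mem_inter_iff, mem_ofPred_eq, mem_prod, mem_Icc, mem_Iic]
    constructor
    · rintro ⟨hs, ⟨-, hst⟩, hk⟩
      refine ⟨Nat.lt_succ_iff.2 hk, ?_, ?_⟩
      · rw [if_pos hk]
        exact (h.least k ⟨s, hs⟩).2 hs
      · split_ifs with hk'
        · rcases h.branch k j hk' s hs t ht with hle | heq
          · exact hle
          · exact heq ▸ hst
        · exact hst
    · rintro ⟨hk, h1, h2⟩
      have hk := Nat.lt_succ_iff.1 hk
      have hkne := h.nonempty_of_le hk hne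
      rw [if_pos hk] at h1
      refine ⟨?_, ⟨(h.start_nonneg hkne).trans h1, ?_⟩, hk⟩
      · split_ifs at h2 with hk'
        · exact (h.ord k).out (h.least k hkne).1 (h.step k j hk' hne).1 ⟨h1, h2⟩
        · have : k = j := by omega
          subst this
          exact (h.ord k).out (h.least k hkne).1 ht ⟨h1, h2⟩
      · split_ifs at h2 with hk'
        · exact h2.trans ((h.start_le_start hk' hne).trans hbt)
        · exact h2

end IsLevelFamily

namespace IsHybridTimeDomain

variable {E : Set (ℝ × ℕ)}

theorem exists_jumpTimes (hE : IsHybridTimeDomain E) {t : ℝ} {j : ℕ} (h : (t, j) ∈ E) :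
    ∃ u : ℕ → ℝ, u 0 = 0 ∧ (∀ k ≤ j, u k ≤ u (k + 1)) ∧ u (j + 1) = t ∧
      ∀ s, ∀ k ≤ j, ((s, k) ∈ E ∧ s ≤ t) ↔ (u k ≤ s ∧ s ≤ u (k + 1)) := by
  obtain ⟨-, J, u, -, h0, hmono, heq⟩ := hE _ h
  have key : ∀ s k, ((s, k) ∈ E ∧ (0 ≤ s ∧ s ≤ t) ∧ k ≤ j) ↔ (k < J ∧ u k ≤ s ∧ s ≤ u (k + 1)) := by
    intro s k
    have := Set.ext_iff.1 heq (s, k)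
    simpa only [mem_inter_iff, mem_ofPred_eq, mem_prod, mem_Icc, mem_Iic] using this
  have hjt := (key t j).1 ⟨h, ⟨(hE _ h).1, le_rfl⟩, le_rfl⟩
  -- The truncation has no level above `j` and contains the point `(t, j)`, which fixes the number
  -- of levels.
  have hJ : J = j + 1 := by
    by_contra hne
    have hlt : j + 1 < J := by omega
    have := ((key (u (j + 1)) (j + 1)).2 ⟨hlt, le_rfl, hmono _ hlt⟩).2.2
    omega
  subst hJ
  refine ⟨u, h0, fun k hk => hmono k (Nat.lt_succ_iff.2 hk), ?_, fun s k hk => ?_⟩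
  · exact le_antisymm ((key (u (j + 1)) j).2 ⟨j.lt_succ_self, hmono j j.lt_succ_self, le_rfl⟩).2.1.2
      hjt.2.2
  · constructor
    · exact fun hs => ((key s k).1 ⟨hs.1, ⟨(hE _ hs.1).1, hs.2⟩, hk⟩).2
    · intro hs
      have := (key s k).2 ⟨Nat.lt_succ_iff.2 hk, hs⟩
      exact ⟨this.1, this.2.1.2⟩

/-- Truncations at different points are each compact domains but need not be nested. Level `j` may
continue beyond the start of level `j + 1`, provided that all higher levels consist of that single
time; this is the second alternative of `branch`. -/
theorem isLevelFamily (hE : IsHybridTimeDomain E) (h0 : ((0 : ℝ), 0) ∈ E) :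
    IsLevelFamily (fun j => {t | (t, j) ∈ E}) fun j => sInf {t | (t, j) ∈ E} := by
  have key : ∀ t j, (t, j) ∈ E → ∃ u : ℕ → ℝ, (∀ k ≤ j, u k ≤ u (k + 1)) ∧ u (j + 1) = t ∧
      (∀ s, ∀ k ≤ j, ((s, k) ∈ E ∧ s ≤ t) ↔ (u k ≤ s ∧ s ≤ u (k + 1))) ∧
      ∀ k ≤ j, IsLeast {t | (t, k) ∈ E} (u k) ∧ sInf {t | (t, k) ∈ E} = u k := by
    intro t j ht
    obtain ⟨u, -, hmono, hut, hiff⟩ := hE.exists_jumpTimes ht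
    refine ⟨u, hmono, hut, hiff, fun k hk => ?_⟩
    have hmem := (hiff (u k) k hk).2 ⟨le_rfl, hmono k hk⟩
    have hl : IsLeast {t | (t, k) ∈ E} (u k) := ⟨hmem.1, fun s hs => by
      rcases le_total s t with hst | hst
      · exact ((hiff s k hk).1 ⟨hs, hst⟩).1
      · exact hmem.2.trans hst⟩
    exact ⟨hl, hl.csInf_eq⟩
  refine ⟨fun j => ⟨fun s hs t ht q hq => ?_⟩, ?_, ?_, ?_, ?_⟩
  · obtain ⟨u, hmono, hut, hiff, -⟩ := key t j ht
    have h1 := (hiff s j le_rfl).1 ⟨hs, hq.1.trans hq.2⟩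
    exact ((hiff q j le_rfl).2 ⟨h1.1.trans hq.1, hut ▸ hq.2⟩).1
  · exact IsLeast.csInf_eq ⟨h0, fun s hs => (hE _ hs).1⟩
  · rintro j ⟨t, ht⟩
    obtain ⟨u, -, -, -, hl⟩ := key t j ht
    rw [(hl j le_rfl).2]
    exact (hl j le_rfl).1
  · rintro j k hjk ⟨t, ht⟩
    obtain ⟨u, hmono, -, hiff, hl⟩ := key t k ht
    rw [(hl (j + 1) hjk).2]
    exact ⟨((hiff _ j hjk.le).2 ⟨hmono j hjk.le, le_rfl⟩).1, (hl (j + 1) hjk).1.1⟩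
  · intro j k hjk s hs t ht
    obtain ⟨u, hmono, -, hiff, hl⟩ := key t k ht
    rw [(hl (j + 1) hjk).2]
    rcases le_total s t with hst | hst
    · exact Or.inl ((hiff s j hjk.le).1 ⟨hs, hst⟩).2
    · obtain ⟨v, -, hvs, hiff', hl'⟩ := key s j hs
      have h1 : u (j + 1) ≤ t :=
        ((hiff _ (j + 1) hjk).2 ⟨le_rfl, hmono _ hjk⟩).2
      have h2 : u j = v j := (hl j hjk.le).2.symm.trans (hl' j le_rfl).2
      have h3 : (t, j) ∈ E := ((hiff' t j le_rfl).2
        ⟨h2 ▸ (hmono j hjk.le).trans h1, hvs ▸ hst⟩).1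
      exact Or.inr (le_antisymm ((hiff t j hjk.le).1 ⟨h3, le_rfl⟩).2 h1)

end IsHybridTimeDomain

/-! ### Flow intervals of solutions -/

theorem hasDerivAt_clm_comp {E F : Type*} [NormedAddCommGroup E] [NormedSpace ℝ E]
    [NormedAddCommGroup F] [NormedSpace ℝ F] (l : E →L[ℝ] F) {f : ℝ → E} {v : E} {t : ℝ}
    (h : HasDerivAt f v t) : HasDerivAt (fun s => l (f s)) (l v) t :=
  l.hasFDerivAt.comp_hasDerivAt t h

namespace HybridSystem

/-- A continuous linear image of a solution along a flow interval. -/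
theorem IsSolution.flow_clm {E F : Type*} [NormedAddCommGroup E] [NormedSpace ℝ E]
    [NormedAddCommGroup F] [NormedSpace ℝ F] {H : HybridSystem E} {x : HybridFun E}
    (hx : H.IsSolution x) {j : ℕ} {s t : ℝ} (hst : s < t) (hsub : Icc s t ⊆ x.slice j)
    (l : E →L[ℝ] F) :
    AbsolutelyContinuousOnInterval (fun r => l (x.val r j)) s t ∧
    (∀ r ∈ Icc s t, x.val r j ∈ H.C) ∧
    ∀ᵐ r : ℝ, r ∈ Icc s t → ∃ v ∈ H.F (x.val r j), HasDerivAt (fun q => l (x.val q j)) (l v) r := by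
  have hint : (interior (x.slice j)).Nonempty := by
    refine (nonempty_Ioo.2 hst).mono ?_
    rw [← interior_Icc]
    exact interior_mono hsub
  obtain ⟨hC, hF⟩ := hx.2.2.2.1 j hint
  refine ⟨absolutelyContinuousOnInterval_lipschitz_comp l.lipschitz (hx.1.2 j hint s t hst.le hsub),
    fun r hr => hC r (hsub hr), ?_⟩
  filter_upwards [hF] with r hr hrst
  obtain ⟨v, hv, hd⟩ := hr (hsub hrst)
  exact ⟨v, hv, hasDerivAt_clm_comp l hd⟩

end HybridSystem

namespace Data

variable {n₁ n₂ : ℕ} {d : Data n₁ n₂} {T₁ T₂ : ℝ} {S : Set (State n₁ n₂)}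
  {f' : State n₁ n₂ → ℝ → ℝ → (EuclideanSpace ℝ (Fin n₁) × ℝ →L[ℝ] EuclideanSpace ℝ (Fin n₁))}
  {ε : ℝ}

/-- Each component is integrated through a continuous linear map. The clocks and `x` have continuous
right-hand sides, and the inclusion for `z` is tested against functionals. -/
theorem isFlow_of_isSolution (ho : d.IsOscillating T₁ T₂ S f')
    {x : HybridFun (State n₁ n₂ × ℝ × ℝ)} (hx : (d.original ε).IsSolution x) {j : ℕ} {a b : ℝ}
    (hab : a < b) (hsub : Icc a b ⊆ x.slice j) :
    d.IsFlow ε (fun t => (x.val t j).1) (fun t => (x.val t j).2.1) (fun t => (x.val t j).2.2)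
      a b := by
  have hmem : ∀ r ∈ Icc a b, x.val r j ∈ (d.original ε).C :=
    (hx.flow_clm hab hsub (ContinuousLinearMap.fst ℝ (State n₁ n₂) (ℝ × ℝ))).2.1
  have hcont : ∀ {F : Type} [NormedAddCommGroup F] [NormedSpace ℝ F]
      (l : (State n₁ n₂ × ℝ × ℝ) →L[ℝ] F), ContinuousOn (fun r => l (x.val r j)) (Icc a b) := by
    intro F _ _ l
    have := (hx.flow_clm hab hsub l).1.continuousOn
    rwa [uIcc_of_le hab.le] at this
  have hsub' : ∀ s ∈ Icc a b, ∀ t ∈ Icc a b, Icc s t ⊆ Icc a b :=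
    fun s hs t ht => Icc_subset_Icc hs.1 ht.2
  let p₁ : (State n₁ n₂ × ℝ × ℝ) →L[ℝ] State n₁ n₂ := ContinuousLinearMap.fst ℝ _ _
  let p₂ : (State n₁ n₂ × ℝ × ℝ) →L[ℝ] ℝ :=
    (ContinuousLinearMap.fst ℝ ℝ ℝ).comp (ContinuousLinearMap.snd ℝ _ _)
  let p₃ : (State n₁ n₂ × ℝ × ℝ) →L[ℝ] ℝ :=
    (ContinuousLinearMap.snd ℝ ℝ ℝ).comp (ContinuousLinearMap.snd ℝ _ _)
  have haff : ∀ (l : (State n₁ n₂ × ℝ × ℝ) →L[ℝ] ℝ) (c : ℝ),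
      (∀ q, ∀ v ∈ (d.original ε).F q, l v = c) →
      ∀ s ∈ Icc a b, ∀ t ∈ Icc a b, s ≤ t → l (x.val t j) = l (x.val s j) + c * (t - s) := by
    intro l c hl s hs t ht hst
    rcases hst.eq_or_lt with rfl | hlt
    · simp
    obtain ⟨hac, -, hd⟩ := hx.flow_clm hlt ((hsub' s hs t ht).trans hsub) l
    have := absolutelyContinuousOnInterval_sub_eq_integral hst hac
      (continuousOn_const (c := c)) (by
        filter_upwards [hd] with r hr hrst
        obtain ⟨v, hv, hdv⟩ := hr hrst
        rwa [hl _ v hv] at hdv)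
    rw [intervalIntegral.integral_const, smul_eq_mul] at this
    linarith
  refine ⟨hcont p₁, fun t ht => (hmem t ht).1, fun t ht => (hmem t ht).2.1,
    fun t ht => (hmem t ht).2.2, haff p₂ _ fun q v hv => hv.2.2.1, haff p₃ _ fun q v hv => hv.2.2.2,
    fun s hs t ht hst => ?_, fun s hs t ht hst l c hlc => ?_⟩
  · rcases hst.eq_or_lt with rfl | hlt
    · simp
    let l : (State n₁ n₂ × ℝ × ℝ) →L[ℝ] EuclideanSpace ℝ (Fin n₁) := (WithLp.fstL 2 ℝ _ _).comp p₁
    obtain ⟨hac, -, hd⟩ := hx.flow_clm hlt ((hsub' s hs t ht).trans hsub) l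
    have hc : ∀ f, LipOn S f → ContinuousOn
        (fun r => f (x.val r j).1 (x.val r j).2.1 (x.val r j).2.2) (Icc s t) := fun f hf =>
      hf.continuousOn.comp (((hcont p₁).prodMk ((hcont p₂).prodMk (hcont p₃))).mono
        (hsub' s hs t ht)) fun r hr =>
          have hr' := hmem r (hsub' s hs t ht hr)
          ⟨ho.subset hr'.1, hr'.2⟩
    exact absolutelyContinuousOnInterval_sub_eq_integral hst hac
      (((hc _ ho.lip₁).const_smul ε⁻¹).add (hc _ ho.lip₂)) (by
        filter_upwards [hd] with r hr hrst
        obtain ⟨v, hv, hdv⟩ := hr hrst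
        exact hv.1 ▸ hdv)
  · rcases hst.eq_or_lt with rfl | hlt
    · simp
    let l' : (State n₁ n₂ × ℝ × ℝ) →L[ℝ] ℝ := l.comp ((WithLp.sndL 2 ℝ _ _).comp p₁)
    obtain ⟨hac, -, hd⟩ := hx.flow_clm hlt ((hsub' s hs t ht).trans hsub) l'
    have := absolutelyContinuousOnInterval_sub_le (c := c) hst hac (by
        filter_upwards [hd] with r hr hrst
        obtain ⟨v, hv, hdv⟩ := hr hrst
        exact ⟨_, hlc r hrst _ hv.2.1, hdv⟩)
    rw [map_sub]
    exact this

end Data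

/-! ### Ultralimits of solutions -/

/-- The times of the level `j` of a hybrid function at which `t + j ≤ T`. -/
def HybridFun.truncSlice {E : Type*} (x : HybridFun E) (T : ℝ) (j : ℕ) : Set ℝ :=
  {t | t ∈ x.slice j ∧ t + (j : ℝ) ≤ T}

/-- The initial time of the level `j` of a hybrid function. -/
noncomputable def HybridFun.startTime {E : Type*} (x : HybridFun E) (j : ℕ) : ℝ :=
  sInf (x.slice j)

theorem HybridFun.isLevelFamily_truncSlice {E : Type*} {x : HybridFun E}
    (hx : IsHybridTimeDomain x.dom) (h0 : ((0 : ℝ), 0) ∈ x.dom) (T : ℝ) :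
    IsLevelFamily (x.truncSlice T) x.startTime := by
  refine (hx.isLevelFamily h0).truncate (fun j t ht => ht.1) fun j k hjk s hs t ht hst => ⟨hs, ?_⟩
  have : (j : ℝ) ≤ k := Nat.cast_le.2 hjk
  linarith [ht.2]

theorem OSCOn.isClosed_graph {E E' : Type*} [PseudoMetricSpace E] [PseudoMetricSpace E']
    {M : E → Set E'} {S : Set E} (h : OSCOn M S) (hS : IsClosed S) :
    IsClosed {q : E × E' | q.1 ∈ S ∧ q.2 ∈ M q.1} := by
  rw [← isSeqClosed_iff_isClosed]
  intro q q₀ hq hlim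
  have h1 := (continuous_fst.tendsto q₀).comp hlim
  have h2 := (continuous_snd.tendsto q₀).comp hlim
  have hS₀ : q₀.1 ∈ S := hS.mem_of_tendsto h1 (Eventually.of_forall fun i => (hq i).1)
  exact ⟨hS₀, h _ _ _ _ (fun i => (hq i).1) hS₀ (fun i => (hq i).2) h1 h2⟩

namespace Data

variable {n₁ n₂ : ℕ}

/-- Solutions of the oscillating system with `ε → 0` and with converging initial values. -/
structure IsSolutionSeq (d : Data n₁ n₂) (𝓤 : Ultrafilter ℕ) (ε : ℕ → ℝ)
    (x : ℕ → HybridFun (State n₁ n₂ × ℝ × ℝ)) (p₀ : State n₁ n₂) : Prop where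
  pos : ∀ i, 0 < ε i
  tendsto : Tendsto ε 𝓤 (𝓝 0)
  sol : ∀ i, (d.original (ε i)).IsSolution (x i)
  init : Tendsto (fun i => ((x i).val 0 0).1) 𝓤 (𝓝 p₀)

/-- The level `j` of the ultralimit of the hybrid functions `x i`. -/
def limitLevel (𝓤 : Ultrafilter ℕ) (T : ℝ) (x : ℕ → HybridFun (State n₁ n₂ × ℝ × ℝ)) (j : ℕ) :
    Set ℝ :=
  limitSet 𝓤 (fun i => (x i).truncSlice T j) fun i t => ((x i).val t j).1

/-- The values of the ultralimit of the hybrid functions `x i`. -/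
noncomputable def limitVal (𝓤 : Ultrafilter ℕ) (T : ℝ)
    (x : ℕ → HybridFun (State n₁ n₂ × ℝ × ℝ)) (t : ℝ) (j : ℕ) : State n₁ n₂ :=
  limitFun 𝓤 (fun i => (x i).truncSlice T j) (fun i t => ((x i).val t j).1) t

/-- The levels `0, …, N` of the ultralimit of the hybrid functions `x i`. -/
noncomputable def limitArc (𝓤 : Ultrafilter ℕ) (T : ℝ)
    (x : ℕ → HybridFun (State n₁ n₂ × ℝ × ℝ)) (N : ℕ) : HybridFun (State n₁ n₂) where
  dom := {p | p.2 ≤ N ∧ p.1 ∈ limitLevel 𝓤 T x p.2}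
  val := limitVal 𝓤 T x

/-- The limit of the initial times of the level `j`. -/
noncomputable def limitStart (𝓤 : Ultrafilter ℕ) (x : ℕ → HybridFun (State n₁ n₂ × ℝ × ℝ))
    (j : ℕ) : ℝ :=
  limUnder (𝓤 : Filter ℕ) fun i => (x i).startTime j

/-- The hybrid functions `x i` are uniformly bounded on the level `j`. -/
def IsBddLevel (𝓤 : Ultrafilter ℕ) (T : ℝ) (x : ℕ → HybridFun (State n₁ n₂ × ℝ × ℝ)) (j : ℕ) :
    Prop :=
  ∃ R : ℝ, ∀ᶠ i in 𝓤, ∀ t ∈ (x i).truncSlice T j, ‖((x i).val t j).1‖ ≤ R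

namespace IsSolutionSeq

variable {d : Data n₁ n₂} {T₁ T₂ : ℝ} {S : Set (State n₁ n₂)}
  {f' : State n₁ n₂ → ℝ → ℝ → (EuclideanSpace ℝ (Fin n₁) × ℝ →L[ℝ] EuclideanSpace ℝ (Fin n₁))}
  {𝓤 : Ultrafilter ℕ} {T : ℝ} {ε : ℕ → ℝ} {x : ℕ → HybridFun (State n₁ n₂ × ℝ × ℝ)}
  {p₀ : State n₁ n₂}

theorem isLevelFamily (h : d.IsSolutionSeq 𝓤 ε x p₀) (T : ℝ) (i : ℕ) :
    IsLevelFamily ((x i).truncSlice T) (x i).startTime :=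
  HybridFun.isLevelFamily_truncSlice (h.sol i).1.1 (h.sol i).2.1 T

theorem isFlowSeq (h : d.IsSolutionSeq 𝓤 ε x p₀) (ho : d.IsOscillating T₁ T₂ S f') (T : ℝ)
    (j : ℕ) :
    d.IsFlowSeq 𝓤 T (fun i => (x i).truncSlice T j) ε (fun i t => ((x i).val t j).1)
      (fun i t => ((x i).val t j).2.1) fun i t => ((x i).val t j).2.2 := by
  refine ⟨fun i => (h.isLevelFamily T i).ord j, fun i t ht => ⟨((h.sol i).1.1 _ ht.1).1, ?_⟩, h.pos,
    h.tendsto, fun i s hs t ht hst => ?_⟩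
  · have : (0 : ℝ) ≤ j := j.cast_nonneg
    linarith [ht.2]
  · exact isFlow_of_isSolution ho (h.sol i) hst fun q hq =>
      (((h.isLevelFamily T i).ord j).out hs ht hq).1

theorem startTime_zero (h : d.IsSolutionSeq 𝓤 ε x p₀) (i : ℕ) : (x i).startTime 0 = 0 :=
  (h.isLevelFamily 0 i).zero

theorem limitStart_zero (h : d.IsSolutionSeq 𝓤 ε x p₀) : limitStart 𝓤 x 0 = 0 := by
  refine Tendsto.limUnder_eq ?_
  simp only [h.startTime_zero]
  exact tendsto_const_nhds

theorem eventually_nonempty {j : ℕ} (hne : (limitLevel 𝓤 T x j).Nonempty) :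
    ∀ᶠ i in 𝓤, ((x i).truncSlice T j).Nonempty := by
  obtain ⟨t, ⟨u, hu⟩, -⟩ := hne
  exact hu.1.mono fun i hi => ⟨_, hi⟩

theorem tendsto_startTime (h : d.IsSolutionSeq 𝓤 ε x p₀) (ho : d.IsOscillating T₁ T₂ S f') {j : ℕ}
    (hne : ∀ᶠ i in 𝓤, ((x i).truncSlice T j).Nonempty) :
    Tendsto (fun i => (x i).startTime j) 𝓤 (𝓝 (limitStart 𝓤 x j)) := by
  obtain ⟨b, -, hb⟩ := exists_tendsto_of_isCompact (𝓤 := 𝓤) (isCompact_Icc (a := (0 : ℝ)) (b := T))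
    (u := fun i => (x i).startTime j) (by
      filter_upwards [hne] with i hi
      exact (h.isFlowSeq ho T j).sub i ((h.isLevelFamily T i).least j hi).1)
  rw [limitStart, hb.limUnder_eq]
  exact hb

theorem isApprox_startTime (h : d.IsSolutionSeq 𝓤 ε x p₀) (ho : d.IsOscillating T₁ T₂ S f') {j : ℕ}
    (hne : ∀ᶠ i in 𝓤, ((x i).truncSlice T j).Nonempty) :
    IsApprox 𝓤 (fun i => (x i).truncSlice T j) (limitStart 𝓤 x j) fun i => (x i).startTime j :=
  ⟨hne.mono fun i hi => ((h.isLevelFamily T i).least j hi).1, h.tendsto_startTime ho hne⟩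

theorem isApprox_startTime_succ (h : d.IsSolutionSeq 𝓤 ε x p₀) (ho : d.IsOscillating T₁ T₂ S f')
    {j : ℕ} (hne : ∀ᶠ i in 𝓤, ((x i).truncSlice T (j + 1)).Nonempty) :
    IsApprox 𝓤 (fun i => (x i).truncSlice T j) (limitStart 𝓤 x (j + 1))
      fun i => (x i).startTime (j + 1) :=
  ⟨hne.mono fun i hi => ((h.isLevelFamily T i).step j (j + 1) j.lt_succ_self hi).1,
    h.tendsto_startTime ho hne⟩

theorem jump_mem (h : d.IsSolutionSeq 𝓤 ε x p₀) {i j : ℕ}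
    (hne : ((x i).truncSlice T (j + 1)).Nonempty) :
    ((x i).val ((x i).startTime (j + 1)) j).1 ∈ d.D ∧
      ((x i).val ((x i).startTime (j + 1)) (j + 1)).1 ∈
        d.G ((x i).val ((x i).startTime (j + 1)) j).1 := by
  have hst := (h.isLevelFamily T i).step j (j + 1) j.lt_succ_self hne
  have := (h.sol i).2.2.2.2 _ j hst.1.1 hst.2.1
  exact ⟨this.1.1, this.2.1⟩

/-- The initial values of a level are bounded if the previous level is. -/
theorem exists_bound_start (h : d.IsSolutionSeq 𝓤 ε x p₀) (ho : d.IsOscillating T₁ T₂ S f')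
    (hb : d.BasicRegularity) {j : ℕ} (hB : ∀ k < j, IsBddLevel 𝓤 T x k)
    (hne : ∀ᶠ i in 𝓤, ((x i).truncSlice T j).Nonempty) :
    ∃ R : ℝ, ∀ᶠ i in 𝓤, ‖((x i).val ((x i).startTime j) j).1‖ ≤ R := by
  cases j with
  | zero =>
    refine ⟨‖p₀‖ + 1, ?_⟩
    filter_upwards [h.init.norm (Iio_mem_nhds (by linarith : ‖p₀‖ < ‖p₀‖ + 1))] with i hi
    rw [h.startTime_zero]
    exact le_of_lt hi
  | succ j =>
    obtain ⟨R, hR⟩ := hB j j.lt_succ_self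
    obtain ⟨p, -, hp⟩ := exists_tendsto_of_isCompact (𝓤 := 𝓤)
      (isCompact_closedBall (0 : State n₁ n₂) R)
      (u := fun i => ((x i).val ((x i).startTime (j + 1)) j).1) (by
        filter_upwards [hR, (h.isApprox_startTime_succ ho hne).1] with i h1 h2
        simpa using h1 _ h2)
    have hpD : p ∈ d.D := hb.closed_D.mem_of_tendsto hp (hne.mono fun i hi => (h.jump_mem hi).1)
    obtain ⟨N, hN, B, hNB⟩ := hb.locBdd_G p hpD
    refine ⟨B, ?_⟩
    filter_upwards [hne, hp hN] with i hi hiN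
    exact hNB _ ⟨hiN, (h.jump_mem hi).1⟩ _ (h.jump_mem hi).2

theorem limitStart_mem (h : d.IsSolutionSeq 𝓤 ε x p₀) (ho : d.IsOscillating T₁ T₂ S f')
    (hb : d.BasicRegularity) {j : ℕ} (hB : ∀ k < j, IsBddLevel 𝓤 T x k)
    (hne : ∀ᶠ i in 𝓤, ((x i).truncSlice T j).Nonempty) :
    limitStart 𝓤 x j ∈ limitLevel 𝓤 T x j := by
  obtain ⟨R, hR⟩ := h.exists_bound_start ho hb hB hne
  refine (h.isFlowSeq ho T j).mem_limitSet ho hb (h.isApprox_startTime ho hne) (R := R) ?_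
  filter_upwards [hR, hne] with i hi hnei q hq hqle
  have : q = (x i).startTime j := le_antisymm hqle (((h.isLevelFamily T i).least j hnei).2 hq)
  rw [this]
  exact hi

/-- If a level is bounded, then all limits of its times belong to the limit level. -/
theorem mem_limitLevel (h : d.IsSolutionSeq 𝓤 ε x p₀) (ho : d.IsOscillating T₁ T₂ S f')
    (hb : d.BasicRegularity) {j : ℕ} (hB : IsBddLevel 𝓤 T x j) {t : ℝ} {u : ℕ → ℝ}
    (hu : IsApprox 𝓤 (fun i => (x i).truncSlice T j) t u) : t ∈ limitLevel 𝓤 T x j := by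
  obtain ⟨R, hR⟩ := hB
  exact (h.isFlowSeq ho T j).mem_limitSet ho hb hu (hR.mono fun i hi q hq _ => hi q hq)

/-- The order relations between the levels pass to the limit, and the ultrafilter decides which
alternative of `branch` holds. Boundedness is needed only below level `N`, where the jump times must
survive in the limit; level `N` may escape. -/
theorem isLevelFamily_limit (h : d.IsSolutionSeq 𝓤 ε x p₀) (ho : d.IsOscillating T₁ T₂ S f')
    (hb : d.BasicRegularity) {N : ℕ} (hB : ∀ k < N, IsBddLevel 𝓤 T x k) :
    IsLevelFamily (fun j => {t | j ≤ N ∧ t ∈ limitLevel 𝓤 T x j}) (limitStart 𝓤 x) := by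
  refine ⟨fun j => ⟨fun s hs t ht q hq =>
    ⟨hs.1, (h.isFlowSeq ho T j).ordConnected.out hs.2 ht.2 hq⟩⟩, h.limitStart_zero, ?_, ?_, ?_⟩
  · rintro j ⟨t, hjN, ht⟩
    have hne := eventually_nonempty ⟨t, ht⟩
    refine ⟨⟨hjN, h.limitStart_mem ho hb (fun k hk => hB k (hk.trans_le hjN)) hne⟩, ?_⟩
    rintro s ⟨-, ⟨u, hu⟩, -⟩
    refine le_of_tendsto_of_tendsto (h.tendsto_startTime ho hne) hu.2 ?_
    filter_upwards [hu.1] with i hi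
    exact ((h.isLevelFamily T i).least j ⟨_, hi⟩).2 hi
  · rintro j k hjk ⟨t, hkN, ht⟩
    have hne : ∀ᶠ i in 𝓤, ((x i).truncSlice T (j + 1)).Nonempty :=
      (eventually_nonempty ⟨t, ht⟩).mono fun i hi => (h.isLevelFamily T i).nonempty_of_le hjk hi
    exact ⟨⟨hjk.le.trans hkN, h.mem_limitLevel ho hb (hB j (hjk.trans_le hkN))
      (h.isApprox_startTime_succ ho hne)⟩, hjk.trans_le hkN,
      h.limitStart_mem ho hb (fun m hm => hB m (by omega)) hne⟩
  · rintro j k hjk s ⟨-, ⟨u, hu⟩, -⟩ t ⟨-, ⟨v, hv⟩, -⟩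
    have hne : ∀ᶠ i in 𝓤, ((x i).truncSlice T (j + 1)).Nonempty :=
      hv.1.mono fun i hi => (h.isLevelFamily T i).nonempty_of_le hjk ⟨_, hi⟩
    have hst := h.tendsto_startTime ho hne
    have hor : ∀ᶠ i in 𝓤, u i ≤ (x i).startTime (j + 1) ∨ v i = (x i).startTime (j + 1) := by
      filter_upwards [hu.1, hv.1] with i h1 h2
      exact (h.isLevelFamily T i).branch j k hjk _ h1 _ h2
    rcases Ultrafilter.eventually_or.1 hor with hor | hor
    · exact Or.inl (le_of_tendsto_of_tendsto hu.2 hst hor)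
    · exact Or.inr (tendsto_nhds_unique (hv.2.congr' hor) hst)

/-- The ultralimit is a solution of the average system. -/
theorem isSolution_limitArc (h : d.IsSolutionSeq 𝓤 ε x p₀) (ho : d.IsOscillating T₁ T₂ S f')
    (hb : d.BasicRegularity) (hT : 0 ≤ T) {N : ℕ} (hB : ∀ k < N, IsBddLevel 𝓤 T x k) :
    (d.average T₁ T₂).IsSolution (limitArc 𝓤 T x N) ∧ (limitArc 𝓤 T x N).val 0 0 = p₀ := by
  have hfam := h.isLevelFamily_limit ho hb hB
  have h00 : ∀ i, (0 : ℝ) ∈ (x i).truncSlice T 0 := fun i => ⟨(h.sol i).2.1, by simpa using hT⟩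
  have hzero : (0 : ℝ) ∈ limitLevel 𝓤 T x 0 := by
    have := h.limitStart_mem ho hb (j := 0) (T := T) (fun k hk => absurd hk k.not_lt_zero)
      (Eventually.of_forall fun i => ⟨0, h00 i⟩)
    rwa [h.limitStart_zero] at this
  have hval : (limitArc 𝓤 T x N).val 0 0 = p₀ :=
    tendsto_nhds_unique ((h.isFlowSeq ho T 0).tendsto_limitFun ho hb hzero
      ⟨Eventually.of_forall h00, tendsto_const_nhds⟩) h.init
  have hslice : ∀ j, (limitArc 𝓤 T x N).slice j ⊆ limitLevel 𝓤 T x j := fun j t ht => ht.2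
  refine ⟨⟨⟨hfam.isHybridTimeDomain, fun j _ a b hab hsub => ?_⟩, ⟨N.zero_le, hzero⟩, ?_,
    fun j hj => ⟨fun t ht => ?_, ?_⟩, fun t j ht ht' => ?_⟩, hval⟩
  · obtain ⟨K, hK⟩ := (h.isFlowSeq ho T j).exists_lipschitzOnWith ho hb
      (hslice j (hsub (right_mem_Icc.2 hab)))
    refine (hK.mono fun q hq => ?_).absolutelyContinuousOnInterval
    rw [uIcc_of_le hab] at hq
    exact ⟨hslice j (hsub hq), hq.2⟩
  -- Initial values on trivial levels need not lie in `C`, so closedness of the union `C ∪ D` is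
  -- used.
  · rw [hval]
    exact (hb.closed_C.union hb.closed_D).mem_of_tendsto h.init (Eventually.of_forall fun i =>
      (h.sol i).2.2.1.imp And.left And.left)
  · obtain ⟨s, hs⟩ := hj
    exact (h.isFlowSeq ho T j).limitFun_mem ho hb
      (IsFlowSeq.interior_nontrivial (interior_mono (hslice j) hs)) (hslice j ht)
  · filter_upwards [(h.isFlowSeq ho T j).ae_hasDerivAt ho hb] with t ht hts
    exact ht (hslice j hts)
  · have heq : t = limitStart 𝓤 x (j + 1) := hfam.eq_start ht ht'
    subst heq
    have hne : ∀ᶠ i in 𝓤, ((x i).truncSlice T (j + 1)).Nonempty := eventually_nonempty ⟨_, ht'.2⟩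
    have l1 := (h.isFlowSeq ho T j).tendsto_limitFun ho hb ht.2 (h.isApprox_startTime_succ ho hne)
    have l2 := (h.isFlowSeq ho T (j + 1)).tendsto_limitFun ho hb ht'.2
      (h.isApprox_startTime ho hne)
    exact (hb.osc_G.isClosed_graph hb.closed_D).mem_of_tendsto (l1.prodMk_nhds l2)
      (hne.mono fun i hi => h.jump_mem hi)

/-- Without finite escape times of the limits all levels are bounded. -/
theorem isBddLevel (h : d.IsSolutionSeq 𝓤 ε x p₀) (ho : d.IsOscillating T₁ T₂ S f')
    (hb : d.BasicRegularity) (hT : 0 ≤ T)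
    (hesc : ∀ y : HybridFun (State n₁ n₂), (d.average T₁ T₂).IsSolution y → y.val 0 0 = p₀ →
      y.NoFiniteEscape) (j : ℕ) : IsBddLevel 𝓤 T x j := by
  induction j using Nat.strong_induction_on with
  | _ j ih =>
    by_contra hcon
    have hsol := h.isSolution_limitArc ho hb hT ih
    -- The limit of the levels up to `j` is a solution even if level `j` is unbounded; its hybrid
    -- time is at most `T + j`, so it has a bound `M`.
    obtain ⟨M, hM⟩ := hesc _ hsol.1 hsol.2 ⟨T + j, by
      rintro ⟨t, k⟩ ⟨hk, ⟨u, hu⟩, -⟩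
      have h1 : t ≤ T := le_of_tendsto hu.2 (hu.1.mono fun i hi =>
        ((h.isFlowSeq ho T k).sub i hi).2)
      have h2 : (k : ℝ) ≤ j := Nat.cast_le.2 hk
      exact add_le_add h1 h2⟩
    have hbig : ∀ R : ℝ, ∀ᶠ i in 𝓤, ∃ t ∈ (x i).truncSlice T j, R < ‖((x i).val t j).1‖ := by
      intro R
      by_contra hR
      refine hcon ⟨R, ?_⟩
      filter_upwards [Ultrafilter.eventually_not.2 hR] with i hi t ht
      by_contra! hlt
      exact hi ⟨t, ht, hlt⟩
    have hne : ∀ᶠ i in 𝓤, ((x i).truncSlice T j).Nonempty :=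
      (hbig 0).mono fun i ⟨t, ht, _⟩ => ⟨t, ht⟩
    obtain ⟨R₀, hR₀⟩ := h.exists_bound_start ho hb ih hne
    -- Above the initial norms of the level, so that the norm `R` is reached by continuity, and
    -- above the bound `M`. The limit of the first times at which it is reached belongs to the limit
    -- arc and has norm `R`.
    set R := max R₀ (M + 1)
    have hfirst : ∀ᶠ i in 𝓤, ∃ e ∈ (x i).truncSlice T j, ‖((x i).val e j).1‖ = R ∧
        ∀ q ∈ (x i).truncSlice T j, q ≤ e → ‖((x i).val q j).1‖ ≤ R := by
      filter_upwards [hbig R, hR₀, hne] with i ⟨t, ht, htR⟩ hi hnei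
      have hl := (h.isLevelFamily T i).least j hnei
      have hst : (x i).startTime j < t := by
        refine lt_of_le_of_ne (hl.2 ht) fun heq => ?_
        rw [← heq] at htR
        exact absurd (hi.trans (le_max_left _ _)) (not_le.2 htR)
      have hflow := (h.isFlowSeq ho T j).flow i _ hl.1 t ht hst
      obtain ⟨e, he, heR, hele⟩ := exists_first_norm_eq hst.le hflow.cont
        (hi.trans (le_max_left R₀ (M + 1))) htR.le
      exact ⟨e, ((h.isLevelFamily T i).ord j).out hl.1 ht he, heR,
        fun q hq hqe => hele q ⟨hl.2 hq, hqe⟩⟩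
    obtain ⟨e, he⟩ := hfirst.choice
    obtain ⟨e₀, -, he₀⟩ := exists_tendsto_of_isCompact (𝓤 := 𝓤) (isCompact_Icc (a := 0) (b := T))
      (u := e) (he.mono fun i hi => (h.isFlowSeq ho T j).sub i hi.1)
    have happ : IsApprox 𝓤 (fun i => (x i).truncSlice T j) e₀ e := ⟨he.mono fun i hi => hi.1, he₀⟩
    have hmem : e₀ ∈ limitLevel 𝓤 T x j :=
      (h.isFlowSeq ho T j).mem_limitSet ho hb happ (he.mono fun i hi => hi.2.2)
    have hlim := ((h.isFlowSeq ho T j).tendsto_limitFun ho hb hmem happ).norm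
    have hnorm : R = ‖limitVal 𝓤 T x e₀ j‖ := tendsto_nhds_unique
      (tendsto_const_nhds.congr' (he.mono fun i hi => hi.2.1.symm)) hlim
    have h1 := hM (e₀, j) ⟨le_rfl, hmem⟩
    have h2 : M + 1 ≤ R := le_max_right _ _
    have h3 : ‖limitVal 𝓤 T x e₀ j‖ ≤ M := h1
    linarith

end IsSolutionSeq

end Data

/-! ### Closeness to the ultralimit -/

/-- Almost nearest points, with slack `ε i`, form one sequence that serves every `δ`. -/
theorem exists_isApprox {𝓤 : Ultrafilter ℕ} {I : ℕ → Set ℝ} {t : ℝ} {ε : ℕ → ℝ}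
    (hpos : ∀ i, 0 < ε i) (hε : Tendsto ε 𝓤 (𝓝 0))
    (h : ∀ δ > 0, ∀ᶠ i in 𝓤, ∃ q ∈ I i, dist t q < δ) : ∃ u, IsApprox 𝓤 I t u := by
  have hex : ∀ᶠ i in 𝓤, ∃ q ∈ I i, dist t q < Metric.infDist t (I i) + ε i := by
    filter_upwards [h 1 one_pos] with i ⟨q, hq, _⟩
    exact (Metric.infDist_lt_iff ⟨q, hq⟩).1 (lt_add_of_pos_right _ (hpos i))
  obtain ⟨u, hu⟩ := hex.choice
  refine ⟨u, hu.mono fun i hi => hi.1, ?_⟩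
  rw [Metric.tendsto_nhds]
  intro δ hδ
  filter_upwards [hu, h (δ / 2) (half_pos hδ), hε (Iio_mem_nhds (half_pos hδ))]
    with i hi ⟨q, hq, hqδ⟩ hεi
  have h1 : Metric.infDist t (I i) ≤ dist t q := Metric.infDist_le_dist_of_mem hq
  have h2 : ε i < δ / 2 := hεi
  rw [dist_comm]
  linarith [hi.2]

namespace Data.IsSolutionSeq

variable {n₁ n₂ : ℕ} {d : Data n₁ n₂} {T₁ T₂ : ℝ} {S : Set (State n₁ n₂)}
  {f' : State n₁ n₂ → ℝ → ℝ → (EuclideanSpace ℝ (Fin n₁) × ℝ →L[ℝ] EuclideanSpace ℝ (Fin n₁))}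
  {𝓤 : Ultrafilter ℕ} {T : ℝ} {ε : ℕ → ℝ} {x : ℕ → HybridFun (State n₁ n₂ × ℝ × ℝ)}
  {p₀ : State n₁ n₂}

theorem isCompact_limitLevel (h : d.IsSolutionSeq 𝓤 ε x p₀) (ho : d.IsOscillating T₁ T₂ S f')
    (hb : d.BasicRegularity) {j : ℕ} (hB : IsBddLevel 𝓤 T x j) :
    IsCompact (limitLevel 𝓤 T x j) := by
  refine (isCompact_Icc (a := (0 : ℝ)) (b := T)).of_isClosed_subset
    (isClosed_of_closure_subset fun t ht => ?_) ?_
  · obtain ⟨u, hu⟩ := exists_isApprox (t := t) (I := fun i => (x i).truncSlice T j) h.pos h.tendsto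
      fun δ hδ => by
        obtain ⟨s, ⟨⟨v, hv⟩, -⟩, hs⟩ := Metric.mem_closure_iff.1 ht (δ / 2) (half_pos hδ)
        filter_upwards [hv.1, Metric.tendsto_nhds.1 hv.2 (δ / 2) (half_pos hδ)] with i h1 h2
        refine ⟨v i, h1, ?_⟩
        rw [dist_comm] at h2
        linarith [dist_triangle t s (v i)]
    exact h.mem_limitLevel ho hb hB hu
  · rintro t ⟨⟨u, hu⟩, -⟩
    exact isClosed_Icc.mem_of_tendsto hu.2 (hu.1.mono fun i hi => (h.isFlowSeq ho T j).sub i hi)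

theorem continuousOn_limitVal (h : d.IsSolutionSeq 𝓤 ε x p₀) (ho : d.IsOscillating T₁ T₂ S f')
    (hb : d.BasicRegularity) {j : ℕ} (hB : IsBddLevel 𝓤 T x j) :
    ContinuousOn (fun t => limitVal 𝓤 T x t j) (limitLevel 𝓤 T x j) := by
  rcases (limitLevel 𝓤 T x j).eq_empty_or_nonempty with he | hne
  · rw [he]
    exact continuousOn_empty _
  · obtain ⟨m, hm⟩ := (h.isCompact_limitLevel ho hb hB).exists_isGreatest hne
    obtain ⟨K, hK⟩ := (h.isFlowSeq ho T j).exists_lipschitzOnWith ho hb hm.1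
    exact hK.continuousOn.mono fun t ht => ⟨ht, hm.2 ht⟩

/-- If every time of a sequence of hybrid times has a bad property, then so has eventually a
convergent sequence of times on one level. -/
theorem exists_level_tendsto {T : ℝ} {P : ℕ → ℝ → ℕ → Prop} (h0 : ∀ i t j, P i t j → 0 ≤ t)
    (hT : ∀ i t j, P i t j → t + (j : ℝ) ≤ T) (h : ∀ᶠ i in 𝓤, ∃ t j, P i t j) :
    ∃ (t : ℕ → ℝ) (t₀ : ℝ) (j : ℕ), Tendsto t 𝓤 (𝓝 t₀) ∧ ∀ᶠ i in 𝓤, P i (t i) j := by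
  obtain ⟨t, ht⟩ := h.choice
  obtain ⟨j, hj⟩ := ht.choice
  -- The level is at most `⌈T⌉₊`, and convergence in a discrete space makes it eventually constant.
  obtain ⟨⟨t₀, j₀⟩, -, hlim⟩ := exists_tendsto_of_isCompact (𝓤 := 𝓤)
    ((isCompact_Icc (a := (0 : ℝ)) (b := T)).prod (finite_Iic ⌈T⌉₊).isCompact)
    (u := fun i => (t i, j i)) (by
      filter_upwards [hj] with i hi
      have h1 := h0 _ _ _ hi
      have h2 := hT _ _ _ hi
      have h3 : (0 : ℝ) ≤ j i := (j i).cast_nonneg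
      refine ⟨⟨h1, by linarith⟩, ?_⟩
      have : (j i : ℝ) ≤ ⌈T⌉₊ := le_trans (by linarith) (Nat.le_ceil T)
      exact Nat.cast_le.1 this)
  rw [nhds_prod_eq, tendsto_prod_iff'] at hlim
  refine ⟨t, t₀, j₀, hlim.1, ?_⟩
  filter_upwards [hj, hlim.2 (mem_nhds_discrete.2 (mem_singleton j₀))] with i hi hji
  have hji : j i = j₀ := hji
  rwa [hji] at hi

/-- Times violating either half of closeness converge along the ultrafilter on a fixed level. Bad
times of the solutions have their limit in the limit level. Bad times of the limit arc do so because
that level is compact, and the limit is continuous on it. In both cases the values converge to the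
same state. -/
theorem eventually_close (h : d.IsSolutionSeq 𝓤 ε x p₀) (ho : d.IsOscillating T₁ T₂ S f')
    (hb : d.BasicRegularity) (hB : ∀ j, IsBddLevel 𝓤 T x j) {ρ : ℝ} (hρ : 0 < ρ) :
    ∀ᶠ i in 𝓤, Close T ρ ((x i).map Prod.fst) (limitArc 𝓤 T x ⌈T⌉₊) := by
  have hle : ∀ {t : ℝ} {j : ℕ}, 0 ≤ t → t + (j : ℝ) ≤ T → j ≤ ⌈T⌉₊ := fun ht hjT =>
    Nat.cast_le.1 (le_trans (by linarith) (Nat.le_ceil T))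
  refine Eventually.and ?_ ?_
  · by_contra hcon
    obtain ⟨t, t₀, j, ht, hP⟩ := exists_level_tendsto (𝓤 := 𝓤) (T := T)
      (P := fun i t j => (t, j) ∈ (x i).dom ∧ t + (j : ℝ) ≤ T ∧
        ∀ s : ℝ, (s, j) ∈ (limitArc 𝓤 T x ⌈T⌉₊).dom → |t - s| ≤ ρ →
          ρ < ‖((x i).val t j).1 - limitVal 𝓤 T x s j‖)
      (fun i t j hP => ((h.sol i).1.1 _ hP.1).1) (fun i t j hP => hP.2.1) (by
        filter_upwards [Ultrafilter.eventually_not.2 hcon] with i hi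
        by_contra! hno
        exact hi fun t j htj hT => hno t j htj hT)
    have happ : IsApprox 𝓤 (fun i => (x i).truncSlice T j) t₀ t :=
      ⟨hP.mono fun i hi => ⟨hi.1, hi.2.1⟩, ht⟩
    have hmem := h.mem_limitLevel ho hb (hB j) happ
    have hlim := (h.isFlowSeq ho T j).tendsto_limitFun ho hb hmem happ
    obtain ⟨i, hi, h1, h2⟩ := (hP.and ((Metric.tendsto_nhds.1 ht ρ hρ).and
      (Metric.tendsto_nhds.1 hlim ρ hρ))).exists
    have hjT : j ≤ ⌈T⌉₊ := hle ((h.sol i).1.1 _ hi.1).1 hi.2.1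
    have h3 := hi.2.2 t₀ ⟨hjT, hmem⟩ (by rw [← Real.dist_eq]; exact h1.le)
    rw [dist_eq_norm] at h2
    exact absurd h2 (not_lt.2 h3.le)
  · by_contra hcon
    obtain ⟨t, t₀, j, ht, hP⟩ := exists_level_tendsto (𝓤 := 𝓤) (T := T)
      (P := fun i t j => t ∈ limitLevel 𝓤 T x j ∧ t + (j : ℝ) ≤ T ∧
        ∀ s : ℝ, (s, j) ∈ (x i).dom → |t - s| ≤ ρ →
          ρ < ‖limitVal 𝓤 T x t j - ((x i).val s j).1‖)
      (fun i t j hP => by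
        obtain ⟨⟨u, hu⟩, -⟩ := hP.1
        exact ge_of_tendsto hu.2 (hu.1.mono fun i hi => ((h.isFlowSeq ho T j).sub i hi).1))
      (fun i t j hP => hP.2.1) (by
        filter_upwards [Ultrafilter.eventually_not.2 hcon] with i hi
        by_contra! hno
        exact hi fun t j htj hT => hno t j htj.2 hT)
    have hmem : t₀ ∈ limitLevel 𝓤 T x j :=
      (h.isCompact_limitLevel ho hb (hB j)).isClosed.mem_of_tendsto ht (hP.mono fun i hi => hi.1)
    obtain ⟨u, hu⟩ := hmem.1
    have hlim := (h.isFlowSeq ho T j).tendsto_limitFun ho hb hmem hu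
    have hlim' : Tendsto (fun i => limitVal 𝓤 T x (t i) j) 𝓤 (𝓝 (limitVal 𝓤 T x t₀ j)) :=
      (h.continuousOn_limitVal ho hb (hB j) t₀ hmem).tendsto.comp
        (tendsto_nhdsWithin_iff.2 ⟨ht, hP.mono fun i hi => hi.1⟩)
    have d1 : Tendsto (fun i => |t i - u i|) 𝓤 (𝓝 0) := by simpa using (ht.sub hu.2).abs
    have d2 : Tendsto (fun i => ‖limitVal 𝓤 T x (t i) j - ((x i).val (u i) j).1‖) 𝓤 (𝓝 0) := by
      have := (hlim'.sub hlim).norm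
      rwa [limitVal, sub_self, norm_zero] at this
    obtain ⟨i, hi, h1, h2, h3⟩ := (hP.and (hu.1.and ((d1.eventually_lt_const hρ).and
      (d2.eventually_lt_const hρ)))).exists
    exact absurd (hi.2.2 _ h1.1 (le_of_lt h2)) (not_lt.2 (le_of_lt h3))

end Data.IsSolutionSeq

end HybridAveraging

/-! ### The limit of a sequence of counterexamples. -/

theorem theorem1 {n₁ n₂ : ℕ} (d : HybridAveraging.Data n₁ n₂) (T₁ T₂ : ℝ)
    (hbasic : d.BasicRegularity) (hosc : d.OscillationRegularity T₁ T₂)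
    (K₀ : Set (HybridAveraging.State n₁ n₂)) (hK₀ : IsCompact K₀)
    (hesc : ∀ y : HybridAveraging.HybridFun (HybridAveraging.State n₁ n₂),
      (d.average T₁ T₂).IsSolution y → y.val 0 0 ∈ K₀ → y.NoFiniteEscape) :
    ∀ ρ > (0 : ℝ), ∀ T > (0 : ℝ), ∃ εs > (0 : ℝ), ∃ r > (0 : ℝ), ∀ ε ∈ Set.Ioo 0 εs,
      ∀ x : HybridAveraging.HybridFun (HybridAveraging.State n₁ n₂ × ℝ × ℝ),
        (d.original ε).IsSolution x →
        (x.val 0 0).1 ∈ K₀ + Metric.closedBall (0 : HybridAveraging.State n₁ n₂) r →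
        ∃ y : HybridAveraging.HybridFun (HybridAveraging.State n₁ n₂),
          (d.average T₁ T₂).IsSolution y ∧ y.val 0 0 ∈ K₀ ∧
          HybridAveraging.Close T ρ (x.map Prod.fst) y := by
  intro ρ hρ T hT
  by_contra! hcon
  obtain ⟨S, f', ho⟩ := hosc.exists_isOscillating
  have hpos : ∀ i : ℕ, (0 : ℝ) < 1 / ((i : ℝ) + 1) := fun i => Nat.one_div_pos_of_nat
  -- The same sequence `1 / (i + 1)` bounds `ε` and the radius `r`, so the initial values approach
  -- `K₀` while `ε → 0`.
  choose ε hε x hx hinit hclose using fun i : ℕ => hcon _ (hpos i) _ (hpos i)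
  let 𝓤 : Ultrafilter ℕ := hyperfilter ℕ
  have h𝓤 : (𝓤 : Filter ℕ) ≤ atTop := Nat.hyperfilter_le_atTop
  have hr : Tendsto (fun i : ℕ => 1 / ((i : ℝ) + 1)) 𝓤 (𝓝 0) :=
    tendsto_one_div_add_atTop_nhds_zero_nat.mono_left h𝓤
  choose k hk w hw hkw using fun i => Set.mem_add.1 (hinit i)
  obtain ⟨p₀, hp₀, hlim⟩ := HybridAveraging.exists_tendsto_of_isCompact (𝓤 := 𝓤) hK₀
    (Eventually.of_forall hk)
  have hseq : d.IsSolutionSeq 𝓤 ε x p₀ := by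
    refine ⟨fun i => (hε i).1, squeeze_zero (fun i => (hε i).1.le) (fun i => (hε i).2.le) hr,
      hx, ?_⟩
    have hw0 : Tendsto w 𝓤 (𝓝 0) := squeeze_zero_norm (fun i => mem_closedBall_zero_iff.1 (hw i)) hr
    simpa only [hkw, add_zero] using hlim.add hw0
  have hB := hseq.isBddLevel ho hbasic hT.le fun y hy hy0 => hesc y hy (hy0 ▸ hp₀)
  obtain ⟨i, hi⟩ := (hseq.eventually_close ho hbasic hB hρ).exists
  -- Levels above `⌈T⌉₊` contain no hybrid time with `t + j ≤ T`.
  obtain ⟨hsol, hval⟩ := hseq.isSolution_limitArc ho hbasic hT.le (N := ⌈T⌉₊) fun k _ => hB k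
  exact hclose i _ hsol (hval ▸ hp₀) hi
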